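/- Let $m,n\ge 0$ be integers, $\lambda,\gamma>0$. Write $X\in\mathbf Q_{m(n+1)}$ (real symmetric of size $m(n+1)$) in $m\times m$ blocks $X_{hk}$, $0\le h,k\le n$. Let $\mathbf M_{m,n}$ be the space of $Y=[Y_0\ \cdots\ Y_n]$ with $Y_j\in\mathbb R^{m\times m}$ and $Y_0=Y_0^T$, and let $\mathrm T(Y)$ be the symmetric block Toeplitz matrix with first block row $Y$. Put $\mathrm D_0(X)=\sum_{h=0}^n X_{hh}$ and $\mathrm D_j(X)=2\sum_{h=0}^{n-j}X_{h,h+j}$ for $1\le j\le n$, $\langle A,B\rangle=\operatorname{tr}(AB^*)$, and $$h_\infty(Y)=\sum_{k>h}\ \max_{0\le j\le n}\max\{|(Y_j)_{kh}|,|(Y_j)_{hk}|\}.$$ Let $\Delta(e^{i\vartheta})=[I_m\ e^{i\vartheta}I_m\ \cdots\ e^{in\vartheta}I_m]$, let $\int$ be integration over the unit circle against normalized Lebesgue measure, and let $\mathcal Q_{m,n}$ be the set of functions $\sum_{j=-n}^n e^{-ij\vartheta}S_j$ with $S_j=S_{-j}^T\in\mathbb R^{m\times m}$. For such a function $\Sigma$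 put $\phi_1(\Sigma)=h_\infty([S_0\ 2S_1\ \cdots\ 2S_n])$, so that $\phi_1(\Delta X\Delta^*)=h_\infty(\mathrm D(X))$, and let $\phi_*(\Lambda)=\sum_{k=1}^m\int\sigma_k(\Lambda)$, where $\sigma_k$ are the singular values. Let $\hat R\in\mathbf M_{m,n}$ with $\mathrm T(\hat R)\succ0$, and let $\hat\Phi_m=\sum_{j=-n}^n e^{-ij\vartheta}\hat R_j$ with $\hat R_{-j}=\hat R_j^T$. Consider the regularized sparse plus low-rank problem $$(\mathrm A)\quad \min_{\Sigma,\Lambda\in\mathcal Q_{m,n}}\ \int\bigl(-\log\det(\Sigma-\Lambda)+\langle\Sigma-\Lambda,\hat\Phi_m\rangle\bigr)+\lambda\bigl(\gamma\phi_1(\Sigma)+\phi_*(\Lambda)\bigr)\quad\text{s.t. }\Sigma-\Lambda\succ0,\ \Lambda\succeq0\text{ on the unit circle,}$$ the matrix primal problem $$(\mathrm B)\quad \min_{X,L\in\mathbf Q_{m(n+1)}}\ -\log\det X_{00}+\langle \mathrm T(\hat R),X\rangle+\lambda\gamma h_\infty(\mathrm D(X+L))+\lambda\operatorname{tr}L\quad\text{s.t.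 }X_{00}\succ0,\ X\succeq0,\ L\succeq0,$$ and its dual, over symmetric $W\in\mathbb R^{m\times m}$ and $Z\in\mathbf M_{m,n}$, $$(\mathrm C)\quad \max_{W,Z}\ \log\det W+m\quad\text{s.t. }W\succ0,\ \mathrm T(\hat R)+\mathrm T(Z)\succeq\begin{bmatrix}W&0\\0&0\end{bmatrix},\ \operatorname{diag}(Z_j)=0\ (0\le j\le n),$$ $$\sum_{j=0}^n\bigl(|(Z_j)_{kh}|+|(Z_j)_{hk}|\bigr)\le\lambda\gamma\ (k\ne h),\quad \lambda I+\mathrm T(Z)\succeq0.$$ Then: 1. (B) has a solution $(X^\circ,L^\circ)$ such that $\Delta X^\circ\Delta^*\succ0$ on the unit circle, and $X^\circ$ is unique: every solution of (B) has the same $X$-component $X^\circ$. 2. (C) has a solution, and for every solution $(W^\circ,Z^\circ)$ of (C) the Yule–Walker equations $$(\mathrm T(\hat R)+\mathrm T(Z^\circ))B^T=\begin{bmatrix}W^\circ\\0\end{bmatrix},\qquad B_0=I,$$ have a unique solution $B=[B_0\ \cdots\ B_n]\in\mathbb R^{m\times m(n+1)}$, and $X^\circ=B^T(W^\circ)^{-1}B$.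 3. (A) and (B) are equivalent: if $(X,L)$ solves (B), then $(\Sigma,\Lambda)=(\Delta(X+L)\Delta^*,\Delta L\Delta^*)$ solves (A), with the same objective value; conversely, every solution of (A) is of this form for some solution $(X,L)$ of (B). In particular (A) has a solution. -/

import Mathlib

open scoped Matrix ComplexOrder

noncomputable section

namespace ARLatent

/-- Square real matrices of size `m(n+1)`, split into `(n+1) × (n+1)` blocks of size `m × m`:
the entry `X (h, a) (k, b)` is the entry `(a, b)` of the block `X_{hk}`. -/
abbrev BlockMat (m n : ℕ) := Matrix (Fin (n + 1) × Fin m) (Fin (n + 1) × Fin m) ℝ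

/-- The block `X_{hk}`. -/
def block {m n : ℕ} (X : BlockMat m n) (h k : Fin (n + 1)) : Matrix (Fin m) (Fin m) ℝ :=
  Matrix.of fun a b => X (h, a) (k, b)

/-- The block rows `Y = [Y_0 Y_1 … Y_n]` of `m × m` real matrices with `Y_0` symmetric. -/
def blockRows (m n : ℕ) : Set (Fin (n + 1) → Matrix (Fin m) (Fin m) ℝ) :=
  {Y | (Y 0).IsSymm}

/-- The two-sided sequence attached to `Y`: `Y_j` for `0 ≤ j ≤ n`, `Y_{-j}ᵀ` for `-n ≤ j < 0`,
and `0` for `|j| > n`. -/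
def twoSided {m n : ℕ} (Y : Fin (n + 1) → Matrix (Fin m) (Fin m) ℝ) (j : ℤ) :
    Matrix (Fin m) (Fin m) ℝ :=
  if hj : j.natAbs < n + 1 then
    if 0 ≤ j then Y ⟨j.natAbs, hj⟩ else (Y ⟨j.natAbs, hj⟩)ᵀ
  else 0

/-- The block Toeplitz matrix `T(Y)` with first block row `Y`: its block `(h, k)` is `Y_{k-h}` for
`h ≤ k` and `Y_{h-k}ᵀ` for `h > k`. -/
def toeplitz {m n : ℕ} (Y : Fin (n + 1) → Matrix (Fin m) (Fin m) ℝ) : BlockMat m n :=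
  Matrix.of fun p q => twoSided Y ((q.1 : ℤ) - (p.1 : ℤ)) p.2 q.2

/-- The map `D`: `D_0(X) = ∑_h X_{hh}` and `D_j(X) = 2 ∑_{h=0}^{n-j} X_{h,h+j}` for `1 ≤ j ≤ n`. -/
def adjT {m n : ℕ} (X : BlockMat m n) (j : Fin (n + 1)) : Matrix (Fin m) (Fin m) ℝ :=
  (if j = 0 then (1 : ℝ) else 2) •
    ∑ h : Fin (n + 1), ∑ k : Fin (n + 1),
      if (k : ℕ) = (h : ℕ) + (j : ℕ) then block X h k else 0

/-- `h_∞(Y) = ∑_{k>h} max_{0 ≤ j ≤ n} max {|(Y_j)_{kh}|, |(Y_j)_{hk}|}`. -/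
def hInf {m n : ℕ} (Y : Fin (n + 1) → Matrix (Fin m) (Fin m) ℝ) : ℝ :=
  ∑ h : Fin m, ∑ k : Fin m,
    if h < k then ⨆ j : Fin (n + 1), max |Y j k h| |Y j h k| else 0

/-! ### Functions on the unit circle, written as functions of the angle `θ` -/

/-- Integral over the unit circle against the normalized Lebesgue measure. -/
def circleMean {E : Type*} [NormedAddCommGroup E] [NormedSpace ℝ E] (f : ℝ → E) : E :=
  (2 * Real.pi)⁻¹ • ∫ θ in (-Real.pi)..Real.pi, f θ

/-- `θ ↦ ∑_{j=-n}^n e^{-ijθ} R_j`. -/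
def trigPoly {m : ℕ} (n : ℕ) (R : ℤ → Matrix (Fin m) (Fin m) ℝ) (θ : ℝ) :
    Matrix (Fin m) (Fin m) ℂ :=
  ∑ j ∈ Finset.Icc (-(n : ℤ)) (n : ℤ),
    Complex.exp (-(Complex.I * (j : ℂ) * (θ : ℂ))) • (R j).map Complex.ofReal

/-- The family `𝒬_{m,n}` of matrix pseudo-polynomials. -/
def pseudoPolys (m n : ℕ) : Set (ℝ → Matrix (Fin m) (Fin m) ℂ) :=
  {S | ∃ R : ℤ → Matrix (Fin m) (Fin m) ℝ, (∀ j, R j = (R (-j))ᵀ) ∧ S = trigPoly n R}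

/-- The windowed correlogram `∑_{j=-n}^n e^{-ijθ} R_j`, with `R_{-j} = R_jᵀ`. -/
def correlogram {m n : ℕ} (R : Fin (n + 1) → Matrix (Fin m) (Fin m) ℝ) :
    ℝ → Matrix (Fin m) (Fin m) ℂ :=
  trigPoly n (twoSided R)

/-- The coefficient of `e^{-ijθ}` in `S`, computed as a Fourier integral. For `S` in `𝒬_{m,n}`
this coefficient is a real matrix, so taking real parts loses nothing. -/
def coeff {m : ℕ} (S : ℝ → Matrix (Fin m) (Fin m) ℂ) (j : ℕ) : Matrix (Fin m) (Fin m) ℝ :=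
  Matrix.of fun a b =>
    (circleMean fun θ => Complex.exp (Complex.I * (j : ℂ) * (θ : ℂ)) * S θ a b).re

/-- The shift operator `Δ(e^{iθ}) = [I, e^{iθ} I, …, e^{inθ} I]`. -/
def shiftOp (m n : ℕ) (θ : ℝ) : Matrix (Fin m) (Fin (n + 1) × Fin m) ℂ :=
  Matrix.of fun a p =>
    if a = p.2 then Complex.exp (Complex.I * ((p.1 : ℕ) : ℂ) * (θ : ℂ)) else 0

/-- The function `Δ X Δ*`. -/
def shiftConj {m n : ℕ} (X : BlockMat m n) (θ : ℝ) : Matrix (Fin m) (Fin m) ℂ :=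
  shiftOp m n θ * X.map Complex.ofReal * (shiftOp m n θ)ᴴ

/-- The sparsity regularizer `φ_1(S) = h_∞(Y)` with `Y_0 = S_0` and `Y_j = 2 S_j` for
`1 ≤ j ≤ n`, where `S = ∑_{j=-n}^n e^{-ijθ} S_j`. Since `Δ X Δ*` has coefficients
`D_0(X)` and `D_j(X) / 2`, this gives `φ_1(Δ X Δ*) = h_∞(D(X))` for every symmetric `X`. -/
def phiOne {m : ℕ} (n : ℕ) (S : ℝ → Matrix (Fin m) (Fin m) ℂ) : ℝ :=
  hInf fun j : Fin (n + 1) => (if j = 0 then (1 : ℝ) else 2) • coeff S (j : ℕ)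

/-- The low-rank regularizer `φ_*(S)`: the integral over the circle of the sum of all the singular
values of `S(e^{iθ})`. -/
def phiStar {m : ℕ} (S : ℝ → Matrix (Fin m) (Fin m) ℂ) : ℝ :=
  circleMean fun θ =>
    ∑ k ∈ Finset.range m, (Matrix.toEuclideanLin (S θ)).singularValues k

/-! ### The three optimization problems -/

/-- `p` is a minimizer of `f` over the set `s`. -/
def IsArgmin {α : Type*} (f : α → ℝ) (s : Set α) (p : α) : Prop := p ∈ s ∧ IsMinOn f s p

/-- `p` is a maximizer of `f` over the set `s`. -/
def IsArgmax {α : Type*} (f : α → ℝ) (s : Set α) (p : α) : Prop := p ∈ s ∧ IsMaxOn f s p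

/-- Constraints of the regularized sparse plus low-rank problem: `Σ, Λ ∈ 𝒬_{m,n}` with
`Σ - Λ ≻ 0` and `Λ ⪰ 0` on the unit circle. -/
def spectralFeasible (m n : ℕ) :
    Set ((ℝ → Matrix (Fin m) (Fin m) ℂ) × (ℝ → Matrix (Fin m) (Fin m) ℂ)) :=
  {p | p.1 ∈ pseudoPolys m n ∧ p.2 ∈ pseudoPolys m n ∧
    (∀ θ, (p.1 θ - p.2 θ).PosDef) ∧ ∀ θ, (p.2 θ).PosSemidef}

/-- Objective of the regularized sparse plus low-rank problem. -/
def spectralObjective {m n : ℕ} (R : Fin (n + 1) → Matrix (Fin m) (Fin m) ℝ) (lam gam : ℝ)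
    (p : (ℝ → Matrix (Fin m) (Fin m) ℂ) × (ℝ → Matrix (Fin m) (Fin m) ℂ)) : ℝ :=
  (circleMean fun θ =>
    -Real.log (p.1 θ - p.2 θ).det.re + ((p.1 θ - p.2 θ) * (correlogram R θ)ᴴ).trace.re) +
  lam * (gam * phiOne n p.1 + phiStar p.2)

/-- Constraints of the matrix primal problem. -/
def primalFeasible (m n : ℕ) : Set (BlockMat m n × BlockMat m n) :=
  {p | (block p.1 0 0).PosDef ∧ p.1.PosSemidef ∧ p.2.PosSemidef}

/-- Objective of the matrix primal problem. -/
def primalObjective {m n : ℕ} (R : Fin (n + 1) → Matrix (Fin m) (Fin m) ℝ) (lam gam : ℝ)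
    (p : BlockMat m n × BlockMat m n) : ℝ :=
  -Real.log (block p.1 0 0).det + (toeplitz R * p.1ᵀ).trace +
    lam * gam * hInf (adjT (p.1 + p.2)) + lam * p.2.trace

/-- The block matrix with `W` in block `(0, 0)` and `0` in all other blocks. -/
def corner {m : ℕ} (n : ℕ) (W : Matrix (Fin m) (Fin m) ℝ) : BlockMat m n :=
  Matrix.of fun p q => if p.1 = 0 ∧ q.1 = 0 then W p.2 q.2 else 0

/-- Constraints of the dual problem, in the variables `(W, Z)`. -/
def dualFeasible {m n : ℕ} (R : Fin (n + 1) → Matrix (Fin m) (Fin m) ℝ) (lam gam : ℝ) :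
    Set (Matrix (Fin m) (Fin m) ℝ × (Fin (n + 1) → Matrix (Fin m) (Fin m) ℝ)) :=
  {p | p.2 ∈ blockRows m n ∧ p.1.PosDef ∧
    (toeplitz R + toeplitz p.2 - corner n p.1).PosSemidef ∧
    (∀ j a, p.2 j a a = 0) ∧
    (∀ k h : Fin m, k ≠ h → ∑ j, (|p.2 j k h| + |p.2 j h k|) ≤ lam * gam) ∧
    (lam • (1 : BlockMat m n) + toeplitz p.2).PosSemidef}

/-- Objective of the dual problem. -/
def dualObjective {m n : ℕ}
    (p : Matrix (Fin m) (Fin m) ℝ × (Fin (n + 1) → Matrix (Fin m) (Fin m) ℝ)) : ℝ :=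
  Real.log p.1.det + (m : ℝ)

/-- The block column with `W` in block `0` and `0` in the other blocks. -/
def firstCol {m : ℕ} (n : ℕ) (W : Matrix (Fin m) (Fin m) ℝ) :
    Matrix (Fin (n + 1) × Fin m) (Fin m) ℝ :=
  Matrix.of fun p b => if p.1 = 0 then W p.2 b else 0

/-- `B = [B_0 … B_n]` solves the Yule–Walker equations
`(T(R) + T(Z)) Bᵀ = [W; 0; …; 0]`, `B_0 = I`. -/
def IsYuleWalker {m n : ℕ} (R Z : Fin (n + 1) → Matrix (Fin m) (Fin m) ℝ)
    (W : Matrix (Fin m) (Fin m) ℝ) (B : Matrix (Fin m) (Fin (n + 1) × Fin m) ℝ) : Prop :=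
  (toeplitz R + toeplitz Z) * Bᵀ = firstCol n W ∧
    (Matrix.of fun a b => B a (0, b)) = (1 : Matrix (Fin m) (Fin m) ℝ)

end ARLatent

end

/-! The plan is to solve (B) and (C) by convex duality, and then to compare (A) with (C) directly
instead of with (B).

(B) has a minimizer by compactness (`exists_primal_argmin`). Outside the log-determinant its
objective is sublinear, so the first-order condition at a minimizer (X, L) says that W = X₀₀⁻¹
defines a linear functional dominated by a sublinear one. Separation of convex sets turns this
domination into a multiplier Z with (W, Z) feasible for (C) and no duality gap (`exists_multiplier`,
`exists_dual_of_primal`). Zero gap forces X₀₀W = 1 and (T(R) + T(Z) - corner W)X = 0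
(`dual_le_primal`). Dual feasibility and the Toeplitz structure make T(R) + T(Z) positive definite
(`toep_posDef_of_corner_le`), so these identities determine X = BᵀW⁻¹B from the Yule–Walker solution
B (`yuleWalker_of_complementary`). Fixing one dual optimum and varying the primal solution gives
uniqueness of X; fixing X and varying the dual optimum gives the statement on (C).

The link with the circle is the theory of autoregressive densities. If P is block Toeplitz, positive
definite, and PBᵀ = [W; 0; …; 0], then A(z) = ∑ zᵏBₖᵀ is invertible on the closed unit disc
(`polyVal_mulVec_eq_zero`). Hence ΔXΔ* is positive definite, the mean of its log-determinant is -log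
det W (`circleMean_log_det`), and the Fourier coefficients of (ΔXΔ*)⁻¹ up to lag n are the blocks of
P (`fourierRe_shiftConj_inv`). Integrating the pointwise inequality log det Q + m ≤ -log det S +
tr(SQ) with Q = (ΔXΔ*)⁻¹ bounds (A) below by (C), and equality forces Σ - Λ = ΔXΔ*
(`dual_le_spectral`). Since ΔXΔ* realizes the value of (B), all three optimal values agree. To
return from (A) to (B), a nonnegative Λ is written as ΔLΔ* with L ⪰ 0
(`exists_posSemidef_shiftConj_eq`), again by separation, with the same densities providing the
contradiction. -/

open scoped Matrix ComplexOrder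

noncomputable section

namespace ARLatent

/-! ### Positive semidefinite matrices: trace pairing and log-determinant inequalities. -/

section MatrixLemmas

variable {𝕜 ι : Type*} [RCLike 𝕜] [Fintype ι] [DecidableEq ι]

open scoped MatrixOrder in
theorem posSemidef_factor {M : Matrix ι ι 𝕜} (hM : M.PosSemidef) :
    ∃ C : Matrix ι ι 𝕜, M = Cᴴ * C := by
  obtain ⟨C, hC⟩ := CStarAlgebra.nonneg_iff_eq_star_mul_self.mp (Matrix.nonneg_iff_posSemidef.mpr hM)
  exact ⟨C, hC⟩

theorem trace_mul_re_nonneg {M N : Matrix ι ι 𝕜} (hM : M.PosSemidef) (hN : N.PosSemidef) :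
    0 ≤ RCLike.re (M * N).trace := by
  obtain ⟨C, rfl⟩ := posSemidef_factor hM
  rw [Matrix.mul_assoc, Matrix.trace_mul_comm]
  have := (hN.mul_mul_conjTranspose_same C).trace_nonneg
  exact (RCLike.nonneg_iff.mp this).1

/-- Complementary slackness. With M = CᴴC and N = DᴴD the trace is that of (DCᴴ)ᴴ(DCᴴ), so it
vanishes only if DCᴴ = 0. -/
theorem mul_eq_zero_of_trace_mul_re {M N : Matrix ι ι 𝕜} (hM : M.PosSemidef)
    (hN : N.PosSemidef) (h : RCLike.re (M * N).trace = 0) : M * N = 0 := by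
  obtain ⟨C, rfl⟩ := posSemidef_factor hM
  obtain ⟨D, rfl⟩ := posSemidef_factor hN
  have hp := hN.mul_mul_conjTranspose_same C
  have h0 : (C * (Dᴴ * D) * Cᴴ).trace = 0 := by
    rw [Matrix.mul_assoc, Matrix.trace_mul_comm] at h
    obtain ⟨h1, h2⟩ := RCLike.nonneg_iff.mp hp.trace_nonneg
    refine RCLike.ext ?_ ?_
    · simpa using h
    · simpa using h2
  have h1 : (D * Cᴴ)ᴴ * (D * Cᴴ) = 0 := by
    have := hp.trace_eq_zero_iff.mp h0
    simpa [Matrix.mul_assoc] using this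
  have h2 : D * Cᴴ = 0 := Matrix.conjTranspose_mul_self_eq_zero.mp h1
  have h3 : C * Dᴴ = 0 := by simpa using congrArg Matrix.conjTranspose h2
  rw [Matrix.mul_assoc, ← Matrix.mul_assoc C, h3]; simp

/-- Sum log t ≤ t - 1 over the eigenvalues; strictness for t ≠ 1 gives the equality case below. -/
theorem log_det_le_trace_sub_card {M : Matrix ι ι 𝕜} (hM : M.PosDef) :
    Real.log (RCLike.re M.det) ≤ RCLike.re M.trace - Fintype.card ι := by
  have hp := hM.eigenvalues_pos
  rw [hM.1.det_eq_prod_eigenvalues, hM.1.trace_eq_sum_eigenvalues, ← RCLike.ofReal_prod,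
    ← RCLike.ofReal_sum, RCLike.ofReal_re, RCLike.ofReal_re,
    Real.log_prod (fun i _ => (hp i).ne')]
  have : ∑ i, Real.log (hM.1.eigenvalues i) ≤ ∑ i, (hM.1.eigenvalues i - 1) :=
    Finset.sum_le_sum fun i _ => Real.log_le_sub_one_of_pos (hp i)
  simpa using this

theorem eq_one_of_log_det_eq {M : Matrix ι ι 𝕜} (hM : M.PosDef)
    (h : Real.log (RCLike.re M.det) = RCLike.re M.trace - Fintype.card ι) : M = 1 := by
  have hp := hM.eigenvalues_pos
  rw [hM.1.det_eq_prod_eigenvalues, hM.1.trace_eq_sum_eigenvalues, ← RCLike.ofReal_prod,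
    ← RCLike.ofReal_sum, RCLike.ofReal_re, RCLike.ofReal_re,
    Real.log_prod (fun i _ => (hp i).ne')] at h
  have h' : ∑ i, Real.log (hM.1.eigenvalues i) = ∑ i, (hM.1.eigenvalues i - 1) := by
    simpa using h
  have h1 := (Finset.sum_eq_sum_iff_of_le
    (fun i _ => Real.log_le_sub_one_of_pos (hp i))).mp h'
  have h2 : hM.1.eigenvalues = fun _ => 1 := by
    funext i
    by_contra hne
    exact absurd (h1 i (Finset.mem_univ i)) (Real.log_lt_sub_one_of_pos (hp i) hne).ne
  have h3 := hM.1.spectral_theorem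
  rw [h2] at h3
  rw [h3]
  have : (RCLike.ofReal ∘ fun _ : ι => (1 : ℝ)) = fun _ => (1 : 𝕜) := by ext; simp
  rw [this, Matrix.diagonal_one, map_one]

theorem isUnit_of_posDef_conjTranspose_mul_self {C : Matrix ι ι 𝕜} (h : (Cᴴ * C).PosDef) :
    IsUnit C := by
  have := h.isUnit
  rw [Matrix.isUnit_iff_isUnit_det, Matrix.det_mul] at this
  rw [Matrix.isUnit_iff_isUnit_det]
  exact isUnit_of_mul_isUnit_right this

theorem re_det_pos {M : Matrix ι ι 𝕜} (hM : M.PosDef) : 0 < RCLike.re M.det :=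
  (RCLike.pos_iff.mp hM.det_pos).1

theorem re_det_mul {M N : Matrix ι ι 𝕜} (hM : M.PosDef) :
    RCLike.re (M * N).det = RCLike.re M.det * RCLike.re N.det := by
  rw [Matrix.det_mul, RCLike.mul_re, (RCLike.pos_iff.mp hM.det_pos).2]; simp

/-- Fenchel inequality for -log det, the source of every weak duality bound below. Writing Q = CᴴC,
the matrix CSCᴴ has the determinant and trace of SQ, which reduces the claim to
`log_det_le_trace_sub_card`. -/
theorem log_det_add_le {S Q : Matrix ι ι 𝕜} (hS : S.PosDef) (hQ : Q.PosDef) :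
    Real.log (RCLike.re Q.det) + Fintype.card ι ≤
      -Real.log (RCLike.re S.det) + RCLike.re (S * Q).trace := by
  have e := re_det_mul (N := Q) hS
  obtain ⟨C, rfl⟩ := posSemidef_factor hQ.posSemidef
  have hC := isUnit_of_posDef_conjTranspose_mul_self hQ
  have hM : (C * S * Cᴴ).PosDef := by
    have := (Matrix.IsUnit.posDef_star_right_conjugate_iff (x := S) hC).mpr hS
    exact this
  have h1 := log_det_le_trace_sub_card hM
  have h2 : (C * S * Cᴴ).trace = (S * (Cᴴ * C)).trace := by
    rw [Matrix.mul_assoc, Matrix.trace_mul_comm, Matrix.mul_assoc]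
  have h3 : (C * S * Cᴴ).det = (S * (Cᴴ * C)).det := by
    simp only [Matrix.det_mul]; ring
  rw [h2, h3, e, Real.log_mul (re_det_pos hS).ne' (re_det_pos hQ).ne'] at h1
  linarith

theorem mul_eq_one_of_log_det_eq {S Q : Matrix ι ι 𝕜} (hS : S.PosDef) (hQ : Q.PosDef)
    (h : Real.log (RCLike.re Q.det) + Fintype.card ι =
      -Real.log (RCLike.re S.det) + RCLike.re (S * Q).trace) : S * Q = 1 := by
  have e := re_det_mul (N := Q) hS
  obtain ⟨C, rfl⟩ := posSemidef_factor hQ.posSemidef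
  have hC := isUnit_of_posDef_conjTranspose_mul_self hQ
  have hM : (C * S * Cᴴ).PosDef := by
    have := (Matrix.IsUnit.posDef_star_right_conjugate_iff (x := S) hC).mpr hS
    exact this
  have h2 : (C * S * Cᴴ).trace = (S * (Cᴴ * C)).trace := by
    rw [Matrix.mul_assoc, Matrix.trace_mul_comm, Matrix.mul_assoc]
  have h3 : (C * S * Cᴴ).det = (S * (Cᴴ * C)).det := by
    simp only [Matrix.det_mul]; ring
  have h1 : C * S * Cᴴ = 1 := by
    refine eq_one_of_log_det_eq hM ?_
    rw [h2, h3, e, Real.log_mul (re_det_pos hS).ne' (re_det_pos hQ).ne']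
    linarith
  have h4 : S * Cᴴ * C = 1 := by
    rw [Matrix.mul_assoc] at h1
    exact mul_eq_one_comm.mp h1
  rw [← Matrix.mul_assoc, h4]

/-- Testing on eᵢ ± eⱼ gives 2|Mᵢⱼ| ≤ Mᵢᵢ + Mⱼⱼ. This is what makes trace-bounded sets of positive
semidefinite matrices compact. -/
theorem abs_apply_le_trace {M : Matrix ι ι ℝ} (hM : M.PosSemidef) (i j : ι) :
    |M i j| ≤ M.trace := by
  have hd : ∀ i, 0 ≤ M i i := fun i => hM.diag_nonneg
  have key : ∀ s : ℝ, 0 ≤ M i i + 2 * s * M i j + s ^ 2 * M j j := by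
    intro s
    have := hM.dotProduct_mulVec_nonneg (Pi.single i 1 + s • Pi.single j 1)
    have hs : M j i = M i j := by simpa using hM.1.apply i j
    simp [Matrix.mulVec_add, Matrix.mulVec_smul] at this
    rw [hs] at this
    linear_combination this
  have htr : M i i ≤ M.trace := Finset.single_le_sum (f := fun i => M i i) (fun i _ => hd i) (Finset.mem_univ i)
  have htr' : M j j ≤ M.trace := Finset.single_le_sum (f := fun i => M i i) (fun i _ => hd i) (Finset.mem_univ j)
  have h1 := key 1
  have h2 := key (-1)
  rw [abs_le]; constructor <;> nlinarith

theorem exists_posSemidef_sub_smul_one {M : Matrix ι ι ℝ} (hM : M.PosDef) :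
    ∃ c : ℝ, 0 < c ∧ (M - c • 1).PosSemidef := by
  obtain ⟨c, hc, hle⟩ : ∃ c : ℝ, 0 < c ∧ ∀ i, c ≤ hM.1.eigenvalues i := by
    rcases isEmpty_or_nonempty ι with h | h
    · exact ⟨1, one_pos, fun i => h.elim i⟩
    · obtain ⟨i, hi⟩ := Finite.exists_min hM.1.eigenvalues
      exact ⟨_, hM.eigenvalues_pos i, hi⟩
  refine ⟨c, hc, ?_⟩
  have h3 := hM.1.spectral_theorem
  have h4 : M - c • 1 = Unitary.conjStarAlgAut ℝ _ hM.1.eigenvectorUnitary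
      (Matrix.diagonal (fun i => hM.1.eigenvalues i - c)) := by
    have : (Matrix.diagonal (fun i => hM.1.eigenvalues i - c) : Matrix ι ι ℝ) =
        Matrix.diagonal (RCLike.ofReal ∘ hM.1.eigenvalues) - c • 1 := by
      ext i j; by_cases h : i = j <;> simp [Matrix.diagonal, h]
    rw [this, map_sub, ← h3, map_smul, map_one]
  rw [h4, Unitary.conjStarAlgAut_apply]
  exact (Matrix.PosSemidef.diagonal (fun i => sub_nonneg.mpr (hle i))).mul_mul_conjTranspose_same _

/-- The representing matrix is symmetrized, which does not change its pairing with symmetric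
matrices. Separating functionals thereby become candidates for primal variables. -/
theorem exists_trace_repr (f : Matrix ι ι ℝ →ₗ[ℝ] ℝ) :
    ∃ X : Matrix ι ι ℝ, X.IsSymm ∧ ∀ M : Matrix ι ι ℝ, M.IsSymm → f M = (M * X).trace := by
  set Y : Matrix ι ι ℝ := Matrix.of fun i j => f (Matrix.single i j 1) with hY
  have h1 : ∀ M : Matrix ι ι ℝ, f M = (M * Yᵀ).trace := by
    intro M
    conv_lhs => rw [Matrix.matrix_eq_sum_single M]
    simp only [map_sum, Matrix.trace, Matrix.diag, Matrix.mul_apply, Matrix.transpose_apply]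
    refine Finset.sum_congr rfl fun i _ => Finset.sum_congr rfl fun j _ => ?_
    have : Matrix.single i j (M i j) = (M i j) • Matrix.single i j (1 : ℝ) := by
      simp
    rw [this, map_smul, smul_eq_mul]; rfl
  refine ⟨(1 / 2 : ℝ) • (Y + Yᵀ), ?_, fun M hM => ?_⟩
  · simp [Matrix.IsSymm, add_comm]
  · have h2 : (M * Y).trace = (M * Yᵀ).trace := by
      rw [← Matrix.trace_transpose, Matrix.transpose_mul, hM.eq, Matrix.trace_mul_comm]
    rw [h1 M, Matrix.mul_smul, Matrix.mul_add, Matrix.trace_smul, Matrix.trace_add, h2]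
    simp; ring

/-- Self-duality of the cone: test against the rank-one matrices vvᵀ. -/
theorem posSemidef_of_trace_nonneg {κ : Type*} [Fintype κ] {X : Matrix κ κ ℝ} (hX : X.IsSymm)
    (h : ∀ M : Matrix κ κ ℝ, M.PosSemidef → 0 ≤ (M * X).trace) : X.PosSemidef := by
  refine Matrix.PosSemidef.of_dotProduct_mulVec_nonneg ?_ fun v => ?_
  · rw [Matrix.IsHermitian, Matrix.conjTranspose_eq_transpose_of_trivial]; exact hX
  · have := h _ (Matrix.posSemidef_vecMulVec_self_star v)
    rw [Matrix.trace_mul_comm, Matrix.mul_vecMulVec, Matrix.trace_vecMulVec,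
      dotProduct_comm] at this
    exact this

-- Singular values are square roots of the eigenvalues of T*T. In an eigenbasis of A that operator
-- is diagonal with entries dᵢ², and comparing characteristic roots as multisets avoids matching the
-- two orderings.
open Polynomial in
theorem sum_singularValues_eq_trace {m : ℕ} {A : Matrix (Fin m) (Fin m) 𝕜} (hA : A.PosSemidef) :
    ∑ k ∈ Finset.range m, (Matrix.toEuclideanLin A).singularValues k = RCLike.re A.trace := by
  set T := Matrix.toEuclideanLin A with hT
  have hn : Module.finrank 𝕜 (EuclideanSpace 𝕜 (Fin m)) = m := by simp
  have hsym : T.IsSymmetric := Matrix.isSymmetric_toEuclideanLin_iff.mpr hA.1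
  have hadj : LinearMap.adjoint T = T := LinearMap.isSymmetric_iff_isSelfAdjoint _ |>.mp hsym
  set d := hA.1.eigenvalues
  set b := hA.1.eigenvectorBasis
  have hTb : ∀ i, T (b i) = (d i : 𝕜) • b i := by
    intro i
    have := hA.1.mulVec_eigenvectorBasis i
    apply (WithLp.ofLp_injective 2)
    rw [hT, Matrix.ofLp_toLpLin, Matrix.toLin'_apply]
    simp only [WithLp.ofLp_smul]
    rw [this]
    ext x
    simp only [Pi.smul_apply, RCLike.real_smul_eq_coe_mul, smul_eq_mul]
    rfl
  have hmat : LinearMap.toMatrix b.toBasis b.toBasis (LinearMap.adjoint T ∘ₗ T) =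
      Matrix.diagonal fun i => ((d i ^ 2 : ℝ) : 𝕜) := by
    ext i j
    rw [LinearMap.toMatrix_apply, hadj]
    simp only [LinearMap.comp_apply, OrthonormalBasis.coe_toBasis, hTb, map_smul,
      Matrix.diagonal_apply]
    rw [smul_smul]
    have : b.toBasis.repr (b j) = Finsupp.single j 1 := by
      rw [← b.coe_toBasis, Module.Basis.repr_self]
    rw [this]
    by_cases h : i = j
    · subst h; simp [sq]
    · simp [h]
  have hroots : (LinearMap.adjoint T ∘ₗ T).charpoly.roots =
      Multiset.map (fun i => ((d i ^ 2 : ℝ) : 𝕜)) Finset.univ.val := by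
    have hr : ∀ e : Fin m → 𝕜, (∏ i, (X - C (e i))).roots = Multiset.map e Finset.univ.val := by
      intro e
      rw [Polynomial.roots_prod _ _ (by
        simp [Finset.prod_ne_zero_iff, Polynomial.X_sub_C_ne_zero])]
      simp
    rw [← LinearMap.charpoly_toMatrix _ b.toBasis, hmat, Matrix.charpoly_diagonal, hr]
  have hroots' := T.isSymmetric_adjoint_comp_self.roots_charpoly_eq_eigenvalues hn
  rw [hroots] at hroots'
  have h5 := congrArg (fun s => (Multiset.map (fun z : 𝕜 => √(RCLike.re z)) s).sum) hroots'
  simp only [Multiset.map_map, Function.comp_def, RCLike.ofReal_re] at h5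
  rw [Finset.sum_range]
  simp only [T.singularValues_fin hn]
  rw [hA.1.trace_eq_sum_eigenvalues, ← RCLike.ofReal_sum, RCLike.ofReal_re]
  refine Eq.trans h5.symm ?_
  change ∑ i, √(d i ^ 2) = _
  exact Finset.sum_congr rfl fun i _ => Real.sqrt_sq (hA.eigenvalues_nonneg i)

end MatrixLemmas

/-! ### Block Toeplitz matrices, block-diagonal sums and the pairing between T and D. -/

section BlockToeplitz

variable {m n : ℕ}

/-- The block Toeplitz matrix with block `(h, k)` equal to `F (k - h)`. -/
def toep {α : Type*} (n : ℕ) (F : ℤ → Matrix (Fin m) (Fin m) α) :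
    Matrix (Fin (n + 1) × Fin m) (Fin (n + 1) × Fin m) α :=
  Matrix.of fun p q => F ((q.1 : ℤ) - (p.1 : ℤ)) p.2 q.2

theorem toeplitz_eq_toep (Y : Fin (n + 1) → Matrix (Fin m) (Fin m) ℝ) :
    toeplitz Y = toep n (twoSided Y) := rfl

/-- The sum of the blocks of `X` on the `j`-th block diagonal. -/
def lagSum (X : BlockMat m n) (j : ℤ) : Matrix (Fin m) (Fin m) ℝ :=
  ∑ h : Fin (n + 1), ∑ k : Fin (n + 1), if (k : ℤ) - (h : ℤ) = j then block X h k else 0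

/-- The entrywise inner product of block rows. -/
def rowInner (Z Y : Fin (n + 1) → Matrix (Fin m) (Fin m) ℝ) : ℝ :=
  ∑ j, ∑ a, ∑ b, Z j a b * Y j a b

theorem lagSum_apply (X : BlockMat m n) (j : ℤ) (a b : Fin m) :
    lagSum X j a b = ∑ h : Fin (n + 1), ∑ k : Fin (n + 1),
      if (k : ℤ) - (h : ℤ) = j then X (h, a) (k, b) else 0 := by
  simp only [lagSum, Matrix.sum_apply]
  refine Finset.sum_congr rfl fun h _ => Finset.sum_congr rfl fun k _ => ?_
  split_ifs <;> simp [block]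

theorem lagSum_neg {X : BlockMat m n} (hX : X.IsSymm) (j : ℤ) :
    lagSum X j = (lagSum X (-j))ᵀ := by
  ext a b
  rw [Matrix.transpose_apply, lagSum_apply, lagSum_apply, Finset.sum_comm]
  refine Finset.sum_congr rfl fun h _ => Finset.sum_congr rfl fun k _ => ?_
  rw [hX.apply]
  refine if_congr ?_ rfl rfl
  omega

theorem sub_mem_Icc (h k : Fin (n + 1)) :
    (k : ℤ) - (h : ℤ) ∈ Finset.Icc (-(n : ℤ)) (n : ℤ) := by
  rw [Finset.mem_Icc]; omega

theorem sum_Icc_lag {M : Type*} [AddCommMonoid M] (f : ℤ → Fin (n + 1) → Fin (n + 1) → M) :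
    ∑ j ∈ Finset.Icc (-(n : ℤ)) (n : ℤ), ∑ h : Fin (n + 1), ∑ k : Fin (n + 1),
      (if (k : ℤ) - (h : ℤ) = j then f j h k else 0) =
    ∑ h : Fin (n + 1), ∑ k : Fin (n + 1), f ((k : ℤ) - (h : ℤ)) h k := by
  rw [Finset.sum_comm]
  refine Finset.sum_congr rfl fun h _ => ?_
  rw [Finset.sum_comm]
  refine Finset.sum_congr rfl fun k _ => ?_
  rw [Finset.sum_ite_eq, if_pos (sub_mem_Icc h k)]

theorem shiftConj_apply (X : BlockMat m n) (θ : ℝ) (a b : Fin m) :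
    shiftConj X θ a b = ∑ h : Fin (n + 1), ∑ k : Fin (n + 1),
      Complex.exp (-(Complex.I * (((k : ℤ) - (h : ℤ) : ℤ) : ℂ) * θ)) * (X (h, a) (k, b) : ℂ) := by
  have h1 : ∀ k : Fin (n + 1), star (Complex.exp (Complex.I * ((k : ℕ) : ℂ) * (θ : ℂ))) =
      Complex.exp (-(Complex.I * ((k : ℕ) : ℂ) * (θ : ℂ))) := by
    intro k
    rw [Complex.star_def, ← Complex.exp_conj]
    simp
  simp only [shiftConj, shiftOp, Matrix.mul_apply, Fintype.sum_prod_type, Matrix.of_apply,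
    Matrix.map_apply, Matrix.conjTranspose_apply, ite_mul, zero_mul, Finset.sum_ite_eq,
    Finset.mem_univ, if_true, apply_ite (star : ℂ → ℂ), star_zero, mul_ite, mul_zero, h1,
    Finset.sum_mul]
  rw [Finset.sum_comm]
  refine Finset.sum_congr rfl fun h _ => Finset.sum_congr rfl fun k _ => ?_
  rw [mul_right_comm, ← Complex.exp_add]
  congr 2
  push_cast
  ring

theorem trigPoly_apply (R : ℤ → Matrix (Fin m) (Fin m) ℝ) (θ : ℝ) (a b : Fin m) :
    trigPoly n R θ a b = ∑ j ∈ Finset.Icc (-(n : ℤ)) (n : ℤ),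
      Complex.exp (-(Complex.I * (j : ℂ) * (θ : ℂ))) * (R j a b : ℂ) := by
  simp [trigPoly, Matrix.sum_apply]

theorem shiftConj_eq_trigPoly (X : BlockMat m n) : shiftConj X = trigPoly n (lagSum X) := by
  funext θ
  ext a b
  rw [shiftConj_apply, trigPoly_apply]
  refine (sum_Icc_lag fun j h k =>
    Complex.exp (-(Complex.I * (j : ℂ) * θ)) * (X (h, a) (k, b) : ℂ)).symm.trans ?_
  refine Finset.sum_congr rfl fun j _ => ?_
  rw [lagSum_apply, Complex.ofReal_sum, Finset.mul_sum]
  refine Finset.sum_congr rfl fun h _ => ?_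
  rw [Complex.ofReal_sum, Finset.mul_sum]
  refine Finset.sum_congr rfl fun k _ => ?_
  split_ifs <;> simp

theorem shiftConj_mem_pseudoPolys {X : BlockMat m n} (hX : X.IsSymm) :
    shiftConj X ∈ pseudoPolys m n :=
  ⟨lagSum X, lagSum_neg hX, shiftConj_eq_trigPoly X⟩

/-- A Toeplitz matrix is constant along block diagonals, so its pairing with X sees only the
block-diagonal sums of X. -/
theorem trace_toep_mul_transpose (F : ℤ → Matrix (Fin m) (Fin m) ℝ) (X : BlockMat m n) :
    (toep n F * Xᵀ).trace =
      ∑ j ∈ Finset.Icc (-(n : ℤ)) (n : ℤ), ∑ a, ∑ b, F j a b * lagSum X j a b := by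
  have h1 : ∀ j : ℤ, ∑ a, ∑ b, F j a b * lagSum X j a b =
      ∑ h : Fin (n + 1), ∑ k : Fin (n + 1), if (k : ℤ) - (h : ℤ) = j then
        ∑ a, ∑ b, F j a b * X (h, a) (k, b) else 0 := by
    intro j
    have h2 : ∀ h k : Fin (n + 1), (if (k : ℤ) - (h : ℤ) = j then
        ∑ a, ∑ b, F j a b * X (h, a) (k, b) else 0) =
        ∑ a, ∑ b, F j a b * (if (k : ℤ) - (h : ℤ) = j then X (h, a) (k, b) else 0) := by
      intro h k; split_ifs <;> simp
    simp only [h2, lagSum_apply, Finset.mul_sum]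
    calc _ = ∑ a, ∑ h : Fin (n + 1), ∑ b, ∑ k : Fin (n + 1),
          F j a b * (if (k : ℤ) - (h : ℤ) = j then X (h, a) (k, b) else 0) :=
          Finset.sum_congr rfl fun a _ => Finset.sum_comm
      _ = ∑ h : Fin (n + 1), ∑ a, ∑ b, ∑ k : Fin (n + 1),
          F j a b * (if (k : ℤ) - (h : ℤ) = j then X (h, a) (k, b) else 0) := Finset.sum_comm
      _ = ∑ h : Fin (n + 1), ∑ a, ∑ k : Fin (n + 1), ∑ b,
          F j a b * (if (k : ℤ) - (h : ℤ) = j then X (h, a) (k, b) else 0) :=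
          Finset.sum_congr rfl fun h _ => Finset.sum_congr rfl fun a _ => Finset.sum_comm
      _ = _ := Finset.sum_congr rfl fun h _ => Finset.sum_comm
  simp only [h1]
  rw [sum_Icc_lag (fun j h k => ∑ a, ∑ b, F j a b * X (h, a) (k, b))]
  simp only [Matrix.trace, Matrix.diag, Matrix.mul_apply, Fintype.sum_prod_type, toep,
    Matrix.of_apply, Matrix.transpose_apply]
  exact Finset.sum_congr rfl fun h _ => Finset.sum_comm

/-- Folding lag -j onto lag j is where the factor 2 in `adjT` comes from. -/
theorem sum_Icc_even (a : ℤ → ℝ) (ha : ∀ j, a (-j) = a j) (n : ℕ) :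
    ∑ j ∈ Finset.Icc (-(n : ℤ)) (n : ℤ), a j =
      ∑ j : Fin (n + 1), (if j = 0 then 1 else 2) * a (j : ℕ) := by
  induction n with
  | zero =>
    have h0 : Finset.Icc (-((0 : ℕ) : ℤ)) ((0 : ℕ) : ℤ) = {0} := rfl
    have h1 : (Finset.univ : Finset (Fin (0 + 1))) = {0} := rfl
    rw [h0, Finset.sum_singleton, h1, Finset.sum_singleton, if_pos rfl, one_mul]
    rfl
  | succ n ih =>
    have h1 : Finset.Icc (-((n + 1 : ℕ) : ℤ)) ((n + 1 : ℕ) : ℤ) =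
        insert (-((n + 1 : ℕ) : ℤ)) (insert ((n + 1 : ℕ) : ℤ) (Finset.Icc (-(n : ℤ)) n)) := by
      ext x; simp only [Finset.mem_insert, Finset.mem_Icc]; omega
    rw [h1, Finset.sum_insert (by simp only [Finset.mem_insert, Finset.mem_Icc]; omega),
      Finset.sum_insert (by simp only [Finset.mem_Icc]; omega), ih, ha,
      Fin.sum_univ_castSucc (n := n + 1)]
    have h2 : (Fin.last (n + 1)) ≠ 0 := by simp [Fin.ext_iff]
    rw [if_neg h2]
    have h3 : ∀ j : Fin (n + 1), (j.castSucc = 0) ↔ j = 0 := by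
      intro j; rw [Fin.ext_iff, Fin.ext_iff]; rfl
    simp only [h3, Fin.val_castSucc, Fin.val_last]
    push_cast
    ring

theorem twoSided_natCast (Y : Fin (n + 1) → Matrix (Fin m) (Fin m) ℝ) (j : Fin (n + 1)) :
    twoSided Y ((j : ℕ) : ℤ) = Y j := by
  have := j.isLt
  simp only [twoSided, Int.natAbs_natCast, Nat.cast_nonneg, if_true, dif_pos this]

theorem twoSided_neg {Y : Fin (n + 1) → Matrix (Fin m) (Fin m) ℝ} (hY : Y ∈ blockRows m n)
    (j : ℤ) : twoSided Y (-j) = (twoSided Y j)ᵀ := by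
  have h0 : (Y 0)ᵀ = Y 0 := hY
  simp only [twoSided, Int.natAbs_neg]
  split_ifs with h1 h2 h3 h3
  · have : j = 0 := by omega
    subst this
    exact h0.symm
  · rfl
  · rfl
  · omega
  · simp

theorem adjT_eq (X : BlockMat m n) (j : Fin (n + 1)) :
    adjT X j = (if j = 0 then (1 : ℝ) else 2) • lagSum X (j : ℕ) := by
  rw [adjT, lagSum]
  congr 1
  refine Finset.sum_congr rfl fun h _ => Finset.sum_congr rfl fun k _ => ?_
  exact if_congr (by omega) rfl rfl

theorem sum_twoSided_mul_eq_rowInner {Y : Fin (n + 1) → Matrix (Fin m) (Fin m) ℝ}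
    (hY : Y ∈ blockRows m n) {S : ℤ → Matrix (Fin m) (Fin m) ℝ} (hS : ∀ j, S j = (S (-j))ᵀ) :
    ∑ j ∈ Finset.Icc (-(n : ℤ)) (n : ℤ), ∑ a, ∑ b, twoSided Y j a b * S j a b =
      rowInner Y (fun j => (if j = 0 then (1 : ℝ) else 2) • S (j : ℕ)) := by
  rw [sum_Icc_even]
  · refine Finset.sum_congr rfl fun j _ => ?_
    simp only [twoSided_natCast, Finset.mul_sum, Matrix.smul_apply, smul_eq_mul]
    exact Finset.sum_congr rfl fun a _ => Finset.sum_congr rfl fun b _ => by ring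
  · intro j
    rw [Finset.sum_comm]
    refine Finset.sum_congr rfl fun a _ => Finset.sum_congr rfl fun b _ => ?_
    rw [twoSided_neg hY, hS j]
    rfl

/-- This is the adjointness of T and D on symmetric matrices; it turns the multiplier Z into a
Toeplitz matrix inequality. -/
theorem trace_toeplitz_mul {Y : Fin (n + 1) → Matrix (Fin m) (Fin m) ℝ}
    (hY : Y ∈ blockRows m n) {X : BlockMat m n} (hX : X.IsSymm) :
    (toeplitz Y * X).trace = rowInner Y (adjT X) := by
  conv_lhs => rw [← hX.eq]
  rw [toeplitz_eq_toep, trace_toep_mul_transpose,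
    sum_twoSided_mul_eq_rowInner hY (lagSum_neg hX)]
  simp only [← adjT_eq]

theorem adjT_mem_blockRows {X : BlockMat m n} (hX : X.IsSymm) : adjT X ∈ blockRows m n := by
  have := lagSum_neg hX 0
  simp only [blockRows, Set.mem_ofPred_eq, adjT_eq, Matrix.IsSymm]
  simpa using this.symm

theorem twoSided_add (Y Z : Fin (n + 1) → Matrix (Fin m) (Fin m) ℝ) (j : ℤ) :
    twoSided (Y + Z) j = twoSided Y j + twoSided Z j := by
  simp only [twoSided, Pi.add_apply, Matrix.transpose_add]; split_ifs <;> simp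

theorem twoSided_smul (c : ℝ) (Y : Fin (n + 1) → Matrix (Fin m) (Fin m) ℝ) (j : ℤ) :
    twoSided (c • Y) j = c • twoSided Y j := by
  simp only [twoSided, Pi.smul_apply, Matrix.transpose_smul]; split_ifs <;> simp

theorem toeplitz_add (Y Z : Fin (n + 1) → Matrix (Fin m) (Fin m) ℝ) :
    toeplitz (Y + Z) = toeplitz Y + toeplitz Z := by
  ext p q; simp [toeplitz, twoSided_add]

theorem toeplitz_smul (c : ℝ) (Y : Fin (n + 1) → Matrix (Fin m) (Fin m) ℝ) :
    toeplitz (c • Y) = c • toeplitz Y := by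
  ext p q; simp [toeplitz, twoSided_smul]

/-- The map `Y ↦ T(Y)` as a linear map. -/
def toeplitzLin (m n : ℕ) : (Fin (n + 1) → Matrix (Fin m) (Fin m) ℝ) →ₗ[ℝ] BlockMat m n where
  toFun := toeplitz
  map_add' := toeplitz_add
  map_smul' := toeplitz_smul

/-- The block row `[I 0 … 0]`. -/
def idRow (m n : ℕ) : Fin (n + 1) → Matrix (Fin m) (Fin m) ℝ := fun j => if j = 0 then 1 else 0

theorem toeplitz_idRow : toeplitz (idRow m n) = 1 := by
  ext ⟨h, a⟩ ⟨k, b⟩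
  simp only [toeplitz, twoSided, idRow, Matrix.of_apply, Matrix.one_apply, Prod.mk.injEq,
    Fin.ext_iff]
  have e : h = k ↔ (h : ℕ) = k := Fin.ext_iff
  by_cases hk : (h : ℕ) = k
  · simp [hk, Matrix.one_apply, Fin.ext_iff]
  · have h1 : ¬ ((k : ℤ) - (h : ℤ)).natAbs = 0 := by omega
    have h2 : ¬ ((k : ℤ) - (h : ℤ)) = 0 := by omega
    split_ifs <;> simp_all

theorem toeplitz_isSymm {Y : Fin (n + 1) → Matrix (Fin m) (Fin m) ℝ} (hY : Y ∈ blockRows m n) :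
    (toeplitz Y).IsSymm := by
  ext p q
  simp only [toeplitz, Matrix.transpose_apply, Matrix.of_apply]
  have := congrFun (congrFun (twoSided_neg hY ((q.1 : ℤ) - (p.1 : ℤ))) q.2) p.2
  rw [neg_sub] at this
  exact this

theorem rowInner_add_left (Z Z' Y : Fin (n + 1) → Matrix (Fin m) (Fin m) ℝ) :
    rowInner (Z + Z') Y = rowInner Z Y + rowInner Z' Y := by
  simp [rowInner, add_mul, Finset.sum_add_distrib]

theorem rowInner_smul_left (c : ℝ) (Z Y : Fin (n + 1) → Matrix (Fin m) (Fin m) ℝ) :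
    rowInner (c • Z) Y = c * rowInner Z Y := by
  simp [rowInner, Finset.mul_sum, mul_assoc]

theorem rowInner_comm (Z Y : Fin (n + 1) → Matrix (Fin m) (Fin m) ℝ) :
    rowInner Z Y = rowInner Y Z := by
  simp [rowInner, mul_comm]

theorem rowInner_idRow (Y : Fin (n + 1) → Matrix (Fin m) (Fin m) ℝ) :
    rowInner (idRow m n) Y = (Y 0).trace := by
  rw [rowInner, Finset.sum_eq_single 0]
  · simp [idRow, Matrix.one_apply, Matrix.trace]
  · intro j _ hj; simp [idRow, hj]
  · simp

/-! ### The regularizer as a support function -/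

/-- The block rows with zero diagonals over which `c * hInf` is the support function. -/
def offDiagBall (m n : ℕ) (c : ℝ) : Set (Fin (n + 1) → Matrix (Fin m) (Fin m) ℝ) :=
  {Z | Z ∈ blockRows m n ∧ (∀ j a, Z j a a = 0) ∧
    ∀ k h : Fin m, k ≠ h → ∑ j, (|Z j k h| + |Z j h k|) ≤ c}

theorem sum_sum_eq_sum_lt (f : Fin m → Fin m → ℝ) (hf : ∀ a, f a a = 0) :
    ∑ a, ∑ b, f a b = ∑ a, ∑ b, if a < b then f a b + f b a else 0 := by
  have h1 : ∀ a b : Fin m, f a b = (if a < b then f a b else 0) + (if b < a then f a b else 0) := by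
    intro a b
    rcases lt_trichotomy a b with h | h | h
    · simp [h, h.not_gt]
    · subst h; simp [hf]
    · simp [h, h.not_gt]
  have h2 : ∑ a, ∑ b, (if b < a then f a b else 0) = ∑ a, ∑ b, (if a < b then f b a else 0) :=
    Finset.sum_comm
  calc _ = ∑ a, ∑ b, ((if a < b then f a b else 0) + (if b < a then f a b else 0)) :=
        Finset.sum_congr rfl fun a _ => Finset.sum_congr rfl fun b _ => h1 a b
    _ = ∑ a, ∑ b, (if a < b then f a b else 0) + ∑ a, ∑ b, (if b < a then f a b else 0) := by
        simp only [Finset.sum_add_distrib]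
    _ = _ := by
        rw [h2, ← Finset.sum_add_distrib]
        refine Finset.sum_congr rfl fun a _ => ?_
        rw [← Finset.sum_add_distrib]
        refine Finset.sum_congr rfl fun b _ => ?_
        split_ifs <;> simp

theorem rowInner_eq_sum_lt {Z : Fin (n + 1) → Matrix (Fin m) (Fin m) ℝ}
    (hZ : ∀ j a, Z j a a = 0) (Y : Fin (n + 1) → Matrix (Fin m) (Fin m) ℝ) :
    rowInner Z Y = ∑ h, ∑ k, if h < k then
      ∑ j, (Z j k h * Y j k h + Z j h k * Y j h k) else 0 := by
  have h1 : rowInner Z Y = ∑ a, ∑ b, ∑ j, Z j a b * Y j a b := by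
    rw [rowInner, Finset.sum_comm]
    exact Finset.sum_congr rfl fun a _ => Finset.sum_comm
  rw [h1, sum_sum_eq_sum_lt (fun a b => ∑ j, Z j a b * Y j a b) (fun a => by simp [hZ])]
  refine Finset.sum_congr rfl fun a _ => Finset.sum_congr rfl fun b _ => ?_
  split_ifs
  · rw [Finset.sum_add_distrib, add_comm]
  · rfl

/-- Hölder's inequality between ℓ¹ and ℓ^∞, applied to each unordered pair of indices separately. -/
theorem rowInner_le_hInf {c : ℝ} {Z : Fin (n + 1) → Matrix (Fin m) (Fin m) ℝ}
    (hZ : Z ∈ offDiagBall m n c) (Y : Fin (n + 1) → Matrix (Fin m) (Fin m) ℝ) :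
    rowInner Z Y ≤ c * hInf Y := by
  rw [rowInner_eq_sum_lt hZ.2.1, hInf, Finset.mul_sum]
  refine Finset.sum_le_sum fun h _ => ?_
  rw [Finset.mul_sum]
  refine Finset.sum_le_sum fun k _ => ?_
  split_ifs with hk
  · set M := ⨆ j : Fin (n + 1), max |Y j k h| |Y j h k| with hM
    have hle : ∀ j, max |Y j k h| |Y j h k| ≤ M := fun j =>
      le_ciSup (f := fun j => max |Y j k h| |Y j h k|) (Set.finite_range _).bddAbove j
    have hM0 : 0 ≤ M := (le_max_of_le_left (abs_nonneg _)).trans (hle 0)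
    calc ∑ j, (Z j k h * Y j k h + Z j h k * Y j h k)
        ≤ ∑ j, (|Z j k h| + |Z j h k|) * M := by
          refine Finset.sum_le_sum fun j _ => ?_
          have h1 : Z j k h * Y j k h ≤ |Z j k h| * M := by
            refine (le_abs_self _).trans ?_
            rw [abs_mul]
            exact mul_le_mul_of_nonneg_left ((le_max_left _ _).trans (hle j)) (abs_nonneg _)
          have h2 : Z j h k * Y j h k ≤ |Z j h k| * M := by
            refine (le_abs_self _).trans ?_
            rw [abs_mul]
            exact mul_le_mul_of_nonneg_left ((le_max_right _ _).trans (hle j)) (abs_nonneg _)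
          linarith
      _ = (∑ j, (|Z j k h| + |Z j h k|)) * M := by rw [Finset.sum_mul]
      _ ≤ c * M := mul_le_mul_of_nonneg_right (hZ.2.2 k h hk.ne') hM0
  · simp

theorem exists_dual_pair {c : ℝ} (hc : 0 ≤ c) (u w : Fin (n + 1) → ℝ) (h0 : u 0 = w 0) :
    ∃ p q : Fin (n + 1) → ℝ, p 0 = q 0 ∧ ∑ j, (|p j| + |q j|) ≤ c ∧
      ∑ j, (p j * u j + q j * w j) = c * ⨆ j, max |u j| |w j| := by
  have hs : ∀ x : ℝ, ∃ s : ℝ, |s| = 1 ∧ s * x = |x| := by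
    intro x
    rcases le_total 0 x with h | h
    · exact ⟨1, by simp, by simp [abs_of_nonneg h]⟩
    · exact ⟨-1, by simp, by simp [abs_of_nonpos h]⟩
  obtain ⟨i, hi⟩ := exists_eq_ciSup_of_finite (f := fun j => max |u j| |w j|)
  rw [← hi]
  obtain ⟨s, hs1, hsu⟩ := hs (u i)
  obtain ⟨t, ht1, htw⟩ := hs (w i)
  -- All the mass goes to one lag `i` attaining the maximum. At lag 0 the constraint `p 0 = q 0`
  -- forces it to be split into two halves, which loses nothing because `u 0 = w 0`.
  by_cases hi0 : i = 0
  · subst hi0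
    refine ⟨Pi.single 0 (c / 2 * s), Pi.single 0 (c / 2 * s), rfl, ?_, ?_⟩
    · rw [Finset.sum_eq_single 0 (fun j _ hj => by simp [hj]) (by simp)]
      simp [abs_mul, hs1, abs_of_nonneg (div_nonneg hc zero_le_two)]
    · rw [Finset.sum_eq_single 0 (fun j _ hj => by simp [hj]) (by simp)]
      simp only [Pi.single_eq_same, ← h0, max_self]
      rw [← hsu]; ring
  · rcases le_total |w i| |u i| with h | h
    · refine ⟨Pi.single i (c * s), 0, by simp [Ne.symm hi0], ?_, ?_⟩
      · rw [Finset.sum_eq_single i (fun j _ hj => by simp [hj]) (by simp)]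
        simp [abs_mul, hs1, abs_of_nonneg hc]
      · rw [Finset.sum_eq_single i (fun j _ hj => by simp [hj]) (by simp)]
        simp only [Pi.single_eq_same, Pi.zero_apply, max_eq_left h]
        rw [← hsu]; ring
    · refine ⟨0, Pi.single i (c * t), by simp [Ne.symm hi0], ?_, ?_⟩
      · rw [Finset.sum_eq_single i (fun j _ hj => by simp [hj]) (by simp)]
        simp [abs_mul, ht1, abs_of_nonneg hc]
      · rw [Finset.sum_eq_single i (fun j _ hj => by simp [hj]) (by simp)]
        simp only [Pi.single_eq_same, Pi.zero_apply, max_eq_right h]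
        rw [← htw]; ring

theorem exists_rowInner_eq_hInf {c : ℝ} (hc : 0 ≤ c)
    {Y : Fin (n + 1) → Matrix (Fin m) (Fin m) ℝ} (hY : Y ∈ blockRows m n) :
    ∃ Z ∈ offDiagBall m n c, rowInner Z Y = c * hInf Y := by
  have hY0 : ∀ a b, Y 0 a b = Y 0 b a := fun a b => Matrix.IsSymm.apply hY b a
  choose p q hpq0 hpq1 hpq2 using fun h k : Fin m =>
    exists_dual_pair hc (fun j => Y j k h) (fun j => Y j h k) (hY0 k h)
  set Z : Fin (n + 1) → Matrix (Fin m) (Fin m) ℝ := fun j => Matrix.of fun a b =>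
    if b < a then p b a j else if a < b then q a b j else 0 with hZ
  have hp : ∀ {h k : Fin m}, h < k → ∀ j, Z j k h = p h k j := by
    intro h k hk j; simp [hZ, hk]
  have hq : ∀ {h k : Fin m}, h < k → ∀ j, Z j h k = q h k j := by
    intro h k hk j; simp [hZ, hk, hk.not_gt]
  have hd : ∀ j a, Z j a a = 0 := by intro j a; simp [hZ]
  refine ⟨Z, ⟨?_, hd, ?_⟩, ?_⟩
  · refine Matrix.IsSymm.ext fun a b => ?_
    rcases lt_trichotomy a b with h | h | h
    · rw [hp h, hq h, hpq0]
    · rw [h]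
    · rw [hp h, hq h, hpq0]
  · intro k h hkh
    rcases lt_or_gt_of_ne hkh with hlt | hlt
    · simp only [hp hlt, hq hlt]
      simpa only [add_comm] using hpq1 k h
    · simp only [hp hlt, hq hlt]
      exact hpq1 h k
  · rw [rowInner_eq_sum_lt hd, hInf, Finset.mul_sum]
    refine Finset.sum_congr rfl fun h _ => ?_
    rw [Finset.mul_sum]
    refine Finset.sum_congr rfl fun k _ => ?_
    split_ifs with hk
    · simp only [hp hk, hq hk]
      exact hpq2 h k
    · simp

theorem hInf_nonneg (Y : Fin (n + 1) → Matrix (Fin m) (Fin m) ℝ) : 0 ≤ hInf Y := by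
  refine Finset.sum_nonneg fun h _ => Finset.sum_nonneg fun k _ => ?_
  split_ifs
  · exact Real.iSup_nonneg fun j => le_max_of_le_left (abs_nonneg _)
  · exact le_rfl

end BlockToeplitz

/-! ### Real positive matrices viewed as complex ones. -/

section ComplexMap

variable {ι : Type*} [Fintype ι] [DecidableEq ι]

theorem posSemidef_map_ofReal {M : Matrix ι ι ℝ} (hM : M.PosSemidef) :
    (M.map Complex.ofReal).PosSemidef := by
  obtain ⟨C, rfl⟩ := posSemidef_factor hM
  have : (Cᴴ * C).map Complex.ofReal = (C.map Complex.ofReal)ᴴ * C.map Complex.ofReal := by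
    have h1 : Cᴴ.map Complex.ofRealHom = (C.map Complex.ofReal)ᴴ := by ext i j; simp
    refine (Matrix.map_mul (f := Complex.ofRealHom)).trans ?_
    rw [h1]; rfl
  rw [this]
  exact Matrix.posSemidef_conjTranspose_mul_self _

theorem det_map_ofReal (M : Matrix ι ι ℝ) : (M.map Complex.ofReal).det = (M.det : ℂ) :=
  (RingHom.map_det Complex.ofRealHom M).symm

theorem posDef_map_ofReal {M : Matrix ι ι ℝ} (hM : M.PosDef) :
    (M.map Complex.ofReal).PosDef := by
  rw [(posSemidef_map_ofReal hM.posSemidef).posDef_iff_det_ne_zero, det_map_ofReal]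
  exact_mod_cast hM.det_pos.ne'

end ComplexMap

/-! ### Shift invariance of Toeplitz forms. -/

section Shift

variable {m n : ℕ} {α : Type*}

/-- Append a zero last block. -/
def padLast [Zero α] (u : Fin n × Fin m → α) : Fin (n + 1) × Fin m → α :=
  fun p => Fin.snoc (α := fun _ => α) (fun i => u (i, p.2)) 0 p.1

/-- Prepend a zero first block. -/
def padFirst [Zero α] (u : Fin n × Fin m → α) : Fin (n + 1) × Fin m → α :=
  fun p => Fin.cons (α := fun _ => α) 0 (fun i => u (i, p.2)) p.1

@[simp] theorem padLast_castSucc [Zero α] (u : Fin n × Fin m → α) (i : Fin n) (a : Fin m) :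
    padLast u (i.castSucc, a) = u (i, a) := by simp [padLast]

@[simp] theorem padLast_last [Zero α] (u : Fin n × Fin m → α) (a : Fin m) :
    padLast u (Fin.last n, a) = 0 := by simp [padLast]

@[simp] theorem padFirst_succ [Zero α] (u : Fin n × Fin m → α) (i : Fin n) (a : Fin m) :
    padFirst u (i.succ, a) = u (i, a) := by simp [padFirst]

@[simp] theorem padFirst_zero [Zero α] (u : Fin n × Fin m → α) (a : Fin m) :
    padFirst u (0, a) = 0 := by simp [padFirst]

/-- Block (h, k) depends only on k - h, so moving all blocks down by one leaves the form unchanged.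
-/
theorem padFirst_toep_padFirst [CommRing α] (F : ℤ → Matrix (Fin m) (Fin m) α)
    (u w : Fin n × Fin m → α) :
    padFirst u ⬝ᵥ (toep n F *ᵥ padFirst w) = padLast u ⬝ᵥ (toep n F *ᵥ padLast w) := by
  simp only [dotProduct, Matrix.mulVec, Fintype.sum_prod_type]
  rw [Fin.sum_univ_succ, Fin.sum_univ_castSucc (n := n) (f := fun h : Fin (n + 1) =>
    ∑ a, padLast u (h, a) * _)]
  simp only [Fin.sum_univ_succ (f := fun h : Fin (n + 1) => ∑ a, toep n F _ _ * padFirst w (h, a)),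
    Fin.sum_univ_castSucc (f := fun h : Fin (n + 1) => ∑ a, toep n F _ _ * padLast w (h, a)),
    padFirst_zero, padLast_last, padFirst_succ, padLast_castSucc, zero_mul, mul_zero,
    Finset.sum_const_zero, add_zero, zero_add]
  simp [toep]

/-- The first block of a block vector. -/
def headBlock (v : Fin (n + 1) × Fin m → α) : Fin m → α := fun a => v (0, a)

/-- All blocks but the first. -/
def tailBlocks (v : Fin (n + 1) × Fin m → α) : Fin n × Fin m → α := fun p => v (p.1.succ, p.2)

theorem padFirst_tailBlocks [Zero α] {v : Fin (n + 1) × Fin m → α} (h : headBlock v = 0) :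
    padFirst (tailBlocks v) = v := by
  funext ⟨i, a⟩
  refine Fin.cases ?_ (fun i => ?_) i
  · rw [padFirst_zero]; exact (congrFun h a).symm
  · rw [padFirst_succ]; rfl

theorem dotProduct_corner_mulVec (W : Matrix (Fin m) (Fin m) ℝ) (v w : Fin (n + 1) × Fin m → ℝ) :
    v ⬝ᵥ (corner n W *ᵥ w) = headBlock v ⬝ᵥ (W *ᵥ headBlock w) := by
  simp only [dotProduct, Matrix.mulVec, Fintype.sum_prod_type]
  rw [Fin.sum_univ_succ]
  simp only [Fin.sum_univ_succ (f := fun h : Fin (n + 1) => ∑ a, corner n W _ _ * w (h, a))]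
  simp [corner, headBlock, Fin.succ_ne_zero]

theorem corner_posSemidef {W : Matrix (Fin m) (Fin m) ℝ} (hW : W.PosSemidef) :
    (corner n W).PosSemidef := by
  refine Matrix.PosSemidef.of_dotProduct_mulVec_nonneg ?_ fun v => ?_
  · ext p q
    have := hW.1.apply q.2 p.2
    simp only [star_trivial] at this
    simp [corner, this, and_comm]
  · rw [star_trivial, dotProduct_corner_mulVec]
    exact hW.dotProduct_mulVec_nonneg _

/-- If the form vanishes at v, domination of the corner by W ≻ 0 kills the first block of v.
Shifting v up by one block then preserves the value 0 of the form, so the argument repeats and every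
block vanishes. -/
theorem toep_posDef_of_corner_le {F : ℤ → Matrix (Fin m) (Fin m) ℝ}
    {W : Matrix (Fin m) (Fin m) ℝ} (hW : W.PosDef)
    (h : (toep n F - corner n W).PosSemidef) : (toep n F).PosDef := by
  have hc : (corner n W).PosSemidef := corner_posSemidef hW.posSemidef
  have hP : (toep n F).PosSemidef := by simpa using h.add hc
  have hhead : ∀ v : Fin (n + 1) × Fin m → ℝ, v ⬝ᵥ (toep n F *ᵥ v) = 0 → headBlock v = 0 := by
    intro v hv
    have h1 := h.dotProduct_mulVec_nonneg v
    rw [star_trivial, Matrix.sub_mulVec, dotProduct_sub, hv, dotProduct_corner_mulVec] at h1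
    by_contra hne
    have := hW.dotProduct_mulVec_pos hne
    rw [star_trivial] at this
    linarith
  have key : ∀ k : ℕ, ∀ v : Fin (n + 1) × Fin m → ℝ, v ⬝ᵥ (toep n F *ᵥ v) = 0 →
      ∀ i : Fin (n + 1), (i : ℕ) < k → ∀ a, v (i, a) = 0 := by
    intro k
    induction k with
    | zero => intro v _ i hi; omega
    | succ k ih =>
      intro v hv i
      have h0 := hhead v hv
      have h1 := ih (padLast (tailBlocks v))
        (by rw [← padFirst_toep_padFirst, padFirst_tailBlocks h0, hv])
      refine Fin.cases (fun _ a => congrFun h0 a) (fun i hi a => ?_) i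
      have := h1 i.castSucc (by simpa using hi) a
      simpa [tailBlocks] using this
  refine Matrix.PosDef.of_dotProduct_mulVec_pos hP.1 fun v hv => ?_
  refine lt_of_le_of_ne (hP.dotProduct_mulVec_nonneg v) fun h0 => hv ?_
  rw [star_trivial] at h0
  funext ⟨i, a⟩
  exact key (n + 1) v h0.symm i i.isLt a

end Shift

/-! ### The Yule–Walker equations: solvability, stability and recovery of the Toeplitz matrix. -/

section YuleWalker

variable {m n : ℕ}

theorem firstCol_mulVec_dotProduct {α : Type*} [CommRing α] (W : Matrix (Fin m) (Fin m) α)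
    (v : Fin (n + 1) × Fin m → α) (y : Fin m → α) :
    v ⬝ᵥ ((Matrix.of fun p b => if p.1 = 0 then W p.2 b else 0 :
      Matrix (Fin (n + 1) × Fin m) (Fin m) α) *ᵥ y) = headBlock v ⬝ᵥ (W *ᵥ y) := by
  simp only [dotProduct, Matrix.mulVec, Fintype.sum_prod_type]
  rw [Fin.sum_univ_succ]
  simp [headBlock, Fin.succ_ne_zero]

/-- W is the inverse of the (0, 0) block of P⁻¹, and Bᵀ is the first block column of P⁻¹ normalized
by W. -/
theorem exists_yuleWalker {P : BlockMat m n} (hP : P.PosDef) :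
    ∃ (W : Matrix (Fin m) (Fin m) ℝ) (B : Matrix (Fin m) (Fin (n + 1) × Fin m) ℝ), W.PosDef ∧
      P * Bᵀ = firstCol n W ∧ (Matrix.of fun a b => B a (0, b)) = (1 : Matrix (Fin m) (Fin m) ℝ) := by
  have hG : P⁻¹.PosDef := hP.inv
  have hG0 : (P⁻¹.submatrix (fun a : Fin m => ((0 : Fin (n + 1)), a)) (fun a => (0, a))).PosDef :=
    hG.submatrix (fun a b h => by simpa using h)
  set G0 := P⁻¹.submatrix (fun a : Fin m => ((0 : Fin (n + 1)), a)) (fun a => (0, a)) with hG0def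
  have hu : IsUnit P.det := (Matrix.isUnit_iff_isUnit_det _).mp hP.isUnit
  have hu0 : IsUnit G0.det := (Matrix.isUnit_iff_isUnit_det _).mp hG0.isUnit
  refine ⟨G0⁻¹, (P⁻¹ * firstCol n G0⁻¹)ᵀ, hG0.inv, ?_, ?_⟩
  · rw [Matrix.transpose_transpose, ← Matrix.mul_assoc, Matrix.mul_nonsing_inv _ hu, Matrix.one_mul]
  · rw [← Matrix.transpose_transpose (1 : Matrix (Fin m) (Fin m) ℝ), Matrix.transpose_one,
      ← Matrix.mul_nonsing_inv _ hu0]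
    ext a b
    simp only [Matrix.of_apply, Matrix.transpose_apply, Matrix.mul_apply, Fintype.sum_prod_type]
    rw [Fin.sum_univ_succ]
    simp [firstCol, hG0def, Fin.succ_ne_zero]

/-- The matrix polynomial `∑_k z^k B_kᵀ`. -/
def polyVal (B : Matrix (Fin m) (Fin (n + 1) × Fin m) ℝ) (z : ℂ) : Matrix (Fin m) (Fin m) ℂ :=
  Matrix.of fun a b => ∑ k : Fin (n + 1), z ^ (k : ℕ) * (B b (k, a) : ℂ)

theorem hermitian_form_swap {ι : Type*} [Fintype ι] {M : Matrix ι ι ℂ} (hM : M.IsHermitian)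
    (u v : ι → ℂ) : star u ⬝ᵥ (M *ᵥ v) = star (star v ⬝ᵥ (M *ᵥ u)) := by
  rw [Matrix.star_dotProduct, Matrix.star_mulVec, hM.eq, Matrix.dotProduct_mulVec]

/-- Stability by an energy argument. If A(z)y = 0, the vector polynomial with coefficients v = Bᵀy
is divisible by t - z, so v = padFirst c - z padLast c for the quotient c. Since Pv lives in the
first block, it is orthogonal to padFirst c. Shift invariance then gives |z|²E(c) = E(c) + y*Wy with
E(c) ≥ 0, which is impossible for |z| ≤ 1 unless y = 0. -/
theorem polyVal_mulVec_eq_zero {F : ℤ → Matrix (Fin m) (Fin m) ℝ} {W : Matrix (Fin m) (Fin m) ℝ}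
    {B : Matrix (Fin m) (Fin (n + 1) × Fin m) ℝ} (hP : (toep n F).PosSemidef) (hW : W.PosDef)
    (hB : toep n F * Bᵀ = firstCol n W)
    (hB0 : (Matrix.of fun a b => B a (0, b)) = (1 : Matrix (Fin m) (Fin m) ℝ))
    {z : ℂ} (hz : ‖z‖ ≤ 1) {y : Fin m → ℂ} (hy : polyVal B z *ᵥ y = 0) : y = 0 := by
  have hPc := posSemidef_map_ofReal hP
  have hWc := posDef_map_ofReal hW
  set Fc : ℤ → Matrix (Fin m) (Fin m) ℂ := fun j => (F j).map Complex.ofReal with hFc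
  have hmap : (toep n F).map Complex.ofReal = toep n Fc := rfl
  rw [hmap] at hPc
  set P := toep n Fc with hPdef
  set v : Fin (n + 1) × Fin m → ℂ := Bᵀ.map Complex.ofReal *ᵥ y with hv
  have hvhead : headBlock v = y := by
    funext a
    have h1 : ∀ b, B b (0, a) = (1 : Matrix (Fin m) (Fin m) ℝ) b a := fun b =>
      congrFun (congrFun hB0 b) a
    simp [headBlock, hv, Matrix.mulVec, dotProduct, h1, Matrix.one_apply,
      apply_ite Complex.ofReal]
  have hPv : P *ᵥ v = (Matrix.of fun p b => if p.1 = 0 then (W.map Complex.ofReal) p.2 b else 0 :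
      Matrix (Fin (n + 1) × Fin m) (Fin m) ℂ) *ᵥ y := by
    rw [hv, Matrix.mulVec_mulVec]
    congr 1
    have h2 := congrArg (fun M => M.map Complex.ofRealHom) hB
    simp only [Matrix.map_mul] at h2
    refine Eq.trans h2 ?_
    ext p b
    simp only [firstCol, Matrix.map_apply, Matrix.of_apply, Complex.ofRealHom_eq_coe]
    split_ifs <;> simp
  have hsum : ∀ a, ∑ k : Fin (n + 1), z ^ (k : ℕ) * v (k, a) = 0 := by
    intro a
    have := congrFun hy a
    simp only [Matrix.mulVec, dotProduct, polyVal, Matrix.of_apply, Pi.zero_apply] at this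
    rw [← this]
    simp only [hv, Matrix.mulVec, dotProduct, Matrix.map_apply, Matrix.transpose_apply,
      Finset.mul_sum, Finset.sum_mul]
    rw [Finset.sum_comm]
    exact Finset.sum_congr rfl fun b _ => Finset.sum_congr rfl fun k _ => by ring
  -- Synthetic division by t - z: `g (k + 1)` is the k-th coefficient of the quotient, and `g 0` is
  -- the remainder, namely the value at z.
  set g : ℕ → Fin m → ℂ := fun k a =>
    ∑ l : Fin (n + 1), if k ≤ (l : ℕ) then z ^ ((l : ℕ) - k) * v (l, a) else 0 with hg
  have hg0 : ∀ a, g 0 a = 0 := by intro a; simpa [hg] using hsum a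
  have hgn : ∀ a, g (n + 1) a = 0 := by
    intro a
    refine Finset.sum_eq_zero fun l _ => ?_
    rw [if_neg (by omega)]
  have hgk : ∀ (k : Fin (n + 1)) a, v (k, a) = g k a - z * g (k + 1) a := by
    intro k a
    simp only [hg, Finset.mul_sum]
    rw [← Finset.sum_sub_distrib, Finset.sum_eq_single k]
    · simp
    · intro l _ hl
      have hl' : (l : ℕ) ≠ k := fun h => hl (Fin.ext h)
      by_cases h1 : (k : ℕ) + 1 ≤ l
      · rw [if_pos (by omega), if_pos h1, ← mul_assoc, ← pow_succ']
        have : (l : ℕ) - (k + 1) + 1 = l - k := by omega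
        rw [this, sub_self]
      · rw [if_neg (by omega), if_neg h1]; simp
    · simp
  set c : Fin n × Fin m → ℂ := fun p => g ((p.1 : ℕ) + 1) p.2 with hc
  have hcl : ∀ (k : Fin (n + 1)) a, padLast c (k, a) = g (k + 1) a := by
    intro k a
    refine Fin.lastCases ?_ (fun i => ?_) k
    · rw [padLast_last, Fin.val_last, hgn]
    · rw [padLast_castSucc]; rfl
  have hcf : ∀ (k : Fin (n + 1)) a, padFirst c (k, a) = g k a := by
    intro k a
    refine Fin.cases ?_ (fun i => ?_) k
    · rw [padFirst_zero]; exact (hg0 a).symm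
    · rw [padFirst_succ]; rfl
  have hdec : z • padLast c = padFirst c - v := by
    funext ⟨k, a⟩
    simp only [Pi.smul_apply, Pi.sub_apply, smul_eq_mul, hcl, hcf, hgk]
    ring
  have hstarF : star (padFirst c) = padFirst (star c) := by
    funext ⟨k, a⟩
    refine Fin.cases ?_ (fun i => ?_) k <;> simp [Pi.star_apply]
  have hstarL : star (padLast c) = padLast (star c) := by
    funext ⟨k, a⟩
    refine Fin.lastCases ?_ (fun i => ?_) k <;> simp [Pi.star_apply]
  have hhead0 : headBlock (star (padFirst c)) = 0 := by
    funext a; simp [headBlock]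
  have hheadv : headBlock (star v) = star y := by rw [← hvhead]; rfl
  have e1 : star (padFirst c) ⬝ᵥ (P *ᵥ v) = 0 := by
    rw [hPv, firstCol_mulVec_dotProduct, hhead0, zero_dotProduct]
  have e2 : star v ⬝ᵥ (P *ᵥ padFirst c) = 0 := by
    rw [hermitian_form_swap hPc.1, e1, star_zero]
  have e3 : star v ⬝ᵥ (P *ᵥ v) = star y ⬝ᵥ (W.map Complex.ofReal *ᵥ y) := by
    rw [hPv, firstCol_mulVec_dotProduct, hheadv]
  have e4 : star (padFirst c) ⬝ᵥ (P *ᵥ padFirst c) = star (padLast c) ⬝ᵥ (P *ᵥ padLast c) := by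
    rw [hstarF, hstarL, padFirst_toep_padFirst]
  have e5 : (star z * z) * (star (padLast c) ⬝ᵥ (P *ᵥ padLast c)) =
      star (padLast c) ⬝ᵥ (P *ᵥ padLast c) + star y ⬝ᵥ (W.map Complex.ofReal *ᵥ y) := by
    have : star (z • padLast c) ⬝ᵥ (P *ᵥ (z • padLast c)) =
        (star z * z) * (star (padLast c) ⬝ᵥ (P *ᵥ padLast c)) := by
      rw [star_smul, Matrix.mulVec_smul, smul_dotProduct, dotProduct_smul, smul_eq_mul,
        smul_eq_mul, mul_assoc]
    rw [← this, hdec, star_sub, Matrix.mulVec_sub, sub_dotProduct, dotProduct_sub, dotProduct_sub,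
      e1, e2, e3, e4]
    ring
  by_contra hne
  have hpos := (Complex.pos_iff.mp (hWc.dotProduct_mulVec_pos hne)).1
  obtain ⟨hnn, him⟩ := Complex.nonneg_iff.mp (hPc.dotProduct_mulVec_nonneg (padLast c))
  have hzz : star z * z = ((‖z‖ ^ 2 : ℝ) : ℂ) := by
    rw [Complex.star_def, mul_comm, Complex.mul_conj, Complex.normSq_eq_norm_sq]
  rw [hzz] at e5
  have e6 := congrArg Complex.re e5
  rw [Complex.re_ofReal_mul, Complex.add_re] at e6
  have hz2 : ‖z‖ ^ 2 ≤ 1 := pow_le_one₀ (norm_nonneg _) hz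
  nlinarith

theorem det_polyVal_ne_zero {F : ℤ → Matrix (Fin m) (Fin m) ℝ} {W : Matrix (Fin m) (Fin m) ℝ}
    {B : Matrix (Fin m) (Fin (n + 1) × Fin m) ℝ} (hP : (toep n F).PosSemidef) (hW : W.PosDef)
    (hB : toep n F * Bᵀ = firstCol n W)
    (hB0 : (Matrix.of fun a b => B a (0, b)) = (1 : Matrix (Fin m) (Fin m) ℝ))
    {z : ℂ} (hz : ‖z‖ ≤ 1) : (polyVal B z).det ≠ 0 := by
  intro h0
  obtain ⟨y, hy, hy0⟩ := Matrix.exists_mulVec_eq_zero_iff.mpr h0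
  exact hy (polyVal_mulVec_eq_zero hP hW hB hB0 hz hy0)

/-- Remove from `v` its component along the columns of `Bᵀ`, then shift down by one block. -/
def backShift (B : Matrix (Fin m) (Fin (n + 1) × Fin m) ℝ) (v : Fin (n + 1) × Fin m → ℝ) :
    Fin (n + 1) × Fin m → ℝ :=
  padLast (tailBlocks (v - Bᵀ *ᵥ headBlock v))

open Filter Topology in
theorem tendsto_dotProduct_mulVec {ι : Type*} [Fintype ι] (M : Matrix ι ι ℝ) {x y : ℕ → ι → ℝ}
    (hx : Tendsto x atTop (𝓝 0)) (hy : Tendsto y atTop (𝓝 0)) :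
    Tendsto (fun k => x k ⬝ᵥ (M *ᵥ y k)) atTop (𝓝 0) := by
  have hcont : Continuous fun p : (ι → ℝ) × (ι → ℝ) => p.1 ⬝ᵥ (M *ᵥ p.2) := by fun_prop
  have h := (hcont.tendsto (0, 0)).comp (hx.prodMk_nhds hy)
  rwa [zero_dotProduct] at h

section

variable {B : Matrix (Fin m) (Fin (n + 1) × Fin m) ℝ}
  (hB0 : (Matrix.of fun a b => B a (0, b)) = (1 : Matrix (Fin m) (Fin m) ℝ))

include hB0

theorem headBlock_transpose_mulVec (y : Fin m → ℝ) : headBlock (Bᵀ *ᵥ y) = y := by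
  funext a
  have h1 : ∀ b, B b (0, a) = (1 : Matrix (Fin m) (Fin m) ℝ) b a := fun b =>
    congrFun (congrFun hB0 b) a
  simp [headBlock, Matrix.mulVec, dotProduct, h1, Matrix.one_apply]

theorem backShift_decomp (v : Fin (n + 1) × Fin m → ℝ) :
    v = Bᵀ *ᵥ headBlock v + padFirst (tailBlocks (v - Bᵀ *ᵥ headBlock v)) := by
  rw [padFirst_tailBlocks]
  · simp
  · have : headBlock (v - Bᵀ *ᵥ headBlock v) = headBlock v - headBlock (Bᵀ *ᵥ headBlock v) := rfl
    rw [this, headBlock_transpose_mulVec hB0, sub_self]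

/-- Columns of Bᵀ are in the kernel of N and drop out of both arguments; what remains has zero first
block and can be shifted. -/
theorem backShift_null_form {N : ℤ → Matrix (Fin m) (Fin m) ℝ} (hN : (toep n N).IsSymm)
    (hNB : toep n N * Bᵀ = 0) (v w : Fin (n + 1) × Fin m → ℝ) :
    v ⬝ᵥ (toep n N *ᵥ w) = backShift B v ⬝ᵥ (toep n N *ᵥ backShift B w) := by
  have h1 : ∀ y, toep n N *ᵥ (Bᵀ *ᵥ y) = 0 := by
    intro y; rw [Matrix.mulVec_mulVec, hNB, Matrix.zero_mulVec]
  have h2 : ∀ y x, (Bᵀ *ᵥ y) ⬝ᵥ (toep n N *ᵥ x) = 0 := by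
    intro y x
    rw [Matrix.dotProduct_mulVec, ← Matrix.mulVec_transpose, hN.eq, h1, zero_dotProduct]
  conv_lhs => rw [backShift_decomp hB0 v, backShift_decomp hB0 w]
  rw [Matrix.mulVec_add, h1, zero_add, add_dotProduct, h2, zero_add, padFirst_toep_padFirst]
  rfl

/-- The component of v along Bᵀ is orthogonal, for the form, to vectors with zero first block. The
map thus loses exactly the energy of the head block. -/
theorem backShift_form {F : ℤ → Matrix (Fin m) (Fin m) ℝ} {W : Matrix (Fin m) (Fin m) ℝ}
    (hF : (toep n F).IsSymm) (hB : toep n F * Bᵀ = firstCol n W) (v : Fin (n + 1) × Fin m → ℝ) :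
    v ⬝ᵥ (toep n F *ᵥ v) = headBlock v ⬝ᵥ (W *ᵥ headBlock v) +
      backShift B v ⬝ᵥ (toep n F *ᵥ backShift B v) := by
  have h1 : ∀ x y, x ⬝ᵥ (toep n F *ᵥ (Bᵀ *ᵥ y)) = headBlock x ⬝ᵥ (W *ᵥ y) := by
    intro x y
    rw [Matrix.mulVec_mulVec, hB]
    exact firstCol_mulVec_dotProduct W x y
  have h2 : ∀ y x, (Bᵀ *ᵥ y) ⬝ᵥ (toep n F *ᵥ x) = headBlock x ⬝ᵥ (W *ᵥ y) := by
    intro y x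
    rw [Matrix.dotProduct_mulVec, ← Matrix.mulVec_transpose, hF.eq, dotProduct_comm, h1]
  have h3 : ∀ u : Fin n × Fin m → ℝ, headBlock (padFirst u) = 0 := by
    intro u; funext a; simp [headBlock]
  conv_lhs => rw [backShift_decomp hB0 v]
  rw [Matrix.mulVec_add, add_dotProduct, dotProduct_add, dotProduct_add, h1, h2, h1, h3,
    headBlock_transpose_mulVec hB0, zero_dotProduct, padFirst_toep_padFirst]
  simp only [zero_add, add_zero]
  rfl

-- The energies decrease and are bounded below, so the lost amounts tend to 0 and with them the head
-- blocks. Block i + 1 of an iterate is block i of the next one plus a linear image of the head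
-- block, so convergence spreads to all blocks by induction.
open Filter Topology in
theorem tendsto_iterate_backShift {F : ℤ → Matrix (Fin m) (Fin m) ℝ}
    {W : Matrix (Fin m) (Fin m) ℝ} (hF : (toep n F).PosSemidef) (hW : W.PosDef)
    (hB : toep n F * Bᵀ = firstCol n W) (v : Fin (n + 1) × Fin m → ℝ) :
    Tendsto (fun k => (backShift B)^[k] v) atTop (𝓝 0) := by
  have hsymm : (toep n F).IsSymm := by
    have := hF.1; rwa [Matrix.IsHermitian, Matrix.conjTranspose_eq_transpose_of_trivial] at this
  set x : ℕ → Fin (n + 1) × Fin m → ℝ := fun k => (backShift B)^[k] v with hx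
  have hxs : ∀ k, x (k + 1) = backShift B (x k) := fun k => Function.iterate_succ_apply' _ _ _
  set q : ℕ → ℝ := fun k => x k ⬝ᵥ (toep n F *ᵥ x k) with hq
  have hrec : ∀ k, q k = headBlock (x k) ⬝ᵥ (W *ᵥ headBlock (x k)) + q (k + 1) := by
    intro k
    simp only [hq, hxs]
    exact backShift_form hB0 hsymm hB (x k)
  have hq0 : ∀ k, 0 ≤ q k := fun k => by
    have := hF.dotProduct_mulVec_nonneg (x k); rwa [star_trivial] at this
  have hW0 : ∀ y : Fin m → ℝ, 0 ≤ y ⬝ᵥ (W *ᵥ y) := fun y => by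
    have := hW.posSemidef.dotProduct_mulVec_nonneg y; rwa [star_trivial] at this
  have hanti : Antitone q := antitone_nat_of_succ_le fun k => by
    have := hrec k; have := hW0 (headBlock (x k)); linarith
  have hlim := tendsto_atTop_ciInf hanti ⟨0, by rintro _ ⟨k, rfl⟩; exact hq0 k⟩
  have hdiff : Tendsto (fun k => headBlock (x k) ⬝ᵥ (W *ᵥ headBlock (x k))) atTop (𝓝 0) := by
    have h1 := hlim.sub (hlim.comp (tendsto_add_atTop_nat 1))
    rw [sub_self] at h1
    refine h1.congr fun k => ?_
    simp only [Function.comp_apply]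
    rw [hrec k]; ring
  obtain ⟨c, hc, hWc⟩ := exists_posSemidef_sub_smul_one hW
  have hhead : ∀ a, Tendsto (fun k => x k (0, a)) atTop (𝓝 0) := by
    intro a
    have hle : ∀ k, (x k (0, a)) ^ 2 ≤ c⁻¹ * (headBlock (x k) ⬝ᵥ (W *ᵥ headBlock (x k))) := by
      intro k
      have h1 := hWc.dotProduct_mulVec_nonneg (headBlock (x k))
      rw [star_trivial, Matrix.sub_mulVec, dotProduct_sub, Matrix.smul_mulVec, Matrix.one_mulVec,
        dotProduct_smul, smul_eq_mul] at h1
      have h2 : (x k (0, a)) ^ 2 ≤ headBlock (x k) ⬝ᵥ headBlock (x k) := by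
        rw [sq]
        exact Finset.single_le_sum (f := fun a => headBlock (x k) a * headBlock (x k) a)
          (fun b _ => mul_self_nonneg _) (Finset.mem_univ a)
      rw [inv_mul_eq_div, le_div_iff₀ hc]
      nlinarith
    have h2 : Tendsto (fun k => (x k (0, a)) ^ 2) atTop (𝓝 0) := by
      refine squeeze_zero (fun k => sq_nonneg _) hle ?_
      simpa using hdiff.const_mul c⁻¹
    have h3 := h2.sqrt
    simp only [Real.sqrt_sq_eq_abs, Real.sqrt_zero] at h3
    exact (tendsto_zero_iff_abs_tendsto_zero _).mpr h3
  have hall : ∀ i : Fin (n + 1), ∀ a, Tendsto (fun k => x k (i, a)) atTop (𝓝 0) := by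
    intro i
    induction i using Fin.induction with
    | zero => exact hhead
    | succ i ih =>
      intro a
      have h1 : ∀ k, x k (i.succ, a) = x (k + 1) (i.castSucc, a) +
          ∑ b, B b (i.succ, a) * x k (0, b) := by
        intro k
        rw [hxs, backShift, padLast_castSucc]
        simp [tailBlocks, Matrix.mulVec, dotProduct, headBlock]
      simp only [h1]
      have h2 : Tendsto (fun k => x (k + 1) (i.castSucc, a)) atTop (𝓝 0) :=
        (ih a).comp (tendsto_add_atTop_nat 1)
      have h3 : Tendsto (fun k => ∑ b, B b (i.succ, a) * x k (0, b)) atTop (𝓝 (∑ _b : Fin m, 0)) :=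
        tendsto_finsetSum _ fun b _ => by simpa using (hhead b).const_mul (B b (i.succ, a))
      simpa using h2.add h3
  refine tendsto_pi_nhds.mpr fun ⟨i, a⟩ => hall i a

-- W and B determine the Toeplitz matrix. The difference N satisfies NBᵀ = 0, so its bilinear form
-- is invariant under `backShift` in both arguments, while the iterates tend to 0. Positivity of G
-- is not needed, only symmetry.
open Filter Topology in
theorem toep_eq_of_yuleWalker {F G : ℤ → Matrix (Fin m) (Fin m) ℝ} {W : Matrix (Fin m) (Fin m) ℝ}
    (hF : (toep n F).PosSemidef) (hW : W.PosDef) (hB : toep n F * Bᵀ = firstCol n W)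
    (hG : (toep n G).IsSymm) (hGB : toep n G * Bᵀ = firstCol n W) : toep n G = toep n F := by
  have hsymm : (toep n F).IsSymm := by
    have := hF.1; rwa [Matrix.IsHermitian, Matrix.conjTranspose_eq_transpose_of_trivial] at this
  have hsub : toep n (fun j => G j - F j) = toep n G - toep n F := rfl
  have hN : (toep n (fun j => G j - F j)).IsSymm := by rw [hsub]; exact hG.sub hsymm
  have hNB : toep n (fun j => G j - F j) * Bᵀ = 0 := by
    rw [hsub, Matrix.sub_mul, hB, hGB, sub_self]
  obtain ⟨M, hM⟩ : ∃ M, M = toep n (fun j => G j - F j) := ⟨_, rfl⟩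
  have hit : ∀ v w (k : ℕ), v ⬝ᵥ (M *ᵥ w) =
      (backShift B)^[k] v ⬝ᵥ (M *ᵥ (backShift B)^[k] w) := by
    intro v w k
    induction k with
    | zero => rfl
    | succ k ih =>
      rw [ih, Function.iterate_succ_apply', Function.iterate_succ_apply', hM]
      exact backShift_null_form hB0 hN hNB _ _
  have hzero : ∀ v w, v ⬝ᵥ (M *ᵥ w) = 0 := by
    intro v w
    have h1 := tendsto_dotProduct_mulVec M (tendsto_iterate_backShift hB0 hF hW hB v)
      (tendsto_iterate_backShift hB0 hF hW hB w)
    exact tendsto_nhds_unique (tendsto_const_nhds.congr (hit v w)) h1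
  have : M = 0 := by
    ext p q
    have := hzero (Pi.single p 1) (Pi.single q 1)
    simpa using this
  rw [hM, hsub] at this
  exact sub_eq_zero.mp this

end

end YuleWalker

/-! ### Means over the unit circle. -/

section CircleMean

open MeasureTheory

variable {E : Type*} [NormedAddCommGroup E] [NormedSpace ℝ E]

theorem circleMean_add {f g : ℝ → E} (hf : Continuous f) (hg : Continuous g) :
    circleMean (fun θ => f θ + g θ) = circleMean f + circleMean g := by
  rw [circleMean, intervalIntegral.integral_add (hf.intervalIntegrable _ _)
    (hg.intervalIntegrable _ _), smul_add]
  rfl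

theorem circleMean_sub {f g : ℝ → E} (hf : Continuous f) (hg : Continuous g) :
    circleMean (fun θ => f θ - g θ) = circleMean f - circleMean g := by
  rw [circleMean, intervalIntegral.integral_sub (hf.intervalIntegrable _ _)
    (hg.intervalIntegrable _ _), smul_sub]
  rfl

theorem circleMean_neg (f : ℝ → E) : circleMean (fun θ => -f θ) = -circleMean f := by
  rw [circleMean, intervalIntegral.integral_neg, smul_neg]
  rfl

theorem circleMean_sum {κ : Type*} (s : Finset κ) {f : κ → ℝ → E}
    (hf : ∀ i ∈ s, Continuous (f i)) :
    circleMean (fun θ => ∑ i ∈ s, f i θ) = ∑ i ∈ s, circleMean (f i) := by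
  rw [circleMean, intervalIntegral.integral_finsetSum fun i hi => (hf i hi).intervalIntegrable _ _,
    Finset.smul_sum]
  rfl

theorem circleMean_const_mul {𝕜 : Type*} [RCLike 𝕜] (c : 𝕜) (f : ℝ → 𝕜) :
    circleMean (fun θ => c * f θ) = c * circleMean f := by
  rw [circleMean, intervalIntegral.integral_const_mul, ← mul_smul_comm]
  rfl

theorem circleMean_const [CompleteSpace E] (c : E) : circleMean (fun _ => c) = c := by
  rw [circleMean, intervalIntegral.integral_const, smul_smul]
  have : (2 * Real.pi)⁻¹ * (Real.pi - -Real.pi) = 1 := by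
    have := Real.pi_pos.ne'
    field_simp; ring
  rw [this, one_smul]

theorem circleMean_re {f : ℝ → ℂ} (hf : Continuous f) :
    (circleMean f).re = circleMean fun θ => (f θ).re := by
  rw [circleMean, circleMean, Complex.smul_re]
  congr 1
  exact (Complex.reCLM.intervalIntegral_comp_comm (hf.intervalIntegrable _ _)).symm

theorem circleMean_conj (f : ℝ → ℂ) :
    circleMean (fun θ => star (f θ)) = star (circleMean f) := by
  rw [circleMean, circleMean, star_smul, star_trivial]
  congr 1
  simp only [Complex.star_def]
  rw [intervalIntegral, intervalIntegral, integral_conj, integral_conj, map_sub]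

theorem circleMean_mono {f g : ℝ → ℝ} (hf : Continuous f) (hg : Continuous g)
    (h : ∀ θ, f θ ≤ g θ) : circleMean f ≤ circleMean g := by
  refine mul_le_mul_of_nonneg_left ?_ (by positivity)
  exact intervalIntegral.integral_mono (by linarith [Real.pi_pos]) (hf.intervalIntegrable _ _)
    (hg.intervalIntegrable _ _) h

/-- Periodicity moves the integral to [0, 2π] and brings θ into that interval, so the conclusion
holds at every angle. -/
theorem eq_zero_of_circleMean_eq_zero {f : ℝ → ℝ} (hf : Continuous f)
    (hper : Function.Periodic f (2 * Real.pi)) (h0 : ∀ θ, 0 ≤ f θ) (h : circleMean f = 0) (θ : ℝ) :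
    f θ = 0 := by
  by_contra hne
  have hpos : 0 < f θ := lt_of_le_of_ne (h0 θ) (Ne.symm hne)
  obtain ⟨y, hy, hfy⟩ := hper.exists_mem_Ico₀ Real.two_pi_pos θ
  have h2 : ∫ x in (0 : ℝ)..(2 * Real.pi), f x = 0 := by
    have h3 := hper.intervalIntegral_add_eq (-Real.pi) 0
    rw [zero_add] at h3
    have h4 : -Real.pi + 2 * Real.pi = Real.pi := by ring
    rw [h4] at h3
    rw [← h3]
    rcases smul_eq_zero.mp h with h5 | h5
    · exact absurd h5 (inv_ne_zero Real.two_pi_pos.ne')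
    · exact h5
  have h5 : 0 < ∫ x in (0 : ℝ)..(2 * Real.pi), f x :=
    intervalIntegral.integral_pos Real.two_pi_pos hf.continuousOn (fun x _ => h0 x)
      ⟨y, ⟨hy.1, hy.2.le⟩, hfy ▸ hpos⟩
  linarith

/-- Gives access to mean value theorems for analytic functions and for the logarithm of their
modulus. -/
theorem circleMean_comp_exp (f : ℂ → E) :
    circleMean (fun θ => f (Complex.exp (Complex.I * θ))) = Real.circleAverage f 0 1 := by
  rw [circleMean, Real.circleAverage]
  congr 1
  have hper : Function.Periodic (fun θ : ℝ => f (Complex.exp (Complex.I * θ))) (2 * Real.pi) := by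
    intro θ
    have : Complex.I * ((θ + 2 * Real.pi : ℝ) : ℂ) = Complex.I * θ + 2 * Real.pi * Complex.I := by
      push_cast; ring
    simp only [this, Complex.exp_periodic _]
  have h3 := hper.intervalIntegral_add_eq (-Real.pi) 0
  rw [zero_add] at h3
  have h4 : -Real.pi + 2 * Real.pi = Real.pi := by ring
  rw [h4] at h3
  rw [h3]
  simp [circleMap, mul_comm]

theorem circleMean_exp (j : ℤ) :
    circleMean (fun θ : ℝ => Complex.exp (Complex.I * (j : ℂ) * (θ : ℂ))) =
      if j = 0 then 1 else 0 := by
  split_ifs with hj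
  · subst hj; simpa using circleMean_const (1 : ℂ)
  · have hc : Complex.I * (j : ℂ) ≠ 0 := by simp [hj]
    rw [circleMean, integral_exp_mul_complex hc]
    have : Complex.exp (Complex.I * (j : ℂ) * ((Real.pi : ℝ) : ℂ)) =
        Complex.exp (Complex.I * (j : ℂ) * ((-Real.pi : ℝ) : ℂ)) := by
      rw [Complex.exp_eq_exp_iff_exists_int]
      exact ⟨j, by push_cast; ring⟩
    rw [this]; simp

end CircleMean

/-! ### Fourier coefficients and Parseval's identity for matrix trigonometric polynomials. -/

section Fourier

variable {m n : ℕ}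

/-- The real part of the coefficient of `e^{-ijθ}` in `S`. -/
def fourierRe (S : ℝ → Matrix (Fin m) (Fin m) ℂ) (j : ℤ) : Matrix (Fin m) (Fin m) ℝ :=
  Matrix.of fun a b => (circleMean fun θ => Complex.exp (Complex.I * (j : ℂ) * (θ : ℂ)) * S θ a b).re

theorem coeff_eq_fourierRe (S : ℝ → Matrix (Fin m) (Fin m) ℂ) (j : ℕ) :
    coeff S j = fourierRe S (j : ℤ) := by
  simp [coeff, fourierRe]

theorem continuous_trigPoly (R : ℤ → Matrix (Fin m) (Fin m) ℝ) : Continuous (trigPoly n R) := by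
  refine continuous_matrix fun a b => ?_
  simp only [trigPoly_apply]
  fun_prop

theorem periodic_trigPoly (R : ℤ → Matrix (Fin m) (Fin m) ℝ) :
    Function.Periodic (trigPoly n R) (2 * Real.pi) := by
  intro θ
  unfold trigPoly
  refine Finset.sum_congr rfl fun j _ => ?_
  congr 1
  rw [Complex.exp_eq_exp_iff_exists_int]
  exact ⟨-j, by push_cast; ring⟩

theorem fourierRe_trigPoly (R : ℤ → Matrix (Fin m) (Fin m) ℝ) {j : ℤ}
    (hj : j ∈ Finset.Icc (-(n : ℤ)) (n : ℤ)) : fourierRe (trigPoly n R) j = R j := by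
  ext a b
  simp only [fourierRe, Matrix.of_apply, trigPoly_apply, Finset.mul_sum]
  have h1 : ∀ θ : ℝ, ∑ i ∈ Finset.Icc (-(n : ℤ)) (n : ℤ),
      Complex.exp (Complex.I * (j : ℂ) * (θ : ℂ)) *
        (Complex.exp (-(Complex.I * (i : ℂ) * (θ : ℂ))) * (R i a b : ℂ)) =
      ∑ i ∈ Finset.Icc (-(n : ℤ)) (n : ℤ),
        (R i a b : ℂ) * Complex.exp (Complex.I * ((j - i : ℤ) : ℂ) * (θ : ℂ)) := by
    intro θ
    refine Finset.sum_congr rfl fun i _ => ?_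
    rw [← mul_assoc, ← Complex.exp_add, mul_comm]
    congr 2
    push_cast; ring
  simp only [h1]
  rw [circleMean_sum _ (fun i _ => by fun_prop)]
  simp only [circleMean_const_mul, circleMean_exp]
  rw [Finset.sum_eq_single j]
  · simp
  · intro i _ hi
    rw [if_neg (by omega), mul_zero]
  · intro h; exact absurd hj h

theorem circleMean_trace_trigPoly (S : ℤ → Matrix (Fin m) (Fin m) ℝ)
    {G : ℝ → Matrix (Fin m) (Fin m) ℂ} (hG : Continuous G) :
    circleMean (fun θ => (trigPoly n S θ * (G θ)ᴴ).trace.re) =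
      ∑ j ∈ Finset.Icc (-(n : ℤ)) (n : ℤ), ∑ a, ∑ b, fourierRe G j a b * S j a b := by
  have hGab : ∀ a b, Continuous fun θ => G θ a b := fun a b => hG.matrix_elem a b
  have h1 : ∀ θ, (trigPoly n S θ * (G θ)ᴴ).trace.re =
      ∑ j ∈ Finset.Icc (-(n : ℤ)) (n : ℤ), ∑ a, ∑ b,
        S j a b * (Complex.exp (Complex.I * (j : ℂ) * (θ : ℂ)) * G θ a b).re := by
    intro θ
    have h2 : ∀ (j : ℤ) a b, (Complex.exp (-(Complex.I * (j : ℂ) * (θ : ℂ))) * (S j a b : ℂ) *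
        star (G θ a b)).re = S j a b * (Complex.exp (Complex.I * (j : ℂ) * (θ : ℂ)) * G θ a b).re := by
      intro j a b
      have h3 : Complex.exp (-(Complex.I * (j : ℂ) * (θ : ℂ))) =
          star (Complex.exp (Complex.I * (j : ℂ) * (θ : ℂ))) := by
        rw [Complex.star_def, ← Complex.exp_conj]
        simp
      rw [h3, mul_right_comm, ← star_mul', mul_comm, Complex.re_ofReal_mul, Complex.star_def,
        Complex.conj_re]
    simp only [Matrix.trace, Matrix.diag, Matrix.mul_apply, Matrix.conjTranspose_apply,
      trigPoly_apply, Finset.sum_mul, Complex.re_sum, h2]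
    symm
    rw [Finset.sum_comm]
    exact Finset.sum_congr rfl fun a _ => Finset.sum_comm
  simp only [h1]
  rw [circleMean_sum _ (fun j _ => by fun_prop)]
  refine Finset.sum_congr rfl fun j _ => ?_
  rw [circleMean_sum _ (fun a _ => by fun_prop)]
  refine Finset.sum_congr rfl fun a _ => ?_
  rw [circleMean_sum _ (fun b _ => by fun_prop)]
  refine Finset.sum_congr rfl fun b _ => ?_
  rw [circleMean_const_mul, fourierRe, Matrix.of_apply, circleMean_re (by fun_prop), mul_comm]

theorem fourierRe_neg {G : ℝ → Matrix (Fin m) (Fin m) ℂ} (hG : ∀ θ, (G θ).IsHermitian) (j : ℤ) :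
    fourierRe G (-j) = (fourierRe G j)ᵀ := by
  ext a b
  simp only [fourierRe, Matrix.of_apply, Matrix.transpose_apply]
  have : ∀ θ : ℝ, Complex.exp (Complex.I * ((-j : ℤ) : ℂ) * (θ : ℂ)) * G θ a b =
      star (Complex.exp (Complex.I * (j : ℂ) * (θ : ℂ)) * G θ b a) := by
    intro θ
    rw [star_mul', (hG θ).apply, Complex.star_def, ← Complex.exp_conj]
    simp
  simp only [this]
  rw [circleMean_conj, Complex.star_def, Complex.conj_re]

end Fourier

/-! ### Autoregressive densities: log-determinant mean and covariance matching. -/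

section SpectralDensity

variable {m n : ℕ}

theorem differentiable_det {M : ℂ → Matrix (Fin m) (Fin m) ℂ}
    (hM : ∀ a b, Differentiable ℂ fun z => M z a b) : Differentiable ℂ fun z => (M z).det := by
  simp only [Matrix.det_apply]
  fun_prop

theorem differentiable_adjugate {M : ℂ → Matrix (Fin m) (Fin m) ℂ}
    (hM : ∀ a b, Differentiable ℂ fun z => M z a b) (a b : Fin m) :
    Differentiable ℂ fun z => (M z).adjugate a b := by
  simp only [Matrix.adjugate_apply]
  refine differentiable_det fun c d => ?_
  simp only [Matrix.updateRow_apply]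
  split_ifs
  · exact differentiable_const _
  · exact hM c d

theorem inv_apply_eq (M : Matrix (Fin m) (Fin m) ℂ) (a b : Fin m) :
    M⁻¹ a b = M.det⁻¹ * M.adjugate a b := by
  rw [Matrix.inv_def, Ring.inverse_eq_inv', Matrix.smul_apply, smul_eq_mul]

theorem continuous_matrix_inv {M : ℝ → Matrix (Fin m) (Fin m) ℂ} (hM : Continuous M)
    (h0 : ∀ θ, (M θ).det ≠ 0) : Continuous fun θ => (M θ)⁻¹ := by
  refine continuous_matrix fun a b => ?_
  simp only [inv_apply_eq]
  exact (hM.matrix_det.inv₀ h0).mul (hM.matrix_adjugate.matrix_elem a b)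

theorem differentiable_polyVal (B : Matrix (Fin m) (Fin (n + 1) × Fin m) ℝ) (a b : Fin m) :
    Differentiable ℂ fun z => polyVal B z a b := by
  simp only [polyVal, Matrix.of_apply]
  fun_prop

theorem polyVal_zero {B : Matrix (Fin m) (Fin (n + 1) × Fin m) ℝ}
    (hB0 : (Matrix.of fun a b => B a (0, b)) = (1 : Matrix (Fin m) (Fin m) ℝ)) :
    polyVal B 0 = 1 := by
  ext a b
  have h1 : B b (0, a) = (1 : Matrix (Fin m) (Fin m) ℝ) b a := congrFun (congrFun hB0 b) a
  simp only [polyVal, Matrix.of_apply]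
  rw [Fin.sum_univ_succ]
  simp [h1, Matrix.one_apply, eq_comm, apply_ite Complex.ofReal]

theorem shiftOp_mul_transpose (B : Matrix (Fin m) (Fin (n + 1) × Fin m) ℝ) (θ : ℝ) :
    shiftOp m n θ * Bᵀ.map Complex.ofReal = polyVal B (Complex.exp (Complex.I * θ)) := by
  ext a b
  simp only [Matrix.mul_apply, shiftOp, Matrix.of_apply, Fintype.sum_prod_type, ite_mul, zero_mul,
    Finset.sum_ite_eq, Finset.mem_univ, if_true, polyVal, Matrix.map_apply, Matrix.transpose_apply]
  refine Finset.sum_congr rfl fun k _ => ?_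
  rw [← Complex.exp_nat_mul]
  congr 2
  ring

theorem shiftConj_transpose_mul_mul (B : Matrix (Fin m) (Fin (n + 1) × Fin m) ℝ)
    (V : Matrix (Fin m) (Fin m) ℝ) (θ : ℝ) :
    shiftConj (Bᵀ * V * B) θ = polyVal B (Complex.exp (Complex.I * θ)) * V.map Complex.ofReal *
      (polyVal B (Complex.exp (Complex.I * θ)))ᴴ := by
  have h1 : (Bᵀ * V * B).map Complex.ofReal =
      Bᵀ.map Complex.ofReal * V.map Complex.ofReal * B.map Complex.ofReal := by
    refine (Matrix.map_mul (f := Complex.ofRealHom)).trans ?_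
    exact congrArg (· * B.map Complex.ofReal) (Matrix.map_mul (f := Complex.ofRealHom))
  have h2 : (Bᵀ.map Complex.ofReal)ᴴ = B.map Complex.ofReal := by ext; simp
  rw [shiftConj, h1, ← shiftOp_mul_transpose, Matrix.conjTranspose_mul, h2]
  simp only [Matrix.mul_assoc]

section

variable {F : ℤ → Matrix (Fin m) (Fin m) ℝ} {W : Matrix (Fin m) (Fin m) ℝ}
  {B : Matrix (Fin m) (Fin (n + 1) × Fin m) ℝ} (hP : (toep n F).PosSemidef) (hW : W.PosDef)
  (hB : toep n F * Bᵀ = firstCol n W)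
  (hB0 : (Matrix.of fun a b => B a (0, b)) = (1 : Matrix (Fin m) (Fin m) ℝ))

include hP hW hB hB0

theorem isUnit_polyVal {z : ℂ} (hz : ‖z‖ ≤ 1) : IsUnit (polyVal B z) := by
  rw [Matrix.isUnit_iff_isUnit_det]
  exact (det_polyVal_ne_zero hP hW hB hB0 hz).isUnit

theorem isUnit_polyVal_exp (θ : ℝ) : IsUnit (polyVal B (Complex.exp (Complex.I * θ))) :=
  isUnit_polyVal hP hW hB hB0 (by rw [mul_comm, Complex.norm_exp_ofReal_mul_I])

theorem shiftConj_posDef (θ : ℝ) : (shiftConj (Bᵀ * W⁻¹ * B) θ).PosDef := by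
  rw [shiftConj_transpose_mul_mul]
  exact (Matrix.IsUnit.posDef_star_right_conjugate_iff (isUnit_polyVal_exp hP hW hB hB0 θ)).mpr
    (posDef_map_ofReal hW.inv)

/-- The determinant is |det A|²/det W with A = `polyVal B`. As det A has no zero in the closed disc,
the mean of log|det A| is its value at 0, which vanishes because A(0) = 1. -/
theorem circleMean_log_det :
    circleMean (fun θ => Real.log (shiftConj (Bᵀ * W⁻¹ * B) θ).det.re) = -Real.log W.det := by
  have hdiff := differentiable_det (differentiable_polyVal B)
  have h1 : ∀ θ : ℝ, Real.log (shiftConj (Bᵀ * W⁻¹ * B) θ).det.re =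
      2 * Real.log ‖(polyVal B (Complex.exp (Complex.I * θ))).det‖ + -Real.log W.det := by
    intro θ
    have hne := det_polyVal_ne_zero hP hW hB hB0
      (z := Complex.exp (Complex.I * θ)) (by rw [mul_comm, Complex.norm_exp_ofReal_mul_I])
    have h2 : (shiftConj (Bᵀ * W⁻¹ * B) θ).det =
        ((‖(polyVal B (Complex.exp (Complex.I * θ))).det‖ ^ 2 * W.det⁻¹ : ℝ) : ℂ) := by
      rw [shiftConj_transpose_mul_mul, Matrix.det_mul, Matrix.det_mul, Matrix.det_conjTranspose,
        det_map_ofReal, mul_right_comm, Complex.star_def, Complex.mul_conj,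
        Complex.normSq_eq_norm_sq, Matrix.det_nonsing_inv, Ring.inverse_eq_inv']
      push_cast; rfl
    rw [h2, Complex.ofReal_re, Real.log_mul (by simpa using hne) (inv_ne_zero hW.det_pos.ne'),
      Real.log_pow, Real.log_inv]
    norm_num
  have hcont : Continuous fun θ : ℝ =>
      Real.log ‖(polyVal B (Complex.exp (Complex.I * θ))).det‖ := by
    refine Continuous.log ?_ fun θ => ?_
    · exact (hdiff.continuous.comp (by fun_prop)).norm
    · simpa using det_polyVal_ne_zero hP hW hB hB0
        (z := Complex.exp (Complex.I * θ)) (by rw [mul_comm, Complex.norm_exp_ofReal_mul_I])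
  simp only [h1]
  rw [circleMean_add (by fun_prop) continuous_const, circleMean_const_mul, circleMean_const,
    circleMean_comp_exp (fun z => Real.log ‖(polyVal B z).det‖),
    AnalyticOnNhd.circleAverage_log_norm_of_ne_zero (g := fun z => (polyVal B z).det)
      (fun z _ => hdiff.analyticAt z)
      (fun z hz => det_polyVal_ne_zero hP hW hB hB0 (by simpa using hz)), polyVal_zero hB0]
  simp

/-- zʰA(z)⁻¹ is analytic on the closed disc, so its mean is its value at 0. -/
theorem circleMean_inv_polyVal (h : ℕ) (a b : Fin m) :
    circleMean (fun θ : ℝ => Complex.exp (Complex.I * (h : ℂ) * (θ : ℂ)) *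
      (polyVal B (Complex.exp (Complex.I * θ)))⁻¹ a b) =
      if h = 0 then (1 : Matrix (Fin m) (Fin m) ℂ) a b else 0 := by
  have h1 : ∀ θ : ℝ, Complex.exp (Complex.I * (h : ℂ) * (θ : ℂ)) =
      Complex.exp (Complex.I * θ) ^ h := by
    intro θ; rw [← Complex.exp_nat_mul]; congr 1; ring
  simp only [h1]
  have hd : DiffContOnCl ℂ (fun z => z ^ h * (polyVal B z)⁻¹ a b) (Metric.ball 0 |(1 : ℝ)|) := by
    refine DifferentiableOn.diffContOnCl ?_
    rw [abs_one, closure_ball (0 : ℂ) one_ne_zero]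
    simp only [inv_apply_eq]
    refine DifferentiableOn.mul (by fun_prop) (DifferentiableOn.mul ?_ ?_)
    · exact (differentiable_det (differentiable_polyVal B)).differentiableOn.inv
        fun z hz => det_polyVal_ne_zero hP hW hB hB0 (by simpa using hz)
    · exact (differentiable_adjugate (differentiable_polyVal B) a b).differentiableOn
  rw [circleMean_comp_exp (fun z => z ^ h * (polyVal B z)⁻¹ a b), hd.circleAverage,
    polyVal_zero hB0, inv_one]
  by_cases hh : h = 0 <;> simp [hh]

theorem continuous_shiftConj_inv : Continuous fun θ => (shiftConj (Bᵀ * W⁻¹ * B) θ)⁻¹ := by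
  refine continuous_matrix_inv ?_ fun θ => (shiftConj_posDef hP hW hB hB0 θ).det_pos.ne'
  rw [shiftConj_eq_trigPoly]
  exact continuous_trigPoly _

/-- With G = (AW⁻¹A*)⁻¹ one has GA = (A⁻¹)*W. Block row h of the product is the mean of
e^{-ihθ}(A⁻¹)*W, which `circleMean_inv_polyVal` evaluates after conjugation. -/
theorem toep_fourierRe_mul :
    toep n (fourierRe fun θ => (shiftConj (Bᵀ * W⁻¹ * B) θ)⁻¹) * Bᵀ = firstCol n W := by
  set G := fun θ => (shiftConj (Bᵀ * W⁻¹ * B) θ)⁻¹ with hG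
  have hGc : Continuous G := continuous_shiftConj_inv hP hW hB hB0
  have hGab : ∀ a b, Continuous fun θ => G θ a b := fun a b => hGc.matrix_elem a b
  have hGA : ∀ θ : ℝ, G θ * polyVal B (Complex.exp (Complex.I * θ)) =
      ((polyVal B (Complex.exp (Complex.I * θ)))⁻¹)ᴴ * W.map Complex.ofReal := by
    intro θ
    set A := polyVal B (Complex.exp (Complex.I * θ)) with hA
    have hAu : IsUnit A.det :=
      (Matrix.isUnit_iff_isUnit_det _).mp (isUnit_polyVal_exp hP hW hB hB0 θ)
    have hWi : (W⁻¹.map Complex.ofReal)⁻¹ = W.map Complex.ofReal := by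
      refine Matrix.inv_eq_right_inv ?_
      refine (Matrix.map_mul (f := Complex.ofRealHom)).symm.trans ?_
      rw [Matrix.nonsing_inv_mul _ ((Matrix.isUnit_iff_isUnit_det _).mp hW.isUnit)]
      exact Matrix.map_one _ (map_zero _) (map_one _)
    rw [hG]
    simp only [shiftConj_transpose_mul_mul, ← hA]
    rw [Matrix.mul_inv_rev, Matrix.mul_inv_rev, hWi, ← Matrix.conjTranspose_nonsing_inv,
      Matrix.mul_assoc, Matrix.mul_assoc, Matrix.nonsing_inv_mul _ hAu, Matrix.mul_one]
  ext ⟨h, a⟩ b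
  have h1 : (toep n (fourierRe G) * Bᵀ) (h, a) b = (circleMean fun θ =>
      Complex.exp (-(Complex.I * ((h : ℕ) : ℂ) * (θ : ℂ))) *
        (G θ * polyVal B (Complex.exp (Complex.I * θ))) a b).re := by
    have h2 : ∀ θ : ℝ, Complex.exp (-(Complex.I * ((h : ℕ) : ℂ) * (θ : ℂ))) *
        (G θ * polyVal B (Complex.exp (Complex.I * θ))) a b =
        ∑ k : Fin (n + 1), ∑ c, (B b (k, c) : ℂ) *
          (Complex.exp (Complex.I * (((k : ℤ) - (h : ℤ) : ℤ) : ℂ) * (θ : ℂ)) * G θ a c) := by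
      intro θ
      simp only [Matrix.mul_apply, polyVal, Matrix.of_apply, Finset.mul_sum]
      rw [Finset.sum_comm]
      refine Finset.sum_congr rfl fun k _ => Finset.sum_congr rfl fun c _ => ?_
      have : Complex.exp (Complex.I * (((k : ℤ) - (h : ℤ) : ℤ) : ℂ) * (θ : ℂ)) =
          Complex.exp (-(Complex.I * ((h : ℕ) : ℂ) * (θ : ℂ))) *
            Complex.exp (Complex.I * θ) ^ (k : ℕ) := by
        rw [← Complex.exp_nat_mul, ← Complex.exp_add]
        congr 1
        push_cast; ring
      rw [this]; ring
    simp only [h2]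
    rw [circleMean_sum _ (fun k _ => by fun_prop), Complex.re_sum]
    simp only [Matrix.mul_apply, Fintype.sum_prod_type]
    refine Finset.sum_congr rfl fun k _ => ?_
    rw [circleMean_sum _ (fun c _ => by fun_prop), Complex.re_sum]
    refine Finset.sum_congr rfl fun c _ => ?_
    rw [circleMean_const_mul, Complex.re_ofReal_mul, mul_comm]
    rfl
  have h3 : ∀ θ : ℝ, Complex.exp (-(Complex.I * ((h : ℕ) : ℂ) * (θ : ℂ))) *
      (G θ * polyVal B (Complex.exp (Complex.I * θ))) a b =
      ∑ c, (W c b : ℂ) * star (Complex.exp (Complex.I * ((h : ℕ) : ℂ) * (θ : ℂ)) *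
        (polyVal B (Complex.exp (Complex.I * θ)))⁻¹ c a) := by
    intro θ
    rw [hGA, Matrix.mul_apply, Finset.mul_sum]
    refine Finset.sum_congr rfl fun c _ => ?_
    rw [star_mul', Matrix.conjTranspose_apply, Matrix.map_apply]
    have : star (Complex.exp (Complex.I * ((h : ℕ) : ℂ) * (θ : ℂ))) =
        Complex.exp (-(Complex.I * ((h : ℕ) : ℂ) * (θ : ℂ))) := by
      rw [Complex.star_def, ← Complex.exp_conj]; simp
    rw [this]; ring
  have hAc : Continuous fun θ : ℝ => (polyVal B (Complex.exp (Complex.I * θ)))⁻¹ := by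
    refine continuous_matrix_inv (continuous_matrix fun c d => ?_) fun θ =>
      det_polyVal_ne_zero hP hW hB hB0 (by rw [mul_comm, Complex.norm_exp_ofReal_mul_I])
    exact (differentiable_polyVal B c d).continuous.comp (by fun_prop)
  have hAab : ∀ c d, Continuous fun θ : ℝ => (polyVal B (Complex.exp (Complex.I * θ)))⁻¹ c d :=
    fun c d => hAc.matrix_elem c d
  rw [h1]
  simp only [h3]
  rw [circleMean_sum _ (fun c _ => by
    refine continuous_const.mul (Continuous.star ?_)
    exact Continuous.mul (by fun_prop) (hAab c a))]
  simp only [circleMean_const_mul, circleMean_conj, circleMean_inv_polyVal hP hW hB hB0]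
  by_cases hh : h = 0
  · simp [hh, firstCol, Matrix.one_apply, apply_ite]
  · have : (h : ℕ) ≠ 0 := fun h' => hh (Fin.ext h')
    simp [hh, firstCol]

/-- The Toeplitz matrix of the Fourier coefficients and `toep n F` solve the same Yule–Walker
equations, hence coincide by `toep_eq_of_yuleWalker`. -/
theorem fourierRe_shiftConj_inv {j : ℤ} (hj : j ∈ Finset.Icc (-(n : ℤ)) (n : ℤ)) :
    fourierRe (fun θ => (shiftConj (Bᵀ * W⁻¹ * B) θ)⁻¹) j = F j := by
  have hsymm : (toep n (fourierRe fun θ => (shiftConj (Bᵀ * W⁻¹ * B) θ)⁻¹)).IsSymm := by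
    ext p q
    simp only [Matrix.transpose_apply, toep, Matrix.of_apply]
    rw [← neg_sub, fourierRe_neg fun θ => ((shiftConj_posDef hP hW hB hB0 θ).inv).1]
    rfl
  have h := toep_eq_of_yuleWalker hB0 hP hW hB hsymm (toep_fourierRe_mul hP hW hB hB0)
  ext a b
  rw [Finset.mem_Icc] at hj
  -- One of the two block indices is 0, and their difference is `j` for either sign.
  have h2 := congrFun (congrFun h (⟨(-j).toNat, by omega⟩, a)) (⟨j.toNat, by omega⟩, b)
  simp only [toep, Matrix.of_apply] at h2
  have h3 : ((j.toNat : ℕ) : ℤ) - (((-j).toNat : ℕ) : ℤ) = j := by omega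
  rwa [h3] at h2

end

end SpectralDensity

/-! ### Closedness, compactness and convexity in matrix spaces. -/

section Topology

theorem locallyConvexSpace_matrix (ι κ : Type*) : LocallyConvexSpace ℝ (Matrix ι κ ℝ) :=
  inferInstanceAs (LocallyConvexSpace ℝ (ι → κ → ℝ))

theorem isCompact_abs_le (ι κ : Type*) (c : ℝ) :
    IsCompact {M : Matrix ι κ ℝ | ∀ a b, |M a b| ≤ c} := by
  have h : IsCompact (Set.pi Set.univ fun _ : ι => Set.pi Set.univ fun _ : κ => Set.Icc (-c) c) :=
    isCompact_univ_pi fun _ => isCompact_univ_pi fun _ => isCompact_Icc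
  have e : {M : Matrix ι κ ℝ | ∀ a b, |M a b| ≤ c} =
      Set.pi Set.univ fun _ : ι => Set.pi Set.univ fun _ : κ => Set.Icc (-c) c := by
    ext M
    simp only [Set.mem_ofPred_eq, abs_le]
    exact ⟨fun h a _ b _ => h a b, fun h a b => h a trivial b trivial⟩
  rw [e]
  exact h

theorem isClosed_posSemidef (ι : Type*) [Fintype ι] :
    IsClosed {M : Matrix ι ι ℝ | M.PosSemidef} := by
  have : {M : Matrix ι ι ℝ | M.PosSemidef} =
      {M | Mᴴ = M} ∩ ⋂ x : ι → ℝ, {M | 0 ≤ star x ⬝ᵥ (M *ᵥ x)} := by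
    ext M
    simp only [Set.mem_ofPred_eq, Set.mem_inter_iff, Set.mem_iInter,
      Matrix.posSemidef_iff_dotProduct_mulVec]
    rfl
  rw [this]
  refine (isClosed_eq (by fun_prop) continuous_id).inter (isClosed_iInter fun x => ?_)
  exact isClosed_le continuous_const (by fun_prop)

theorem convex_posSemidef (ι : Type*) [Fintype ι] :
    Convex ℝ {M : Matrix ι ι ℝ | M.PosSemidef} :=
  fun _ hM _ hN _ _ ha hb _ => (Matrix.PosSemidef.smul hM ha).add (Matrix.PosSemidef.smul hN hb)

theorem isSymm_of_posSemidef {ι : Type*} {M : Matrix ι ι ℝ} (hM : M.PosSemidef) : M.IsSymm := by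
  have := hM.1; rwa [Matrix.IsHermitian, Matrix.conjTranspose_eq_transpose_of_trivial] at this

end Topology

/-! ### Nonnegative trigonometric polynomials and their Gram matrices. -/

section Gram

variable {m n : ℕ}

/-- The block row `[S_0 2S_1 … 2S_n]` attached to a two-sided sequence. -/
def rowOf (n : ℕ) (S : ℤ → Matrix (Fin m) (Fin m) ℝ) : Fin (n + 1) → Matrix (Fin m) (Fin m) ℝ :=
  fun j => (if j = 0 then (1 : ℝ) else 2) • S (j : ℕ)

theorem rowOf_lagSum (X : BlockMat m n) : rowOf n (lagSum X) = adjT X := by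
  funext j; rw [adjT_eq]; rfl

theorem rowOf_mem_blockRows {S : ℤ → Matrix (Fin m) (Fin m) ℝ} (hS : ∀ j, S j = (S (-j))ᵀ) :
    rowOf n S ∈ blockRows m n := by
  have := hS 0
  simpa [blockRows, rowOf, Matrix.IsSymm] using this.symm

theorem rowInner_rowOf_sub (Z : Fin (n + 1) → Matrix (Fin m) (Fin m) ℝ)
    (S S' : ℤ → Matrix (Fin m) (Fin m) ℝ) :
    rowInner Z (rowOf n fun j => S j - S' j) =
      rowInner Z (rowOf n S) - rowInner Z (rowOf n S') := by
  simp only [rowInner, ← Finset.sum_sub_distrib, rowOf, Matrix.smul_apply, Matrix.sub_apply,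
    smul_eq_mul]
  refine Finset.sum_congr rfl fun j _ => Finset.sum_congr rfl fun a _ =>
    Finset.sum_congr rfl fun b _ => by ring

theorem rowInner_idRow_rowOf (S : ℤ → Matrix (Fin m) (Fin m) ℝ) :
    rowInner (idRow m n) (rowOf n S) = (S 0).trace := by
  rw [rowInner_idRow]; simp [rowOf]

theorem trigPoly_congr {S S' : ℤ → Matrix (Fin m) (Fin m) ℝ}
    (h : ∀ j ∈ Finset.Icc (-(n : ℤ)) (n : ℤ), S j = S' j) : trigPoly n S = trigPoly n S' := by
  funext θ
  exact Finset.sum_congr rfl fun j hj => by rw [h j hj]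

theorem eq_of_rowOf_eq {S S' : ℤ → Matrix (Fin m) (Fin m) ℝ} (hS : ∀ j, S j = (S (-j))ᵀ)
    (hS' : ∀ j, S' j = (S' (-j))ᵀ) (h : rowOf n S = rowOf n S') :
    ∀ j ∈ Finset.Icc (-(n : ℤ)) (n : ℤ), S j = S' j := by
  have h1 : ∀ j : ℕ, j ≤ n → S j = S' j := by
    intro j hj
    have := congrFun h ⟨j, by omega⟩
    simp only [rowOf] at this
    refine smul_right_injective _ ?_ this
    split_ifs <;> norm_num
  intro j hj
  rw [Finset.mem_Icc] at hj
  rcases le_total 0 j with h0 | h0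
  · obtain ⟨k, rfl⟩ := Int.eq_ofNat_of_zero_le h0
    exact h1 k (by omega)
  · obtain ⟨k, hk⟩ := Int.eq_ofNat_of_zero_le (neg_nonneg.mpr h0)
    rw [hS, hS', hk, h1 k (by omega)]

/-- Only the lag 0 block of the representing row is symmetrized, which is harmless against rows
whose lag 0 block is symmetric. -/
theorem exists_rowInner_repr (f : (Fin (n + 1) → Matrix (Fin m) (Fin m) ℝ) →ₗ[ℝ] ℝ) :
    ∃ Y ∈ blockRows m n, ∀ M ∈ blockRows m n, f M = rowInner Y M := by
  set U : Fin (n + 1) → Matrix (Fin m) (Fin m) ℝ := fun j => Matrix.of fun a b =>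
    f (Pi.single j (Matrix.single a b 1)) with hU
  have h1 : ∀ M, f M = rowInner U M := by
    intro M
    have hM : M = ∑ j, ∑ a, ∑ b, M j a b • Pi.single j (Matrix.single a b (1 : ℝ)) := by
      funext i
      rw [Finset.sum_apply, Finset.sum_eq_single i]
      · simp only [Finset.sum_apply, Pi.smul_apply, Pi.single_eq_same]
        conv_lhs => rw [Matrix.matrix_eq_sum_single (M i)]
        simp
      · intro j _ hj
        simp [Finset.sum_apply, Pi.single_eq_of_ne (Ne.symm hj)]
      · simp
    conv_lhs => rw [hM]
    simp only [map_sum, map_smul, smul_eq_mul, rowInner, hU, Matrix.of_apply]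
    exact Finset.sum_congr rfl fun j _ => Finset.sum_congr rfl fun a _ =>
      Finset.sum_congr rfl fun b _ => mul_comm _ _
  refine ⟨fun j => if j = 0 then (1 / 2 : ℝ) • (U 0 + (U 0)ᵀ) else U j, ?_, fun M hM => ?_⟩
  · simp [blockRows, Matrix.IsSymm, add_comm]
  · rw [h1, rowInner, rowInner, Fin.sum_univ_succ, Fin.sum_univ_succ]
    congr 1
    have hM0 : ∀ a b, M 0 a b = M 0 b a := fun a b => Matrix.IsSymm.apply hM b a
    have h2 : ∑ a, ∑ b, U 0 b a * M 0 a b = ∑ a, ∑ b, U 0 a b * M 0 a b := by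
      rw [Finset.sum_comm]
      exact Finset.sum_congr rfl fun a _ => Finset.sum_congr rfl fun b _ => by rw [hM0]
    have h3 : ∀ a b, ((1 / 2 : ℝ) • (U 0 + (U 0)ᵀ)) a b * M 0 a b =
        1 / 2 * (U 0 a b * M 0 a b) + 1 / 2 * (U 0 b a * M 0 a b) := by
      intro a b
      simp only [Matrix.smul_apply, Matrix.add_apply, Matrix.transpose_apply, smul_eq_mul]
      ring
    simp only [if_true, h3, Finset.sum_add_distrib, ← Finset.mul_sum, h2]
    ring

theorem circleMean_trace_mul_density {Y : Fin (n + 1) → Matrix (Fin m) (Fin m) ℝ}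
    (hY : Y ∈ blockRows m n) {G : ℝ → Matrix (Fin m) (Fin m) ℂ} (hG : Continuous G)
    (hGY : ∀ j ∈ Finset.Icc (-(n : ℤ)) (n : ℤ), fourierRe G j = twoSided Y j)
    {S : ℤ → Matrix (Fin m) (Fin m) ℝ} (hS : ∀ j, S j = (S (-j))ᵀ) :
    circleMean (fun θ => (trigPoly n S θ * (G θ)ᴴ).trace.re) = rowInner Y (rowOf n S) := by
  rw [circleMean_trace_trigPoly S hG]
  refine Eq.trans ?_ (sum_twoSided_mul_eq_rowInner hY hS)
  exact Finset.sum_congr rfl fun j hj => by rw [hGY j hj]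

theorem circleMean_trace_re (S : ℤ → Matrix (Fin m) (Fin m) ℝ) :
    circleMean (fun θ => (trigPoly n S θ).trace.re) = (S 0).trace := by
  have h0 := fourierRe_trigPoly (n := n) S (j := 0) (by simp)
  have hc : ∀ a b, Continuous fun θ => trigPoly n S θ a b := fun a b =>
    (continuous_trigPoly S).matrix_elem a b
  simp only [Matrix.trace, Matrix.diag, Complex.re_sum]
  rw [circleMean_sum _ (f := fun a θ => (trigPoly n S θ a a).re)
    (fun a _ => Complex.continuous_re.comp (hc a a))]
  refine Finset.sum_congr rfl fun a _ => ?_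
  rw [← h0, fourierRe, Matrix.of_apply, ← circleMean_re (hc a a)]
  simp

/-- For ε > 0 the matrix T(Y) + εI has an autoregressive density G ≻ 0 with matching Fourier
coefficients, so the perturbed pairing is the mean of tr(SG) ≥ 0. Then ε → 0. -/
theorem rowInner_rowOf_nonneg {Y : Fin (n + 1) → Matrix (Fin m) (Fin m) ℝ}
    (hY : Y ∈ blockRows m n) (hT : (toeplitz Y).PosSemidef) {S : ℤ → Matrix (Fin m) (Fin m) ℝ}
    (hS : ∀ j, S j = (S (-j))ᵀ) (hpos : ∀ θ, (trigPoly n S θ).PosSemidef) :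
    0 ≤ rowInner Y (rowOf n S) := by
  have key : ∀ ε : ℝ, 0 < ε → 0 ≤ rowInner Y (rowOf n S) + ε * (S 0).trace := by
    intro ε hε
    have hY' : Y + ε • idRow m n ∈ blockRows m n := by
      have h0 : (Y 0)ᵀ = Y 0 := hY
      simp [blockRows, Matrix.IsSymm, h0, idRow]
    have hPD : (toeplitz (Y + ε • idRow m n)).PosDef := by
      rw [toeplitz_add, toeplitz_smul, toeplitz_idRow]
      exact Matrix.PosDef.posSemidef_add hT (Matrix.PosDef.one.smul hε)
    obtain ⟨W, B, hW, hB, hB0⟩ := exists_yuleWalker hPD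
    rw [toeplitz_eq_toep] at hPD hB
    have h1 := circleMean_trace_mul_density hY'
      (continuous_shiftConj_inv hPD.posSemidef hW hB hB0)
      (fun j hj => fourierRe_shiftConj_inv hPD.posSemidef hW hB hB0 hj) hS
    rw [rowInner_add_left, rowInner_smul_left, rowInner_idRow_rowOf] at h1
    rw [← h1, ← circleMean_const (0 : ℝ)]
    refine circleMean_mono continuous_const ?_ fun θ => ?_
    · have hc := (continuous_trigPoly (n := n) S).matrix_mul
        (continuous_shiftConj_inv hPD.posSemidef hW hB hB0).matrix_conjTranspose
      exact Complex.continuous_re.comp hc.matrix_trace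
    · have h2 := (shiftConj_posDef hPD.posSemidef hW hB hB0 θ).inv.posSemidef
      exact trace_mul_re_nonneg (hpos θ) h2.conjTranspose
  by_contra hneg
  push Not at hneg
  -- This ε makes the perturbation at most half of the supposed deficit.
  have h2 := key (-rowInner Y (rowOf n S) / (2 * (|(S 0).trace| + 1)))
    (div_pos (by linarith) (by positivity))
  have h3 : -rowInner Y (rowOf n S) / (2 * (|(S 0).trace| + 1)) * (S 0).trace ≤
      -rowInner Y (rowOf n S) / 2 := by
    rw [div_mul_eq_mul_div, div_le_div_iff₀ (by positivity) two_pos]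
    have := le_abs_self (S 0).trace
    nlinarith
  linarith

/-- The map `D` as a linear map. -/
def adjTLin (m n : ℕ) : BlockMat m n →ₗ[ℝ] (Fin (n + 1) → Matrix (Fin m) (Fin m) ℝ) where
  toFun := adjT
  map_add' X Y := by
    funext j
    rw [Pi.add_apply, adjT_eq, adjT_eq, adjT_eq, ← smul_add]
    congr 1
    ext a b
    simp only [Matrix.add_apply, lagSum_apply, ← Finset.sum_add_distrib]
    exact Finset.sum_congr rfl fun h _ => Finset.sum_congr rfl fun k _ => by split_ifs <;> simp
  map_smul' c X := by
    funext j
    rw [Pi.smul_apply, adjT_eq, adjT_eq, RingHom.id_apply, smul_comm]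
    congr 1
    ext a b
    simp only [Matrix.smul_apply, lagSum_apply, smul_eq_mul, Finset.mul_sum]
    exact Finset.sum_congr rfl fun h _ => Finset.sum_congr rfl fun k _ => by split_ifs <;> simp

theorem continuous_adjT : Continuous (adjT : BlockMat m n → _) := by
  refine continuous_pi fun j => continuous_matrix fun a b => ?_
  simp only [adjT_eq, Matrix.smul_apply, lagSum_apply, smul_eq_mul]
  refine continuous_const.mul
    (continuous_finsetSum _ fun h _ => continuous_finsetSum _ fun k _ => ?_)
  split_ifs
  · exact continuous_id.matrix_elem _ _
  · exact continuous_const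

theorem trace_lagSum_zero (X : BlockMat m n) : (lagSum X 0).trace = X.trace := by
  have h1 : ∀ h k : Fin (n + 1), ((k : ℤ) - (h : ℤ) = 0) ↔ h = k := by
    intro h k; rw [Fin.ext_iff]; omega
  simp only [Matrix.trace, Matrix.diag, lagSum_apply, h1, Finset.sum_ite_eq, Finset.mem_univ,
    if_true, Fintype.sum_prod_type]
  exact Finset.sum_comm

/-- Separation takes the place of spectral factorization: a row outside the image under D of the
positive semidefinite matrices of the right trace would be separated from it by some Y,
contradicting `rowInner_rowOf_nonneg`. -/
theorem exists_posSemidef_shiftConj_eq {S : ℤ → Matrix (Fin m) (Fin m) ℝ}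
    (hS : ∀ j, S j = (S (-j))ᵀ) (hpos : ∀ θ, (trigPoly n S θ).PosSemidef) :
    ∃ L : BlockMat m n, L.PosSemidef ∧ shiftConj L = trigPoly n S := by
  have htr : ∀ θ, 0 ≤ (trigPoly n S θ).trace.re := fun θ =>
    (Complex.nonneg_iff.mp (hpos θ).trace_nonneg).1
  have hcont : Continuous fun θ => (trigPoly n S θ).trace.re :=
    Complex.continuous_re.comp (continuous_trigPoly (n := n) S).matrix_trace
  set τ := (S 0).trace with hτ
  have hmean : circleMean (fun θ => (trigPoly n S θ).trace.re) = τ := circleMean_trace_re S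
  have hτ0 : 0 ≤ τ := by
    rw [← hmean, ← circleMean_const (0 : ℝ)]
    exact circleMean_mono continuous_const hcont htr
  rcases hτ0.eq_or_lt with h0 | hτpos
  · refine ⟨0, Matrix.PosSemidef.zero, ?_⟩
    funext θ
    have h1 := eq_zero_of_circleMean_eq_zero hcont
      (fun θ => by have := periodic_trigPoly (n := n) S θ; simp only [this]) htr (hmean.trans h0.symm) θ
    have h2 : (trigPoly n S θ).trace = 0 :=
      Complex.ext h1 (Complex.nonneg_iff.mp (hpos θ).trace_nonneg).2.symm
    rw [(hpos θ).trace_eq_zero_iff.mp h2]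
    ext a b; simp [shiftConj_apply]
  -- Any Gram matrix of S has trace τ; fixing the trace makes the set compact, hence its image
  -- closed.
  set K : Set (BlockMat m n) := {L | L.PosSemidef ∧ L.trace = τ} with hK
  have hKcomp : IsCompact K := by
    refine (isCompact_abs_le _ _ τ).of_isClosed_subset ?_ fun L hL a b => ?_
    · exact (isClosed_posSemidef _).inter (isClosed_eq continuous_id.matrix_trace continuous_const)
    · exact (abs_apply_le_trace hL.1 a b).trans hL.2.le
  have hKconv : Convex ℝ K := by
    intro L hL M hM a b ha hb hab
    refine ⟨convex_posSemidef _ hL.1 hM.1 ha hb hab, ?_⟩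
    rw [Matrix.trace_add, Matrix.trace_smul, Matrix.trace_smul, hL.2, hM.2, ← add_smul, hab,
      one_smul]
  have hmem : rowOf n S ∈ adjT '' K := by
    by_contra hnot
    have := locallyConvexSpace_matrix (Fin m) (Fin m)
    obtain ⟨f, u, hfu, hf⟩ := geometric_hahn_banach_point_closed
      (hKconv.linear_image (adjTLin m n)) (hKcomp.image continuous_adjT).isClosed hnot
    obtain ⟨Y, hY, hYf⟩ := exists_rowInner_repr f.toLinearMap
    have hYr : ∀ M ∈ blockRows m n, f M = rowInner Y M := hYf
    have hL : ∀ L : BlockMat m n, L.PosSemidef → L.trace = τ → u < (toeplitz Y * L).trace := by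
      intro L hL1 hL2
      have hs := isSymm_of_posSemidef hL1
      rw [trace_toeplitz_mul hY hs, ← hYr _ (adjT_mem_blockRows hs)]
      exact hf _ ⟨L, ⟨hL1, hL2⟩, rfl⟩
    -- On `K` the trace is τ, so subtracting (u/τ)I turns the bound u into 0, and the inequality
    -- extends from `K` to the whole cone by scaling.
    have hY' : Y + (-(u / τ)) • idRow m n ∈ blockRows m n := by
      have h0 : (Y 0)ᵀ = Y 0 := hY
      simp [blockRows, Matrix.IsSymm, h0, idRow]
    have hPSD : (toeplitz (Y + (-(u / τ)) • idRow m n)).PosSemidef := by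
      refine posSemidef_of_trace_nonneg (toeplitz_isSymm hY') fun M hM => ?_
      rw [Matrix.trace_mul_comm, toeplitz_add, toeplitz_smul, toeplitz_idRow, Matrix.add_mul,
        Matrix.smul_mul, Matrix.one_mul, Matrix.trace_add, Matrix.trace_smul, smul_eq_mul]
      rcases hM.trace_nonneg.eq_or_lt with h0 | hpos
      · rw [hM.trace_eq_zero_iff.mp h0.symm]; simp
      · have h1 := hL ((τ / M.trace) • M) (hM.smul (by positivity)) (by
          rw [Matrix.trace_smul, smul_eq_mul]; field_simp)
        rw [Matrix.mul_smul, Matrix.trace_smul, smul_eq_mul, div_mul_eq_mul_div,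
          lt_div_iff₀ hpos] at h1
        have h2 : (toeplitz Y * M).trace + -(u / τ) * M.trace =
            (τ * (toeplitz Y * M).trace - u * M.trace) / τ := by
          field_simp
          ring
        rw [h2]
        exact div_nonneg (by linarith) hτ0
    have h3 := rowInner_rowOf_nonneg hY' hPSD hS hpos
    rw [rowInner_add_left, rowInner_smul_left, rowInner_idRow_rowOf, ← hτ] at h3
    rw [hYr _ (rowOf_mem_blockRows hS)] at hfu
    have h4 : -(u / τ) * τ = -u := by field_simp
    linarith
  obtain ⟨L, hL, hLS⟩ := hmem
  refine ⟨L, hL.1, ?_⟩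
  rw [shiftConj_eq_trigPoly]
  rw [← rowOf_lagSum] at hLS
  exact trigPoly_congr (eq_of_rowOf_eq (lagSum_neg (isSymm_of_posSemidef hL.1)) hS hLS)

end Gram

/-! ### The spectral problem against the dual problem. -/

section Spectral

variable {m n : ℕ}

theorem phiOne_trigPoly (S : ℤ → Matrix (Fin m) (Fin m) ℝ) :
    phiOne n (trigPoly n S) = hInf (rowOf n S) := by
  unfold phiOne rowOf
  congr 1
  funext j
  rw [coeff_eq_fourierRe, fourierRe_trigPoly]
  rw [Finset.mem_Icc]; omega

theorem phiStar_trigPoly {S : ℤ → Matrix (Fin m) (Fin m) ℝ}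
    (hpos : ∀ θ, (trigPoly n S θ).PosSemidef) : phiStar (trigPoly n S) = (S 0).trace := by
  rw [phiStar, ← circleMean_trace_re (n := n) S]
  congr 1
  funext θ
  exact sum_singularValues_eq_trace (hpos θ)

theorem circleMean_trace_correlogram {R : Fin (n + 1) → Matrix (Fin m) (Fin m) ℝ}
    (hR : R ∈ blockRows m n) {S : ℤ → Matrix (Fin m) (Fin m) ℝ} (hS : ∀ j, S j = (S (-j))ᵀ) :
    circleMean (fun θ => (trigPoly n S θ * (correlogram R θ)ᴴ).trace.re) =
      rowInner R (rowOf n S) :=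
  circleMean_trace_mul_density hR (continuous_trigPoly _)
    (fun _ hj => fourierRe_trigPoly _ hj) hS

theorem trigPoly_sub (S S' : ℤ → Matrix (Fin m) (Fin m) ℝ) (θ : ℝ) :
    trigPoly n S θ - trigPoly n S' θ = trigPoly n (fun j => S j - S' j) θ := by
  ext a b
  simp only [Matrix.sub_apply, trigPoly_apply, ← Finset.sum_sub_distrib]
  refine Finset.sum_congr rfl fun j _ => ?_
  push_cast; ring

theorem continuous_log_det {S : ℤ → Matrix (Fin m) (Fin m) ℝ}
    (hpos : ∀ θ, (trigPoly n S θ).PosDef) :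
    Continuous fun θ => Real.log (trigPoly n S θ).det.re := by
  refine Continuous.log ?_ fun θ => (re_det_pos (hpos θ)).ne'
  exact Complex.continuous_re.comp (continuous_trigPoly S).matrix_det

theorem continuous_trace_mul {S : ℤ → Matrix (Fin m) (Fin m) ℝ}
    {G : ℝ → Matrix (Fin m) (Fin m) ℂ} (hG : Continuous G) :
    Continuous fun θ => (trigPoly n S θ * (G θ)ᴴ).trace.re :=
  Complex.continuous_re.comp
    ((continuous_trigPoly S).matrix_mul hG.matrix_conjTranspose).matrix_trace

theorem spectralObjective_trigPoly {R : Fin (n + 1) → Matrix (Fin m) (Fin m) ℝ}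
    (hR : R ∈ blockRows m n) (lam gam : ℝ) {S T : ℤ → Matrix (Fin m) (Fin m) ℝ}
    (hS : ∀ j, S j = (S (-j))ᵀ) (hT : ∀ j, T j = (T (-j))ᵀ)
    (hpos : ∀ θ, (trigPoly n (fun j => S j - T j) θ).PosDef)
    (hTpos : ∀ θ, (trigPoly n T θ).PosSemidef) :
    spectralObjective R lam gam (trigPoly n S, trigPoly n T) =
      -circleMean (fun θ => Real.log (trigPoly n (fun j => S j - T j) θ).det.re) +
        rowInner R (rowOf n fun j => S j - T j) +
        lam * (gam * hInf (rowOf n S) + (T 0).trace) := by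
  have hD : ∀ j, S j - T j = (S (-j) - T (-j))ᵀ := by
    intro j; rw [Matrix.transpose_sub, ← hS, ← hT]
  have hRc : Continuous (correlogram R) := continuous_trigPoly _
  unfold spectralObjective
  simp only [trigPoly_sub]
  rw [circleMean_add (continuous_log_det hpos).fun_neg (continuous_trace_mul hRc), circleMean_neg,
    circleMean_trace_correlogram hR hD, phiOne_trigPoly, phiStar_trigPoly hTpos]

variable {R Z : Fin (n + 1) → Matrix (Fin m) (Fin m) ℝ} {W : Matrix (Fin m) (Fin m) ℝ}
  {B : Matrix (Fin m) (Fin (n + 1) × Fin m) ℝ} {lam gam : ℝ}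

theorem toeplitz_add_posDef (hWZ : (W, Z) ∈ dualFeasible R lam gam) :
    (toeplitz R + toeplitz Z).PosDef := by
  obtain ⟨-, hW, h, -⟩ := hWZ
  rw [← toeplitz_add, toeplitz_eq_toep] at h ⊢
  exact toep_posDef_of_corner_le hW h

/-- The gap is a sum of three nonnegative terms: the mean of the pointwise Fenchel gap between Σ - Λ
and (ΔXΔ*)⁻¹, the slack of Z in the support function at Σ, and the pairing of λI + T(Z) ⪰ 0 with Λ ⪰
0. Covariance matching makes the Z-terms cancel. If the sum is zero, the Fenchel gap vanishes at
each angle. -/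
theorem dual_le_spectral (hR : R ∈ blockRows m n) (hWZ : (W, Z) ∈ dualFeasible R lam gam)
    (hB : IsYuleWalker R Z W B)
    {p : (ℝ → Matrix (Fin m) (Fin m) ℂ) × (ℝ → Matrix (Fin m) (Fin m) ℂ)}
    (hp : p ∈ spectralFeasible m n) :
    dualObjective (W, Z) ≤ spectralObjective R lam gam p ∧
      (spectralObjective R lam gam p ≤ dualObjective (W, Z) →
        ∀ θ, p.1 θ - p.2 θ = shiftConj (Bᵀ * W⁻¹ * B) θ) := by
  have hPD := toeplitz_add_posDef hWZ
  obtain ⟨hZ, hW, -, hZd, hZs, hlam⟩ := hWZ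
  obtain ⟨hB, hB0⟩ := hB
  obtain ⟨S, T⟩ := p
  obtain ⟨⟨S, hS, rfl⟩, ⟨T, hT, rfl⟩, hpos, hTpos⟩ := hp
  simp only [trigPoly_sub] at hpos
  rw [← toeplitz_add, toeplitz_eq_toep] at hPD hB
  simp only at hTpos
  rw [spectralObjective_trigPoly hR lam gam hS hT hpos hTpos]
  simp only [trigPoly_sub]
  have hD : ∀ j, S j - T j = (S (-j) - T (-j))ᵀ := by
    intro j; rw [Matrix.transpose_sub, ← hS, ← hT]
  set D : ℤ → Matrix (Fin m) (Fin m) ℝ := fun j => S j - T j with hDdef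
  have hRZ : R + Z ∈ blockRows m n := by
    have h0 : (R 0)ᵀ = R 0 := hR
    have h1 : (Z 0)ᵀ = Z 0 := hZ
    simp [blockRows, Matrix.IsSymm, h0, h1]
  set X := Bᵀ * W⁻¹ * B with hX
  have hXpos : ∀ θ, (shiftConj X θ).PosDef := shiftConj_posDef hPD.posSemidef hW hB hB0
  have hXc : Continuous fun θ => (shiftConj X θ)⁻¹ :=
    continuous_shiftConj_inv hPD.posSemidef hW hB hB0
  have hm1 := circleMean_trace_mul_density hRZ hXc
    (fun j hj => fourierRe_shiftConj_inv hPD.posSemidef hW hB hB0 hj) hD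
  have hm2 := circleMean_log_det hPD.posSemidef hW hB hB0
  rw [← hX] at hm2
  have hXlog : Continuous fun θ => Real.log (shiftConj X θ).det.re := by
    have := hXpos
    rw [shiftConj_eq_trigPoly] at this ⊢
    exact continuous_log_det this
  -- The pointwise Fenchel gap, nonnegative, continuous and periodic.
  set ψ : ℝ → ℝ := fun θ => (-Real.log (trigPoly n D θ).det.re +
    (trigPoly n D θ * ((shiftConj X θ)⁻¹)ᴴ).trace.re) -
    (-Real.log (shiftConj X θ).det.re + m) with hψ
  have hinv : ∀ θ, ((shiftConj X θ)⁻¹)ᴴ = (shiftConj X θ)⁻¹ := fun θ => (hXpos θ).inv.1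
  have hlogdet : ∀ θ, Real.log (RCLike.re ((shiftConj X θ)⁻¹).det) =
      -Real.log (shiftConj X θ).det.re := by
    intro θ
    obtain ⟨h1, h2⟩ := Complex.pos_iff.mp (hXpos θ).det_pos
    have h3 : (shiftConj X θ).det = ((shiftConj X θ).det.re : ℂ) := Complex.ext rfl (by simp [← h2])
    rw [Matrix.det_nonsing_inv, Ring.inverse_eq_inv', h3, ← Complex.ofReal_inv, Complex.ofReal_re,
      ← Real.log_inv]
    rfl
  have hψ0 : ∀ θ, 0 ≤ ψ θ := by
    intro θ
    have := log_det_add_le (hpos θ) (hXpos θ).inv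
    rw [hlogdet, Fintype.card_fin] at this
    simp only [hψ, hinv]
    exact sub_nonneg.mpr this
  have hcD := continuous_log_det hpos
  have hcT : Continuous fun θ => (trigPoly n D θ * ((shiftConj X θ)⁻¹)ᴴ).trace.re :=
    continuous_trace_mul hXc
  have hψc : Continuous ψ := (hcD.neg.add hcT).sub (hXlog.neg.add continuous_const)
  have hψm : circleMean ψ = -circleMean (fun θ => Real.log (trigPoly n D θ).det.re) +
      (rowInner R (rowOf n D) + rowInner Z (rowOf n D)) - (Real.log W.det + m) := by
    rw [hψ, circleMean_sub (hcD.fun_neg.fun_add hcT) (hXlog.fun_neg.fun_add continuous_const),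
      circleMean_add hcD.fun_neg hcT, circleMean_add hXlog.fun_neg continuous_const, circleMean_neg,
      circleMean_neg, circleMean_const, hm1, hm2, rowInner_add_left, neg_neg]
  have hψm0 : 0 ≤ circleMean ψ := by
    rw [← circleMean_const (0 : ℝ)]
    exact circleMean_mono continuous_const hψc hψ0
  have h1 := rowInner_le_hInf (c := lam * gam) ⟨hZ, hZd, hZs⟩ (rowOf n S)
  have h2 : 0 ≤ lam * (T 0).trace + rowInner Z (rowOf n T) := by
    have hY : lam • idRow m n + Z ∈ blockRows m n := by
      have h0 : (Z 0)ᵀ = Z 0 := hZ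
      simp [blockRows, Matrix.IsSymm, h0, idRow]
    have h3 := rowInner_rowOf_nonneg hY
      (by rw [toeplitz_add, toeplitz_smul, toeplitz_idRow]; exact hlam) hT hTpos
    rwa [rowInner_add_left, rowInner_smul_left, rowInner_idRow_rowOf] at h3
  have h3 : rowInner Z (rowOf n D) = rowInner Z (rowOf n S) - rowInner Z (rowOf n T) :=
    rowInner_rowOf_sub Z S T
  have hobj : dualObjective (W, Z) = Real.log W.det + m := rfl
  rw [hobj]
  refine ⟨by nlinarith, fun hle θ => ?_⟩
  have hz : circleMean ψ = 0 := le_antisymm (by nlinarith) hψm0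
  have hper : Function.Periodic ψ (2 * Real.pi) := by
    intro θ
    have e1 : trigPoly n D (θ + 2 * Real.pi) = trigPoly n D θ := periodic_trigPoly D θ
    have e2 : shiftConj X (θ + 2 * Real.pi) = shiftConj X θ := by
      rw [shiftConj_eq_trigPoly]; exact periodic_trigPoly _ θ
    simp only [hψ, e1, e2]
  have h4 := eq_zero_of_circleMean_eq_zero hψc hper hψ0 hz θ
  have h5 : trigPoly n D θ * (shiftConj X θ)⁻¹ = 1 := by
    refine mul_eq_one_of_log_det_eq (hpos θ) (hXpos θ).inv ?_
    rw [hlogdet, Fintype.card_fin]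
    simp only [hψ, hinv] at h4
    exact (sub_eq_zero.mp h4).symm
  have h6 : IsUnit (shiftConj X θ).det := (Matrix.isUnit_iff_isUnit_det _).mp (hXpos θ).isUnit
  calc trigPoly n D θ = trigPoly n D θ * ((shiftConj X θ)⁻¹ * shiftConj X θ) := by
        rw [Matrix.nonsing_inv_mul _ h6, Matrix.mul_one]
    _ = shiftConj X θ := by rw [← Matrix.mul_assoc, h5, Matrix.one_mul]

theorem shiftConj_posSemidef {L : BlockMat m n} (hL : L.PosSemidef) (θ : ℝ) :
    (shiftConj L θ).PosSemidef :=
  (posSemidef_map_ofReal hL).mul_mul_conjTranspose_same _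

theorem shiftConj_add (X L : BlockMat m n) (θ : ℝ) :
    shiftConj (X + L) θ = shiftConj X θ + shiftConj L θ := by
  ext a b
  simp [shiftConj_apply, mul_add, Finset.sum_add_distrib]

/-- The two log-determinant terms agree because the mean over the circle is -log det W and X₀₀ =
W⁻¹. -/
theorem spectralObjective_shiftConj (hR : R ∈ blockRows m n)
    (hWZ : (W, Z) ∈ dualFeasible R lam gam) (hB : IsYuleWalker R Z W B) {L : BlockMat m n}
    (hL : L.PosSemidef) (hX : (Bᵀ * W⁻¹ * B).PosSemidef) (hX0 : block (Bᵀ * W⁻¹ * B) 0 0 = W⁻¹) :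
    spectralObjective R lam gam (shiftConj (Bᵀ * W⁻¹ * B + L), shiftConj L) =
      primalObjective R lam gam (Bᵀ * W⁻¹ * B, L) := by
  have hPD := toeplitz_add_posDef hWZ
  obtain ⟨hZ, hW, -⟩ := hWZ
  obtain ⟨hB, hB0⟩ := hB
  rw [← toeplitz_add, toeplitz_eq_toep] at hPD hB
  have hpos := shiftConj_posDef hPD.posSemidef hW hB hB0
  have hlog := circleMean_log_det hPD.posSemidef hW hB hB0
  set X := Bᵀ * W⁻¹ * B with hXdef
  have hsX := isSymm_of_posSemidef hX
  have hsL := isSymm_of_posSemidef hL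
  have hdiff : ∀ θ, trigPoly n (fun j => lagSum (X + L) j - lagSum L j) θ = shiftConj X θ := by
    intro θ
    rw [← trigPoly_sub, ← shiftConj_eq_trigPoly, ← shiftConj_eq_trigPoly, shiftConj_add,
      add_sub_cancel_right]
  rw [shiftConj_eq_trigPoly (X + L), shiftConj_eq_trigPoly L,
    spectralObjective_trigPoly hR lam gam (lagSum_neg (hsX.add hsL)) (lagSum_neg hsL)
      (fun θ => by rw [hdiff]; exact hpos θ)
      (fun θ => by rw [← shiftConj_eq_trigPoly]; exact shiftConj_posSemidef hL θ)]
  simp only [hdiff]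
  rw [hlog, rowInner_rowOf_sub, rowOf_lagSum, rowOf_lagSum, trace_lagSum_zero, primalObjective]
  simp only [hX0, hsX.eq]
  have hadd : adjT (X + L) = adjT X + adjT L := (adjTLin m n).map_add X L
  have h1 : rowInner R (adjT (X + L)) = rowInner R (adjT X) + rowInner R (adjT L) := by
    rw [hadd, rowInner_comm, rowInner_add_left, rowInner_comm, rowInner_comm _ R]
  rw [h1, trace_toeplitz_mul hR hsX, Matrix.det_nonsing_inv, Ring.inverse_eq_inv', Real.log_inv]
  ring

end Spectral

/-! ### Existence of a primal minimizer. -/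

section Primal

variable {m n : ℕ}

theorem continuous_hInf : Continuous (hInf : (Fin (n + 1) → Matrix (Fin m) (Fin m) ℝ) → ℝ) := by
  unfold hInf
  refine continuous_finsetSum _ fun h _ => continuous_finsetSum _ fun k _ => ?_
  split_ifs
  · simp only [← Finset.sup'_univ_eq_ciSup]
    refine Continuous.finset_sup'_apply _ fun j _ => ?_
    have h1 : ∀ a b, Continuous fun Y : Fin (n + 1) → Matrix (Fin m) (Fin m) ℝ => Y j a b :=
      fun a b => (continuous_apply j).matrix_elem a b
    exact (h1 k h).abs.max (h1 h k).abs
  · exact continuous_const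

theorem block_posSemidef {X : BlockMat m n} (hX : X.PosSemidef) : (block X 0 0).PosSemidef :=
  hX.submatrix fun a => ((0 : Fin (n + 1)), a)

theorem trace_block_le {X : BlockMat m n} (hX : X.PosSemidef) : (block X 0 0).trace ≤ X.trace := by
  have h1 : X.trace = ∑ h : Fin (n + 1), (block X h h).trace := by
    simp [Matrix.trace, block, Fintype.sum_prod_type]
  rw [h1]
  exact Finset.single_le_sum (f := fun h => (block X h h).trace)
    (fun h _ => (hX.submatrix fun a => (h, a)).trace_nonneg) (Finset.mem_univ 0)

theorem continuous_block : Continuous fun X : BlockMat m n => block X 0 0 :=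
  continuous_matrix fun a b => continuous_id.matrix_elem (0, a) (0, b)

theorem continuous_primalRest (R : Fin (n + 1) → Matrix (Fin m) (Fin m) ℝ) (lam gam : ℝ) :
    Continuous fun p : BlockMat m n × BlockMat m n => (toeplitz R * p.1ᵀ).trace +
      lam * gam * hInf (adjT (p.1 + p.2)) + lam * p.2.trace := by
  refine Continuous.add (Continuous.add ?_ ?_) ?_
  · exact (continuous_const.matrix_mul continuous_fst.matrix_transpose).matrix_trace
  · exact continuous_const.mul
      (continuous_hInf.comp (continuous_adjT.comp (continuous_fst.add continuous_snd)))
  · exact continuous_const.mul continuous_snd.matrix_trace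

variable {R : Fin (n + 1) → Matrix (Fin m) (Fin m) ℝ} {lam gam : ℝ}

/-- With T(R) ⪰ cI, half of c tr X absorbs the log-determinant at the cost of the constant `K`, and
the other half bounds tr X; λ bounds tr L. As all other terms are nonnegative, det X₀₀ ≥ exp(-v) on
the sublevel set, a closed condition that replaces X₀₀ ≻ 0. -/
theorem exists_primal_argmin (hlam : 0 < lam) (hgam : 0 < gam) (hT : (toeplitz R).PosDef) :
    ∃ p, IsArgmin (primalObjective R lam gam) (primalFeasible m n) p := by
  obtain ⟨c, hc, hTc⟩ := exists_posSemidef_sub_smul_one hT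
  have hone : block (1 : BlockMat m n) 0 0 = 1 := by ext a b; simp [block, Matrix.one_apply]
  have hfeas : ((1, 0) : BlockMat m n × BlockMat m n) ∈ primalFeasible m n :=
    ⟨by rw [hone]; exact Matrix.PosDef.one, Matrix.PosSemidef.one, Matrix.PosSemidef.zero⟩
  set v := primalObjective R lam gam (1, 0) with hv
  -- The lower bound from `log_det_add_le` with Q = (c/2)I.
  set K := Real.log (RCLike.re ((c / 2) • (1 : Matrix (Fin m) (Fin m) ℝ)).det) +
    Fintype.card (Fin m) with hK
  set C : Set (BlockMat m n × BlockMat m n) := {p | p.1.PosSemidef ∧ p.2.PosSemidef ∧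
    p.1.trace ≤ (v - K) / (c / 2) ∧ p.2.trace ≤ (v - K) / lam ∧
    Real.exp (-v) ≤ (block p.1 0 0).det} with hC
  have hsub : ∀ p ∈ primalFeasible m n, primalObjective R lam gam p ≤ v → p ∈ C := by
    rintro ⟨X, L⟩ ⟨hX0, hX, hL⟩ hle
    simp only at hX0 hX hL
    have hsX := isSymm_of_posSemidef hX
    have e1 : c * X.trace ≤ (toeplitz R * Xᵀ).trace := by
      have := trace_mul_re_nonneg hTc hX
      rw [RCLike.re_to_real, Matrix.sub_mul, Matrix.smul_mul, Matrix.one_mul, Matrix.trace_sub,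
        Matrix.trace_smul, smul_eq_mul] at this
      rw [hsX.eq]; linarith
    have e2 : 0 ≤ lam * gam * hInf (adjT (X + L)) :=
      mul_nonneg (mul_pos hlam hgam).le (hInf_nonneg _)
    have e3 : K ≤ -Real.log (block X 0 0).det + c / 2 * (block X 0 0).trace := by
      have := log_det_add_le hX0 (Matrix.PosDef.one.smul (half_pos hc))
      rw [hK]
      simpa only [Matrix.mul_smul, Matrix.mul_one, Matrix.trace_smul, smul_eq_mul,
        RCLike.re_to_real] using this
    have e4 := trace_block_le hX
    have e5 : 0 ≤ X.trace := hX.trace_nonneg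
    have e6 : 0 ≤ L.trace := hL.trace_nonneg
    have e7 : -Real.log (block X 0 0).det + (toeplitz R * Xᵀ).trace +
      lam * gam * hInf (adjT (X + L)) + lam * L.trace ≤ v := hle
    have e8 : c / 2 * (block X 0 0).trace ≤ c / 2 * X.trace :=
      mul_le_mul_of_nonneg_left e4 (half_pos hc).le
    have e9 : 0 ≤ c * X.trace := mul_nonneg hc.le e5
    have e10 : 0 ≤ lam * L.trace := mul_nonneg hlam.le e6
    refine ⟨hX, hL, ?_, ?_, ?_⟩
    · rw [le_div_iff₀ (half_pos hc)]; linarith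
    · rw [le_div_iff₀ hlam]; linarith
    · rw [← Real.le_log_iff_exp_le hX0.det_pos]; linarith
  have hCcomp : IsCompact C := by
    refine ((isCompact_abs_le _ _ ((v - K) / (c / 2))).prod
      (isCompact_abs_le _ _ ((v - K) / lam))).of_isClosed_subset ?_ ?_
    · refine ((isClosed_posSemidef _).preimage continuous_fst).inter
        (((isClosed_posSemidef _).preimage continuous_snd).inter
        ((isClosed_le continuous_fst.matrix_trace continuous_const).inter
        ((isClosed_le continuous_snd.matrix_trace continuous_const).inter
        (isClosed_le continuous_const (continuous_block.comp continuous_fst).matrix_det))))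
    · rintro ⟨X, L⟩ ⟨hX, hL, h1, h2, -⟩
      exact ⟨fun a b => (abs_apply_le_trace hX a b).trans h1,
        fun a b => (abs_apply_le_trace hL a b).trans h2⟩
  have hcont : ContinuousOn (primalObjective R lam gam) C := by
    have h1 : ContinuousOn (fun p : BlockMat m n × BlockMat m n =>
        -Real.log (block p.1 0 0).det) C :=
      ((continuous_block.comp continuous_fst).matrix_det.continuousOn.log
        fun p hp => ((Real.exp_pos _).trans_le hp.2.2.2.2).ne').neg
    refine (h1.add (continuous_primalRest R lam gam).continuousOn).congr fun p _ => ?_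
    simp only [primalObjective, Pi.add_apply]
    ring
  obtain ⟨p, hpC, hp⟩ := hCcomp.exists_isMinOn ⟨_, hsub _ hfeas le_rfl⟩ hcont
  refine ⟨p, ⟨?_, hpC.1, hpC.2.1⟩, fun q hq => ?_⟩
  · exact (block_posSemidef hpC.1).posDef_iff_det_ne_zero.mpr
      ((Real.exp_pos _).trans_le hpC.2.2.2.2).ne'
  · rcases le_total (primalObjective R lam gam q) v with h | h
    · exact hp (hsub q hq h)
    · exact (hp (hsub _ hfeas le_rfl)).trans h

end Primal

/-! ### Strong duality, complementary slackness and the form of the optimizer. -/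

section Duality

variable {m n : ℕ} {R : Fin (n + 1) → Matrix (Fin m) (Fin m) ℝ} {lam gam : ℝ}

/-- The positively homogeneous part of the primal objective. -/
def primalRest (R : Fin (n + 1) → Matrix (Fin m) (Fin m) ℝ) (lam gam : ℝ)
    (p : BlockMat m n × BlockMat m n) : ℝ :=
  (toeplitz R * p.1ᵀ).trace + lam * gam * hInf (adjT (p.1 + p.2)) + lam * p.2.trace

theorem primalObjective_eq (p : BlockMat m n × BlockMat m n) :
    primalObjective R lam gam p = -Real.log (block p.1 0 0).det + primalRest R lam gam p := by
  simp only [primalObjective, primalRest]; ring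

theorem rowInner_adjT_comb (Z : Fin (n + 1) → Matrix (Fin m) (Fin m) ℝ) (s t : ℝ)
    (P Q : BlockMat m n) :
    rowInner Z (adjT (s • P + t • Q)) = s * rowInner Z (adjT P) + t * rowInner Z (adjT Q) := by
  have h : adjT (s • P + t • Q) = s • adjT P + t • adjT Q := by
    have h1 := (adjTLin m n).map_add (s • P) (t • Q)
    rw [map_smul, map_smul] at h1
    exact h1
  rw [h, rowInner_comm, rowInner_add_left, rowInner_smul_left, rowInner_smul_left,
    rowInner_comm _ Z, rowInner_comm _ Z]

theorem primalRest_comb_le (hlam : 0 < lam) (hgam : 0 < gam) {X L U V : BlockMat m n}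
    (hX : X.PosSemidef) (hL : L.PosSemidef) (hU : U.PosSemidef) (hV : V.PosSemidef) {s t : ℝ}
    (hs : 0 ≤ s) (ht : 0 ≤ t) :
    primalRest R lam gam (s • X + t • U, s • L + t • V) ≤
      s * primalRest R lam gam (X, L) + t * primalRest R lam gam (U, V) := by
  have e : s • X + t • U + (s • L + t • V) = s • (X + L) + t • (U + V) := by
    simp only [smul_add]; abel
  have hsymm : (s • (X + L) + t • (U + V)).IsSymm := isSymm_of_posSemidef
    (((hX.add hL).smul hs).add ((hU.add hV).smul ht))
  -- Sublinearity of a support function: a `Z` optimal for the combination is admissible for each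
  -- summand.
  obtain ⟨Z, hZ, hZe⟩ := exists_rowInner_eq_hInf (mul_pos hlam hgam).le (adjT_mem_blockRows hsymm)
  have h1 := rowInner_le_hInf hZ (adjT (X + L))
  have h2 := rowInner_le_hInf hZ (adjT (U + V))
  rw [rowInner_adjT_comb] at hZe
  simp only [primalRest]
  rw [e, ← hZe]
  simp only [Matrix.transpose_add, Matrix.transpose_smul, Matrix.mul_add, Matrix.mul_smul,
    Matrix.trace_add, Matrix.trace_smul, smul_eq_mul]
  have h3 := mul_le_mul_of_nonneg_left h1 hs
  have h4 := mul_le_mul_of_nonneg_left h2 ht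
  linarith

/-- First-order condition in the direction (U, V). The Fenchel inequality at A and (A + tD)⁻¹ bounds
the change of -log det, which replaces differentiation; divide by t and let t → 0⁺. -/
theorem trace_inv_mul_le_of_argmin {X L U V : BlockMat m n} {c : ℝ}
    (hopt : IsArgmin (primalObjective R lam gam) (primalFeasible m n) (X, L))
    (h : ∀ t : ℝ, 0 < t → t < 1 → (X + t • U, L + t • V) ∈ primalFeasible m n ∧
      primalRest R lam gam (X + t • U, L + t • V) ≤ primalRest R lam gam (X, L) + t * c) :
    ((block X 0 0)⁻¹ * block U 0 0).trace ≤ c := by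
  set A := block X 0 0 with hA
  set D := block U 0 0 with hD
  have hA0 : A.PosDef := hopt.1.1
  have hb : ∀ t : ℝ, block (X + t • U) 0 0 = A + t • D := by
    intro t; ext a b; simp [hA, hD, block]
  have hle : ∀ t : ℝ, 0 < t → t < 1 → ((A + t • D)⁻¹ * D).trace ≤ c := by
    intro t h0 h1
    obtain ⟨hf, hr⟩ := h t h0 h1
    have hAt : (A + t • D).PosDef := by rw [← hb]; exact hf.1
    have hu : IsUnit (A + t • D).det := (Matrix.isUnit_iff_isUnit_det _).mp hAt.isUnit
    have e1 := log_det_add_le hA0 hAt.inv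
    have e2 : A * (A + t • D)⁻¹ = 1 - t • (D * (A + t • D)⁻¹) := by
      have := Matrix.mul_nonsing_inv _ hu
      rw [Matrix.add_mul, Matrix.smul_mul] at this
      exact eq_sub_of_add_eq this
    rw [e2, Matrix.trace_sub, Matrix.trace_one, Matrix.trace_smul, Matrix.det_nonsing_inv,
      Ring.inverse_eq_inv', RCLike.re_to_real, RCLike.re_to_real, RCLike.re_to_real, Real.log_inv,
      smul_eq_mul, Matrix.trace_mul_comm] at e1
    have e3 : primalObjective R lam gam (X, L) ≤ primalObjective R lam gam (X + t • U, L + t • V) :=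
      hopt.2 hf
    rw [primalObjective_eq, primalObjective_eq] at e3
    simp only [hb, ← hA] at e3
    have e4 : t * ((A + t • D)⁻¹ * D).trace ≤ t * c := by linarith
    exact le_of_mul_le_mul_left e4 h0
  have hexp : ∀ t : ℝ, ((A + t • D)⁻¹ * D).trace =
      (A + t • D).det⁻¹ * ((A + t • D).adjugate * D).trace := by
    intro t
    rw [Matrix.inv_def, Ring.inverse_eq_inv', Matrix.smul_mul, Matrix.trace_smul, smul_eq_mul]
  have hlin : Continuous fun t : ℝ => A + t • D :=
    continuous_const.add (continuous_id.smul continuous_const)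
  have hca : ContinuousAt (fun t : ℝ => ((A + t • D)⁻¹ * D).trace) 0 := by
    simp only [hexp]
    refine ContinuousAt.mul (ContinuousAt.inv₀ hlin.matrix_det.continuousAt ?_)
      (hlin.matrix_adjugate.matrix_mul continuous_const).matrix_trace.continuousAt
    simpa using hA0.det_pos.ne'
  have hlim : Filter.Tendsto (fun t : ℝ => ((A + t • D)⁻¹ * D).trace) (nhdsWithin 0 (Set.Ioi 0))
      (nhds (A⁻¹ * D).trace) := by
    have := hca.tendsto.mono_left (nhdsWithin_le_nhds (s := Set.Ioi 0))
    simpa using this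
  refine le_of_tendsto hlim ?_
  filter_upwards [Ioo_mem_nhdsGT (zero_lt_one (α := ℝ))] with t ht
  exact hle t ht.1 ht.2

theorem trace_corner_mul (W : Matrix (Fin m) (Fin m) ℝ) (X : BlockMat m n) :
    (corner n W * X).trace = (W * block X 0 0).trace := by
  simp only [Matrix.trace, Matrix.diag, Matrix.mul_apply, Fintype.sum_prod_type]
  rw [Fin.sum_univ_succ]
  simp [corner, block, Fin.succ_ne_zero]

theorem convex_offDiagBall (c : ℝ) : Convex ℝ (offDiagBall m n c) := by
  rintro Y ⟨hY, hYd, hYs⟩ Z ⟨hZ, hZd, hZs⟩ a b ha hb hab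
  refine ⟨?_, fun j i => by simp [hYd, hZd], fun k h hkh => ?_⟩
  · have h0 : (Y 0)ᵀ = Y 0 := hY
    have h1 : (Z 0)ᵀ = Z 0 := hZ
    simp [blockRows, Matrix.IsSymm, h0, h1]
  · calc ∑ j, (|(a • Y + b • Z) j k h| + |(a • Y + b • Z) j h k|)
        ≤ ∑ j, (a * (|Y j k h| + |Y j h k|) + b * (|Z j k h| + |Z j h k|)) := by
          refine Finset.sum_le_sum fun j _ => ?_
          have key : ∀ x y : ℝ, |a * x + b * y| ≤ a * |x| + b * |y| := by
            intro x y
            refine (abs_add_le _ _).trans ?_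
            rw [abs_mul, abs_mul, abs_of_nonneg ha, abs_of_nonneg hb]
          have h1 := key (Y j k h) (Z j k h)
          have h2 := key (Y j h k) (Z j h k)
          simp only [Pi.add_apply, Pi.smul_apply, Matrix.add_apply, Matrix.smul_apply, smul_eq_mul]
          linarith
      _ = a * ∑ j, (|Y j k h| + |Y j h k|) + b * ∑ j, (|Z j k h| + |Z j h k|) := by
          rw [Finset.sum_add_distrib, Finset.mul_sum, Finset.mul_sum]
      _ ≤ a * c + b * c := add_le_add (mul_le_mul_of_nonneg_left (hYs k h hkh) ha)
          (mul_le_mul_of_nonneg_left (hZs k h hkh) hb)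
      _ = c := by rw [← add_mul, hab, one_mul]

theorem isCompact_offDiagBall {c : ℝ} (hc : 0 ≤ c) : IsCompact (offDiagBall m n c) := by
  have hbox : IsCompact (Set.pi Set.univ fun _ : Fin (n + 1) =>
      {M : Matrix (Fin m) (Fin m) ℝ | ∀ a b, |M a b| ≤ c}) :=
    isCompact_univ_pi fun _ => isCompact_abs_le _ _ c
  have happ : ∀ j a b, Continuous fun Y : Fin (n + 1) → Matrix (Fin m) (Fin m) ℝ => Y j a b :=
    fun j a b => (continuous_apply j).matrix_elem a b
  refine hbox.of_isClosed_subset ?_ ?_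
  · have e : offDiagBall m n c = {Z | (Z 0)ᵀ = Z 0} ∩ ((⋂ j, ⋂ a, {Z | Z j a a = 0}) ∩
        ⋂ k, ⋂ h, ⋂ _ : k ≠ h, {Z | ∑ j, (|Z j k h| + |Z j h k|) ≤ c}) := by
      ext Z
      simp [offDiagBall, blockRows, Matrix.IsSymm]
    rw [e]
    refine (isClosed_eq (continuous_apply 0).matrix_transpose (continuous_apply 0)).inter
      (IsClosed.inter ?_ ?_)
    · exact isClosed_iInter fun j => isClosed_iInter fun a =>
        isClosed_eq (happ j a a) continuous_const
    · exact isClosed_iInter fun k => isClosed_iInter fun h => isClosed_iInter fun _ =>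
        isClosed_le (continuous_finsetSum _ fun j _ => (happ j k h).abs.add (happ j h k).abs)
          continuous_const
  · rintro Z ⟨-, hd, hs⟩ j - a b
    by_cases hab : a = b
    · subst hab; rw [hd]; simpa using hc
    · refine le_trans ?_ (hs a b hab)
      refine le_trans (le_add_of_nonneg_right (abs_nonneg (Z j b a))) ?_
      exact Finset.single_le_sum (f := fun j => |Z j a b| + |Z j b a|)
        (fun j _ => by positivity) (Finset.mem_univ j)

theorem continuous_toeplitz :
    Continuous (toeplitz : (Fin (n + 1) → Matrix (Fin m) (Fin m) ℝ) → BlockMat m n) :=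
  (toeplitzLin m n).continuous_of_finiteDimensional

/-- If no Z works, the compact convex image of `offDiagBall` is strictly separated from the product
of two semidefinite cones. By self-duality the separating functional is a pair (X, L) of positive
semidefinite matrices, and at a Z attaining the support function it violates the hypothesis. -/
theorem exists_multiplier (hR : R ∈ blockRows m n) (hlam : 0 < lam) (hgam : 0 < gam)
    {W : Matrix (Fin m) (Fin m) ℝ} (hW : W.IsSymm)
    (h : ∀ X L : BlockMat m n, X.PosSemidef → L.PosSemidef →
      (W * block X 0 0).trace ≤ primalRest R lam gam (X, L)) :
    ∃ Z ∈ offDiagBall m n (lam * gam), (toeplitz R + toeplitz Z - corner n W).PosSemidef ∧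
      (lam • (1 : BlockMat m n) + toeplitz Z).PosSemidef := by
  by_contra! hnot
  have hc := (mul_pos hlam hgam).le
  set Φ : (Fin (n + 1) → Matrix (Fin m) (Fin m) ℝ) → BlockMat m n × BlockMat m n := fun Z =>
    (toeplitz R + toeplitz Z - corner n W, lam • (1 : BlockMat m n) + toeplitz Z) with hΦ
  set K := Φ '' offDiagBall m n (lam * gam) with hK
  set P : Set (BlockMat m n × BlockMat m n) := {p | p.1.PosSemidef ∧ p.2.PosSemidef} with hP
  have hΦc : Continuous Φ :=
    ((continuous_const.add continuous_toeplitz).sub continuous_const).prodMk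
      (continuous_const.add continuous_toeplitz)
  have hKcomp : IsCompact K := (isCompact_offDiagBall hc).image hΦc
  have hKconv : Convex ℝ K := by
    rintro _ ⟨Y, hY, rfl⟩ _ ⟨Z, hZ, rfl⟩ a b ha hb hab
    refine ⟨a • Y + b • Z, convex_offDiagBall _ hY hZ ha hb hab, ?_⟩
    have hb' : b = 1 - a := by linarith
    subst hb'
    simp only [hΦ, toeplitz_add, toeplitz_smul]
    ext p q <;> simp <;> ring
  have hPclosed : IsClosed P := ((isClosed_posSemidef _).preimage continuous_fst).inter
    ((isClosed_posSemidef _).preimage continuous_snd)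
  have hPconv : Convex ℝ P := fun p hp q hq a b ha hb hab =>
    ⟨convex_posSemidef _ hp.1 hq.1 ha hb hab, convex_posSemidef _ hp.2 hq.2 ha hb hab⟩
  have hdisj : Disjoint K P := by
    rw [Set.disjoint_left]
    rintro _ ⟨Z, hZ, rfl⟩ ⟨h1, h2⟩
    exact hnot Z hZ h1 h2
  have := locallyConvexSpace_matrix (Fin (n + 1) × Fin m) (Fin (n + 1) × Fin m)
  obtain ⟨f, u, v, hfK, huv, hfP⟩ :=
    geometric_hahn_banach_compact_closed hKconv hKcomp hPconv hPclosed hdisj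
  have hv0 : v < 0 := by
    simpa using hfP 0 ⟨Matrix.PosSemidef.zero, Matrix.PosSemidef.zero⟩
  have hfnn : ∀ p ∈ P, 0 ≤ f p := by
    intro p hp
    by_contra! hneg
    -- The scaling puts the value of `f` exactly at `v`, against the strict bound on the cone.
    have h1 := hfP ((v / f p) • p) ⟨hp.1.smul (div_nonneg_of_nonpos hv0.le hneg.le),
      hp.2.smul (div_nonneg_of_nonpos hv0.le hneg.le)⟩
    rw [map_smul, smul_eq_mul, div_mul_cancel₀ _ hneg.ne] at h1
    exact lt_irrefl _ h1
  obtain ⟨X, hXs, hXf⟩ := exists_trace_repr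
    (f.toLinearMap ∘ₗ LinearMap.inl ℝ (BlockMat m n) (BlockMat m n))
  obtain ⟨L, hLs, hLf⟩ := exists_trace_repr
    (f.toLinearMap ∘ₗ LinearMap.inr ℝ (BlockMat m n) (BlockMat m n))
  have hX : X.PosSemidef := posSemidef_of_trace_nonneg hXs fun M hM => by
    rw [← hXf M (isSymm_of_posSemidef hM)]
    exact hfnn (M, 0) ⟨hM, Matrix.PosSemidef.zero⟩
  have hL : L.PosSemidef := posSemidef_of_trace_nonneg hLs fun M hM => by
    rw [← hLf M (isSymm_of_posSemidef hM)]
    exact hfnn (0, M) ⟨Matrix.PosSemidef.zero, hM⟩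
  obtain ⟨Z, hZ, hZe⟩ := exists_rowInner_eq_hInf hc (adjT_mem_blockRows (hXs.add hLs))
  have h1 := hfK _ ⟨Z, hZ, rfl⟩
  have hcs : (corner n W).IsSymm := by
    ext p q
    have := hW.apply p.2 q.2
    simp [corner, this, and_comm]
  have hs1 : (toeplitz R + toeplitz Z - corner n W).IsSymm :=
    ((toeplitz_isSymm hR).add (toeplitz_isSymm hZ.1)).sub hcs
  have hs2 : (lam • (1 : BlockMat m n) + toeplitz Z).IsSymm :=
    (Matrix.isSymm_one.smul lam).add (toeplitz_isSymm hZ.1)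
  have h2 : f (Φ Z) = ((toeplitz R + toeplitz Z - corner n W) * X).trace +
      ((lam • (1 : BlockMat m n) + toeplitz Z) * L).trace := by
    rw [← hXf _ hs1, ← hLf _ hs2]
    have : Φ Z = (toeplitz R + toeplitz Z - corner n W, 0) +
        (0, lam • (1 : BlockMat m n) + toeplitz Z) := by simp [hΦ]
    rw [this, map_add]
    rfl
  have h3 := h X L hX hL
  have h4 := rowInner_adjT_comb Z 1 1 X L
  rw [one_smul, one_smul, one_mul, one_mul] at h4
  rw [h2, Matrix.sub_mul, Matrix.add_mul, Matrix.add_mul, Matrix.trace_sub, Matrix.trace_add,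
    Matrix.trace_add, Matrix.smul_mul, Matrix.one_mul, Matrix.trace_smul, smul_eq_mul,
    trace_corner_mul, trace_toeplitz_mul hZ.1 hXs, trace_toeplitz_mul hZ.1 hLs] at h1
  simp only [primalRest] at h3
  rw [hXs.eq, ← hZe, h4] at h3
  linarith

theorem exists_dual_of_primal (hR : R ∈ blockRows m n) (hlam : 0 < lam) (hgam : 0 < gam)
    {X L : BlockMat m n}
    (hopt : IsArgmin (primalObjective R lam gam) (primalFeasible m n) (X, L)) :
    ∃ W Z, (W, Z) ∈ dualFeasible R lam gam ∧
      primalObjective R lam gam (X, L) ≤ dualObjective (W, Z) := by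
  obtain ⟨hX0, hX, hL⟩ := hopt.1
  simp only at hX0 hX hL
  set W := (block X 0 0)⁻¹ with hWdef
  have hW : W.PosDef := hX0.inv
  have h1 : ∀ U V : BlockMat m n, U.PosSemidef → V.PosSemidef →
      (W * block U 0 0).trace ≤ primalRest R lam gam (U, V) := by
    intro U V hU hV
    refine trace_inv_mul_le_of_argmin (V := V) hopt fun t h0 _ => ⟨⟨?_, ?_, ?_⟩, ?_⟩
    · have : block (X + t • U) 0 0 = block X 0 0 + t • block U 0 0 := by ext a b; simp [block]
      change (block (X + t • U) 0 0).PosDef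
      rw [this]
      exact hX0.add_posSemidef ((block_posSemidef hU).smul h0.le)
    · exact hX.add (hU.smul h0.le)
    · exact hL.add (hV.smul h0.le)
    · have := primalRest_comb_le (R := R) hlam hgam hX hL hU hV zero_le_one h0.le
      simpa only [one_smul, one_mul] using this
  -- The radial direction (-X, -L) scales the point by 1 - t, so t < 1 keeps it feasible;
  -- homogeneity then gives the bound that closes the duality gap.
  have h2 : primalRest R lam gam (X, L) ≤ m := by
    have h3 : (W * block (-X) 0 0).trace ≤ -primalRest R lam gam (X, L) := by
      refine trace_inv_mul_le_of_argmin (V := -L) hopt fun t h0 ht1 => ?_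
      have e1 : X + t • -X = (1 - t) • X + (0 : ℝ) • X := by
        rw [sub_smul, one_smul, zero_smul, smul_neg]; abel
      have e2 : L + t • -L = (1 - t) • L + (0 : ℝ) • L := by
        rw [sub_smul, one_smul, zero_smul, smul_neg]; abel
      have h4 := primalRest_comb_le (R := R) hlam hgam hX hL hX hL (sub_nonneg.mpr ht1.le) le_rfl
      rw [← e1, ← e2] at h4
      refine ⟨⟨?_, ?_, ?_⟩, by linarith⟩
      · have : block (X + t • -X) 0 0 = (1 - t) • block X 0 0 := by
          ext a b; simp [block]; ring
        change (block (X + t • -X) 0 0).PosDef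
        rw [this]
        exact hX0.smul (sub_pos.mpr ht1)
      · change (X + t • -X).PosSemidef
        rw [e1, zero_smul, add_zero]; exact hX.smul (sub_nonneg.mpr ht1.le)
      · change (L + t • -L).PosSemidef
        rw [e2, zero_smul, add_zero]; exact hL.smul (sub_nonneg.mpr ht1.le)
    have h5 : block (-X) 0 0 = -block X 0 0 := by ext a b; simp [block]
    rw [h5, Matrix.mul_neg, hWdef,
      Matrix.nonsing_inv_mul _ ((Matrix.isUnit_iff_isUnit_det _).mp hX0.isUnit), Matrix.trace_neg,
      Matrix.trace_one, Fintype.card_fin] at h3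
    linarith
  obtain ⟨Z, ⟨hZ, hZd, hZs⟩, hZ1, hZ2⟩ :=
    exists_multiplier hR hlam hgam (isSymm_of_posSemidef hW.posSemidef) h1
  refine ⟨W, Z, ⟨hZ, hW, hZ1, hZd, hZs, hZ2⟩, ?_⟩
  rw [primalObjective_eq]
  simp only [dualObjective, hWdef, Matrix.det_nonsing_inv, Ring.inverse_eq_inv', Real.log_inv]
  linarith

/-- The gap is a sum of four nonnegative slacks: Fenchel for (X₀₀, W), two semidefinite pairings,
and the support function. If it vanishes, so does each of them. -/
theorem dual_le_primal {W : Matrix (Fin m) (Fin m) ℝ}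
    {Z : Fin (n + 1) → Matrix (Fin m) (Fin m) ℝ} (hWZ : (W, Z) ∈ dualFeasible R lam gam)
    {X L : BlockMat m n} (hXL : (X, L) ∈ primalFeasible m n) :
    dualObjective (W, Z) ≤ primalObjective R lam gam (X, L) ∧
      (primalObjective R lam gam (X, L) ≤ dualObjective (W, Z) →
        block X 0 0 * W = 1 ∧ (toeplitz R + toeplitz Z) * X = corner n W * X) := by
  obtain ⟨hZ, hW, hRZ, hZd, hZs, hlam⟩ := hWZ
  obtain ⟨hX0, hX, hL⟩ := hXL
  simp only at hZ hW hRZ hZd hZs hlam hX0 hX hL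
  have hXs := isSymm_of_posSemidef hX
  have hLs := isSymm_of_posSemidef hL
  have e1 := log_det_add_le hX0 hW
  have e2 := trace_mul_re_nonneg hRZ hX
  have e3 := trace_mul_re_nonneg hlam hL
  have e4 := rowInner_le_hInf (c := lam * gam) ⟨hZ, hZd, hZs⟩ (adjT (X + L))
  have h4 := rowInner_adjT_comb Z 1 1 X L
  rw [one_smul, one_smul, one_mul, one_mul] at h4
  rw [h4] at e4
  have e2' : ((toeplitz R + toeplitz Z - corner n W) * X).trace =
      (toeplitz R * X).trace + rowInner Z (adjT X) - (block X 0 0 * W).trace := by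
    rw [Matrix.sub_mul, Matrix.add_mul, Matrix.trace_sub, Matrix.trace_add, trace_corner_mul,
      trace_toeplitz_mul hZ hXs, Matrix.trace_mul_comm W]
  have e3' : ((lam • (1 : BlockMat m n) + toeplitz Z) * L).trace =
      lam * L.trace + rowInner Z (adjT L) := by
    rw [Matrix.add_mul, Matrix.trace_add, Matrix.smul_mul, Matrix.one_mul, Matrix.trace_smul,
      smul_eq_mul, trace_toeplitz_mul hZ hLs]
  have hobj : primalObjective R lam gam (X, L) = -Real.log (block X 0 0).det +
      (toeplitz R * X).trace + lam * gam * hInf (adjT (X + L)) + lam * L.trace := by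
    simp only [primalObjective, hXs.eq]
  have hdual : dualObjective (W, Z) = Real.log W.det + m := rfl
  rw [hobj, hdual]
  simp only [RCLike.re_to_real, Fintype.card_fin] at e1 e2 e3
  rw [e2'] at e2
  rw [e3'] at e3
  refine ⟨by linarith, fun hle => ⟨?_, ?_⟩⟩
  · refine mul_eq_one_of_log_det_eq hX0 hW ?_
    simp only [RCLike.re_to_real, Fintype.card_fin]
    linarith
  · have h5 : (toeplitz R + toeplitz Z - corner n W) * X = 0 := by
      refine mul_eq_zero_of_trace_mul_re hRZ hX ?_
      rw [RCLike.re_to_real, e2']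
      linarith
    rw [Matrix.sub_mul] at h5
    exact sub_eq_zero.mp h5

theorem corner_mul (W : Matrix (Fin m) (Fin m) ℝ) (X : BlockMat m n) :
    corner n W * X = firstCol n W * X.submatrix (fun a => ((0 : Fin (n + 1)), a)) id := by
  ext ⟨h, a⟩ q
  simp only [Matrix.mul_apply, Fintype.sum_prod_type]
  rw [Fin.sum_univ_succ]
  by_cases hh : h = 0 <;> simp [corner, firstCol, Fin.succ_ne_zero, hh]

theorem firstCol_mul (W V : Matrix (Fin m) (Fin m) ℝ) :
    firstCol n W * V = firstCol n (W * V) := by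
  ext ⟨h, a⟩ b
  by_cases hh : h = 0 <;> simp [firstCol, Matrix.mul_apply, hh]

/-- The first block column C of X satisfies PC = [1; 0; …; 0], so invertibility of P forces Bᵀ = CW.
The same cancellation of P recovers X from B. -/
theorem yuleWalker_of_complementary {Z : Fin (n + 1) → Matrix (Fin m) (Fin m) ℝ}
    {W : Matrix (Fin m) (Fin m) ℝ} (hPD : (toeplitz R + toeplitz Z).PosDef) (hW : W.PosDef)
    {X : BlockMat m n} (hX : X.IsSymm) (hXW : block X 0 0 * W = 1)
    (hPX : (toeplitz R + toeplitz Z) * X = corner n W * X) :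
    (∃! B, IsYuleWalker R Z W B) ∧ ∀ B, IsYuleWalker R Z W B → X = Bᵀ * W⁻¹ * B := by
  set P := toeplitz R + toeplitz Z with hP
  have hu : IsUnit P.det := (Matrix.isUnit_iff_isUnit_det _).mp hPD.isUnit
  have hcancel : ∀ {κ : Type} (M N : Matrix (Fin (n + 1) × Fin m) κ ℝ), P * M = P * N → M = N := by
    intro κ M N h
    rw [← Matrix.one_mul M, ← Matrix.one_mul N, ← Matrix.nonsing_inv_mul _ hu, Matrix.mul_assoc,
      Matrix.mul_assoc, h]
  have hWu : IsUnit W.det := (Matrix.isUnit_iff_isUnit_det _).mp hW.isUnit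
  have hWs : Wᵀ = W := isSymm_of_posSemidef hW.posSemidef
  have hWX : W * block X 0 0 = 1 := mul_eq_one_comm.mp hXW
  set C : Matrix (Fin (n + 1) × Fin m) (Fin m) ℝ :=
    X.submatrix id (fun a => ((0 : Fin (n + 1)), a)) with hC
  have hCt : X.submatrix (fun a => ((0 : Fin (n + 1)), a)) id = Cᵀ := by
    rw [hC, Matrix.transpose_submatrix, hX.eq]
  have hPC : P * C = firstCol n 1 := by
    have h1 : P * C = (P * X).submatrix id (fun a => ((0 : Fin (n + 1)), a)) := rfl
    have h2 : (firstCol n W * Cᵀ).submatrix id (fun a => ((0 : Fin (n + 1)), a)) =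
        firstCol n W * block X 0 0 := by
      rw [← hCt]; rfl
    rw [h1, hPX, corner_mul, hCt, h2, firstCol_mul, hWX]
  have hYW : ∀ B, IsYuleWalker R Z W B → Bᵀ = C * W := by
    intro B hB
    apply hcancel
    rw [← Matrix.mul_assoc, hPC, firstCol_mul, Matrix.one_mul]
    exact hB.1
  have hsol : IsYuleWalker R Z W (C * W)ᵀ := by
    refine ⟨?_, ?_⟩
    · rw [Matrix.transpose_transpose, ← hP, ← Matrix.mul_assoc, hPC, firstCol_mul, Matrix.one_mul]
    · have : (Matrix.of fun a b => (C * W)ᵀ a (0, b)) = (block X 0 0 * W)ᵀ := rfl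
      rw [this, hXW, Matrix.transpose_one]
  refine ⟨⟨_, hsol, fun B hB => ?_⟩, fun B hB => ?_⟩
  · rw [← hYW B hB, Matrix.transpose_transpose]
  · have hBt := hYW B hB
    have hB' : B = W * Cᵀ := by
      rw [← Matrix.transpose_transpose B, hBt, Matrix.transpose_mul, hWs]
    apply hcancel
    rw [hPX, corner_mul, hCt, ← Matrix.mul_assoc, ← Matrix.mul_assoc, hB.1, firstCol_mul,
      Matrix.mul_nonsing_inv _ hWu, hB', ← Matrix.mul_assoc, firstCol_mul, Matrix.one_mul]

end Duality

end ARLatent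

end

/-! ### Assembly of the three statements. -/

theorem mainTheorem2 (m n : ℕ) (lam gam : ℝ) (hlam : 0 < lam) (hgam : 0 < gam)
    (R : Fin (n + 1) → Matrix (Fin m) (Fin m) ℝ) (hR : R ∈ ARLatent.blockRows m n)
    (hT : (ARLatent.toeplitz R).PosDef) :
    (∃ X₀ : ARLatent.BlockMat m n,
      (∃ L₀, ARLatent.IsArgmin (ARLatent.primalObjective R lam gam)
        (ARLatent.primalFeasible m n) (X₀, L₀)) ∧
      (∀ θ : ℝ, (ARLatent.shiftConj X₀ θ).PosDef) ∧
      (∀ X L, ARLatent.IsArgmin (ARLatent.primalObjective R lam gam)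
        (ARLatent.primalFeasible m n) (X, L) → X = X₀) ∧
      (∃ W Z, ARLatent.IsArgmax ARLatent.dualObjective
        (ARLatent.dualFeasible R lam gam) (W, Z)) ∧
      (∀ W Z, ARLatent.IsArgmax ARLatent.dualObjective
        (ARLatent.dualFeasible R lam gam) (W, Z) →
        (∃! B, ARLatent.IsYuleWalker R Z W B) ∧
        ∀ B, ARLatent.IsYuleWalker R Z W B → X₀ = Bᵀ * W⁻¹ * B)) ∧
    (∀ X L, ARLatent.IsArgmin (ARLatent.primalObjective R lam gam)
        (ARLatent.primalFeasible m n) (X, L) →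
      ARLatent.IsArgmin (ARLatent.spectralObjective R lam gam)
        (ARLatent.spectralFeasible m n)
        (ARLatent.shiftConj (X + L), ARLatent.shiftConj L) ∧
      ARLatent.spectralObjective R lam gam
        (ARLatent.shiftConj (X + L), ARLatent.shiftConj L) =
        ARLatent.primalObjective R lam gam (X, L)) ∧
    (∀ S Lam, ARLatent.IsArgmin (ARLatent.spectralObjective R lam gam)
        (ARLatent.spectralFeasible m n) (S, Lam) →
      ∃ X L, ARLatent.IsArgmin (ARLatent.primalObjective R lam gam)
        (ARLatent.primalFeasible m n) (X, L) ∧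
        S = ARLatent.shiftConj (X + L) ∧ Lam = ARLatent.shiftConj L) ∧
    (∃ S Lam, ARLatent.IsArgmin (ARLatent.spectralObjective R lam gam)
        (ARLatent.spectralFeasible m n) (S, Lam)) := by
  open ARLatent in
  obtain ⟨⟨X₀, L₀⟩, hopt⟩ := exists_primal_argmin (R := R) hlam hgam hT
  obtain ⟨W, Z, hWZ, hgap⟩ := exists_dual_of_primal hR hlam hgam hopt
  -- Any primal solution can be paired with any dual point of zero gap: varying X gives uniqueness,
  -- varying (W, Z) gives the Yule–Walker claim.
  have hslack : ∀ X L W Z, IsArgmin (primalObjective R lam gam) (primalFeasible m n) (X, L) →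
      (W, Z) ∈ dualFeasible R lam gam →
      primalObjective R lam gam (X₀, L₀) ≤ dualObjective (W, Z) →
      (∃! B, IsYuleWalker R Z W B) ∧ ∀ B, IsYuleWalker R Z W B → X = Bᵀ * W⁻¹ * B := by
    intro X L W Z hXL hWZ hle
    obtain ⟨h1, h2⟩ := (dual_le_primal hWZ hXL.1).2 ((hXL.2 hopt.1).trans hle)
    exact yuleWalker_of_complementary (toeplitz_add_posDef hWZ) hWZ.2.1
      (isSymm_of_posSemidef hXL.1.2.1) h1 h2
  have hmax : IsArgmax dualObjective (dualFeasible R lam gam) (W, Z) :=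
    ⟨hWZ, fun q hq => (dual_le_primal (W := q.1) (Z := q.2) hq hopt.1).1.trans hgap⟩
  obtain ⟨⟨B, hB, -⟩, hXB⟩ := hslack X₀ L₀ W Z hopt hWZ hgap
  have hX₀ : X₀ = Bᵀ * W⁻¹ * B := hXB B hB
  have huniq : ∀ X L, IsArgmin (primalObjective R lam gam) (primalFeasible m n) (X, L) →
      X = X₀ := fun X L hXL => by
    rw [hX₀]; exact (hslack X L W Z hXL hWZ hgap).2 B hB
  have hPD := toeplitz_add_posDef hWZ
  have hpos : ∀ θ, (shiftConj X₀ θ).PosDef := by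
    obtain ⟨h1, h2⟩ := hB
    rw [← toeplitz_add, toeplitz_eq_toep] at hPD h1
    rw [hX₀]
    exact shiftConj_posDef hPD.posSemidef hWZ.2.1 h1 h2
  have hX₀0 : block X₀ 0 0 = W⁻¹ := by
    have := ((dual_le_primal hWZ hopt.1).2 hgap).1
    exact (Matrix.inv_eq_left_inv this).symm
  have hval : ∀ L : BlockMat m n, L.PosSemidef →
      spectralObjective R lam gam (shiftConj (X₀ + L), shiftConj L) =
        primalObjective R lam gam (X₀, L) := by
    intro L hL
    have h1 := hopt.1.2.1
    simp only at h1
    rw [hX₀] at h1 hX₀0 ⊢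
    exact spectralObjective_shiftConj hR hWZ hB hL h1 hX₀0
  have hforward : ∀ X L, IsArgmin (primalObjective R lam gam) (primalFeasible m n) (X, L) →
      IsArgmin (spectralObjective R lam gam) (spectralFeasible m n)
        (shiftConj (X + L), shiftConj L) ∧
      spectralObjective R lam gam (shiftConj (X + L), shiftConj L) =
        primalObjective R lam gam (X, L) := by
    intro X L hXL
    obtain rfl := huniq X L hXL
    have hL := hXL.1.2.2
    have hX := hXL.1.2.1
    simp only at hL hX
    refine ⟨⟨⟨shiftConj_mem_pseudoPolys ((isSymm_of_posSemidef hX).add (isSymm_of_posSemidef hL)),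
      shiftConj_mem_pseudoPolys (isSymm_of_posSemidef hL), fun θ => ?_,
      fun θ => shiftConj_posSemidef hL θ⟩, fun q hq => ?_⟩, hval L hL⟩
    · simp only [shiftConj_add, add_sub_cancel_right]
      exact hpos θ
    · simp only [Set.mem_ofPred_eq]
      rw [hval L hL]
      exact ((hXL.2 hopt.1).trans hgap).trans (dual_le_spectral hR hWZ hB hq).1
  refine ⟨⟨X₀, ⟨L₀, hopt⟩, hpos, huniq, ⟨W, Z, hmax⟩, fun W' Z' hWZ' => ?_⟩, hforward, ?_,
    _, _, (hforward X₀ L₀ hopt).1⟩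
  · exact hslack X₀ L₀ W' Z' hopt hWZ'.1 (hgap.trans (hWZ'.2 hWZ))
  · intro S Lam hSL
    have hf := hforward X₀ L₀ hopt
    have hle : spectralObjective R lam gam (S, Lam) ≤ primalObjective R lam gam (X₀, L₀) :=
      (hSL.2 hf.1.1).trans hf.2.le
    -- A spectral solution attains the dual value, so the equality case fixes S - Lam; only a Gram
    -- matrix for Lam is then needed.
    have hdiff := (dual_le_spectral hR hWZ hB hSL.1).2 (hle.trans hgap)
    rw [← hX₀] at hdiff
    obtain ⟨-, ⟨T, hTs, rfl⟩, -, hTpos⟩ := hSL.1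
    obtain ⟨L, hL, hLT⟩ := exists_posSemidef_shiftConj_eq hTs hTpos
    have hS : S = shiftConj (X₀ + L) := by
      funext θ
      rw [shiftConj_add, hLT, ← hdiff θ, sub_add_cancel]
    refine ⟨X₀, L, ⟨⟨hopt.1.1, hopt.1.2.1, hL⟩, fun q hq => ?_⟩, hS, hLT.symm⟩
    have h1 : primalObjective R lam gam (X₀, L) ≤ primalObjective R lam gam (X₀, L₀) := by
      rw [← hval L hL, ← hS, hLT]; exact hle
    exact h1.trans (hopt.2 hq)
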